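/- Let $p=p_n$ be positive integers with $p/n\to\gamma\in(0,\infty)$ as $n\to\infty$. For an $n\times p$ real matrix $X$ and $k\ge 1$ let $$B_{n,k}=\frac1{n^k}\sum X_{i_0,j_0}X_{i_1,j_0}X_{i_1,j_1}X_{i_2,j_1}\cdots X_{i_{k-1},j_{k-1}}X_{i_0,j_{k-1}},$$ where the sum is over all pairwise distinct $i_0,\dots,i_{k-1}\in[n]$ and all pairwise distinct $j_0,\dots,j_{k-1}\in[p]$. Fix $l$ and let $1\le k_1<\dots<k_l$ be integers, which may depend on $n$, with $k_l=o(\sqrt{\log n})$ and $k_l\,(p/n-\gamma)\to0$, i.e. $(p/n)^{k_l}=(1+o(1))\gamma^{k_l}$ (both conditions hold automatically if the lengths do not depend on $n$). (i) Under $H_0$, i.e. when the entries of $X$ are i.i.d. $N(0,1)$, $$\left(\frac{B_{n,k_r}-p\,\mathbf 1_{k_r=1}}{\sqrt{2k_r\gamma^{k_r}}}\right)_{1\le r\le l}\xrightarrow{d}N_l(0,I_l).$$ (ii) Let $\kappa$ and the $\kappa\times\kappa$ matrices $\Sigma_\Theta,\widetilde\Sigma_\Theta,\Sigma_U,\widetilde\Sigma_U$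 be fixed, with $\widetilde\Sigma_\Theta,\widetilde\Sigma_U$ non-negative definite. For each $n$ let $\Theta\in\mathbb R^{n\times\kappa}$, $U\in\mathbb R^{p\times\kappa}$ and $Z\in\mathbb R^{n\times p}$ be mutually independent random matrices, where $Z$ has i.i.d. $N(0,1)$ entries, the rows of $\Theta$ are i.i.d. with mean $0$, covariance matrix $\Sigma_\Theta$ and sub-Gaussian with variance proxy $\widetilde\Sigma_\Theta$ (that is, $\mathbb E\,e^{t'\Theta_{i*}'}\le e^{t'\widetilde\Sigma_\Theta t/2}$ for all $t\in\mathbb R^\kappa$), and the rows of $U$ are i.i.d. with mean $0$, covariance matrix $\Sigma_U$ and sub-Gaussian with variance proxy $\widetilde\Sigma_U$. Suppose that either (1) $X=\frac1{\sqrt p}\Theta U'+Z$, and $\mu_k=\sum_{l_1,\dots,l_{2k}\in[\kappa]}\Sigma_\Theta(l_1,l_{2k})\Sigma_U(l_1,l_2)\Sigma_\Theta(l_2,l_3)\cdots\Sigma_U(l_{2k-1},l_{2k})=\operatorname{Tr}\big((\Sigma_\Theta\Sigma_U)^k\big)$; or (2) $\Sigma_U$ is positive definite, $X=\Theta V'+Z$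 with $V=U(U'U)^{-1/2}$ (and $V=0$ on the event, of vanishing probability, that $U'U$ is singular), and $\mu_k=\operatorname{Tr}(\Sigma_\Theta^k)$. Then $$\left(\frac{B_{n,k_r}-p\,\mathbf 1_{k_r=1}-\mu_{k_r}}{\sqrt{2k_r\gamma^{k_r}}}\right)_{1\le r\le l}\xrightarrow{d}N_l(0,I_l).$$ -/

import Mathlib

open MeasureTheory ProbabilityTheory Filter Topology Matrix

noncomputable section

namespace SpikedModel

/-- The bipartite signed cycle `B_{n,k}` (of length `2k`) of an `n × p` matrix `X`: the sum over
distinct `i_0, …, i_{k-1} ∈ [n]` and distinct `j_0, …, j_{k-1} ∈ [p]` of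
`X_{i_0 j_0} X_{i_1 j_0} X_{i_1 j_1} X_{i_2 j_1} ⋯ X_{i_{k-1} j_{k-1}} X_{i_0 j_{k-1}}`,
divided by `n ^ k`. Here `finRotate k` is the cyclic successor on `{0, …, k-1}`. -/
def bicycle {n p : ℕ} (k : ℕ) (X : Fin n → Fin p → ℝ) : ℝ :=
  (1 / (n : ℝ) ^ k) *
    ∑ i : Fin k ↪ Fin n, ∑ j : Fin k ↪ Fin p,
      ∏ t : Fin k, (X (i t) (j t) * X (i (finRotate k t)) (j t))

/-- The vector of the bipartite signed cycles of lengths `k 0, …, k (l-1)`, where the one of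
length `k` is centered by `p 1_{k = 1} + μ k` and divided by `√(2 k γ ^ k)`. -/
def bicycleVec {n p l : ℕ} (γ : ℝ) (μ : ℕ → ℝ) (k : Fin l → ℕ) (X : Fin n → Fin p → ℝ) :
    EuclideanSpace ℝ (Fin l) :=
  WithLp.toLp 2 fun r =>
    (bicycle (k r) X - (if k r = 1 then (p : ℝ) else 0) - μ (k r)) /
      √(2 * (k r : ℝ) * γ ^ k r)

/-- The law of an `n × p` matrix with i.i.d. standard normal entries. It is the law of the noise
`Z`, and of the data matrix `X` under the null hypothesis. -/
def noise (n p : ℕ) : Measure (Fin n → Fin p → ℝ) :=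
  Measure.pi fun _ => Measure.pi fun _ => gaussianReal 0 1

instance (n p : ℕ) : IsProbabilityMeasure (noise n p) := by
  unfold noise; infer_instance

/-- A law `ν` on `ℝ ^ κ` is sub-Gaussian with variance proxy `S`. -/
structure IsSubGaussianLaw {κ : ℕ} (ν : Measure (Fin κ → ℝ)) (S : Matrix (Fin κ) (Fin κ) ℝ) :
    Prop where
  posSemidef : S.PosSemidef
  integrable : ∀ a, Integrable (fun x => x a) ν
  mean_zero : ∀ a, ∫ x, x a ∂ν = 0
  integrable_exp : ∀ t : Fin κ → ℝ, Integrable (fun x => Real.exp (t ⬝ᵥ x)) ν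
  mgf_le : ∀ t : Fin κ → ℝ, ∫ x, Real.exp (t ⬝ᵥ x) ∂ν ≤ Real.exp ((1 / 2) * (t ⬝ᵥ (S *ᵥ t)))

/-- The class of priors on `m × κ` matrices whose rows are i.i.d. sub-Gaussian vectors with mean
zero, covariance matrix `C` and variance proxy `S`. -/
structure IsSubGaussianPrior {m κ : ℕ} (π : Measure (Fin m → Fin κ → ℝ))
    (C S : Matrix (Fin κ) (Fin κ) ℝ) : Prop where
  indep : iIndepFun (fun (i : Fin m) (T : Fin m → Fin κ → ℝ) => T i) π
  identDistrib : ∀ i j : Fin m,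
    IdentDistrib (fun T : Fin m → Fin κ → ℝ => T i) (fun T : Fin m → Fin κ → ℝ => T j) π π
  cov_eq : ∀ (i : Fin m) (a b : Fin κ),
    cov[fun T : Fin m → Fin κ → ℝ => T i a, fun T => T i b; π] = C a b
  subGaussian : ∀ i : Fin m, IsSubGaussianLaw (π.map fun T => T i) S

/-- The joint law of the mutually independent triple `(Θ, U, Z)`. -/
def jointLaw {n p κ : ℕ} (πΘ : Measure (Fin n → Fin κ → ℝ)) (πU : Measure (Fin p → Fin κ → ℝ)) :
    Measure ((Fin n → Fin κ → ℝ) × (Fin p → Fin κ → ℝ) × (Fin n → Fin p → ℝ)) :=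
  πΘ.prod (πU.prod (noise n p))

instance {n p κ : ℕ} (πΘ : Measure (Fin n → Fin κ → ℝ)) (πU : Measure (Fin p → Fin κ → ℝ))
    [IsProbabilityMeasure πΘ] [IsProbabilityMeasure πU] :
    IsProbabilityMeasure (jointLaw πΘ πU) := by
  unfold jointLaw; infer_instance

/-- The data matrix `X = p ^ (-1/2) Θ U' + Z` of the unnormalized model. -/
def dataUnnormalized {n p κ : ℕ}
    (ω : (Fin n → Fin κ → ℝ) × (Fin p → Fin κ → ℝ) × (Fin n → Fin p → ℝ)) :
    Fin n → Fin p → ℝ :=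
  fun i j => (1 / √(p : ℝ)) * (Matrix.of ω.1 * (Matrix.of ω.2.1)ᵀ) i j + ω.2.2 i j

open scoped MatrixOrder in
/-- The frame `V = U (U'U) ^ (-1/2)`. (If `U'U` is singular, the inverse, hence `V`, is `0`.) -/
def frame {p κ : ℕ} (U : Fin p → Fin κ → ℝ) : Matrix (Fin p) (Fin κ) ℝ :=
  Matrix.of U * (CFC.sqrt ((Matrix.of U)ᵀ * Matrix.of U))⁻¹

/-- The data matrix `X = Θ V' + Z`, `V = U (U'U) ^ (-1/2)`, of the normalized model. -/
def dataNormalized {n p κ : ℕ}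
    (ω : (Fin n → Fin κ → ℝ) × (Fin p → Fin κ → ℝ) × (Fin n → Fin p → ℝ)) :
    Fin n → Fin p → ℝ :=
  fun i j => (Matrix.of ω.1 * (frame ω.2.1)ᵀ) i j + ω.2.2 i j

/-- `∑ Σ_Θ(l_1, l_{2k}) Σ_U(l_1, l_2) Σ_Θ(l_2, l_3) ⋯ Σ_U(l_{2k-1}, l_{2k})`, over all
`l_1, …, l_{2k} ∈ [κ]`, for symmetric `Σ_Θ`. The pair `L t` is `(l_{2t+1}, l_{2t+2})`,
`0 ≤ t < k`. -/
def cyclicSum {κ : ℕ} (CΘ CU : Matrix (Fin κ) (Fin κ) ℝ) (k : ℕ) : ℝ :=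
  ∑ L : Fin k → Fin κ × Fin κ,
    ∏ t : Fin k, (CU (L t).1 (L t).2 * CΘ (L t).2 (L (finRotate k t)).1)

end SpikedModel

end

/-! Null case. By Lévy's continuity theorem it suffices to follow the characteristic function of a
linear combination `W` of centred, normalized signed cycles, a polynomial in independent standard
normals. Integrating by parts in one distinguished edge of each cycle gives the exact identity E[W
e^{isW}] = is E[Γ e^{isW}] (`expE_cyclePoly`), where Γ sums, over pairs of cycles with the same
distinguished edge, the product of their remaining edge variables. If Γ is L¹-close to a constant
σ², solving the resulting differential equation in s shows that W is close to N(0, σ²)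
(`norm_charFun_sub_le`). So only second moments of Γ are needed, not all moments of W.

The diagonal pairs of Γ are squares of mean one; their number is about n^{2k} γ^k
(`tendsto_card_cyc`), which the normalization turns into 1. The fluctuation of this part
(`gaussE_mainPoly_sub_sq_le`) and the pairs of different cycles (`gaussE_restPoly_sq_le`) have
relative size n^{-1/2+o(1)}: a nonzero expectation forces the cycles involved to have at least one
vertex less than the normalization pays for. The combinatorial factors k^{O(k)} and C^{O(k)} are
n^{o(1)} because k = o(√log n) (`tendsto_log_pow_mul_rpow`).

Alternatives. Given (Θ, U), the data are a deterministic signal S plus noise, and the signed cycle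
of S + Z is that of S, plus that of Z, plus mixed terms. The mixed terms are negligible since a
proper nonempty set of edges of a cycle touches more vertices than it has edges
(`card_lt_card_touched`, `gaussE_crossPoly_sq_le`). The pure signal term is n^{-k} Tr((SS')^k) up to
repeated indices, and cyclicity of the trace rewrites this through a κ × κ product of Gram matrices
(`trace_signal_pow`), which is within about n^{-1/4} of its limit; this rate survives k-th powers.
These estimates hold on typical (Θ, U), whose probability tends to 1 (`tendsto_compl_typical`).
Hence the signal only shifts the null law by μ_k. Both models have the form Θ W' + Z, with W = U/√p
or W = V, and are instances of `tendstoInDistribution_spiked`. -/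

noncomputable section

namespace SpikedModel

section

/-! ### Gaussian integration by parts -/

/-- **Stein's identity** for the standard normal law. -/
lemma integral_mul_gaussianReal {f f' : ℝ → ℂ} (hf : ∀ y, HasDerivAt f (f' y) y)
    (h0 : Integrable f (gaussianReal 0 1)) (h1 : Integrable f' (gaussianReal 0 1))
    (h2 : Integrable (fun y : ℝ => (y : ℂ) * f y) (gaussianReal 0 1)) :
    ∫ y : ℝ, (y : ℂ) * f y ∂gaussianReal 0 1 = ∫ y, f' y ∂gaussianReal 0 1 := by
  have hpdf : ∀ y : ℝ, HasDerivAt (fun y => ((gaussianPDFReal 0 1 y : ℝ) : ℂ))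
      (-(y : ℂ) * (gaussianPDFReal 0 1 y : ℝ)) y := by
    intro y
    have h : HasDerivAt (fun y => gaussianPDFReal 0 1 y) (-y * gaussianPDFReal 0 1 y) y := by
      unfold gaussianPDFReal
      have h3 : HasDerivAt (fun x : ℝ => -(x - 0) ^ 2 / (2 * ((1 : NNReal) : ℝ))) (-y) y := by
        have := ((hasDerivAt_id y).pow 2).neg.div_const 2
        convert! this using 1
        · ext x; simp
        · simp; ring
      convert! (h3.exp.const_mul ((√(2 * Real.pi * ((1 : NNReal) : ℝ)))⁻¹)) using 1
      ring
    convert! h.ofReal_comp using 1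
    push_cast; ring
  have hint : ∀ g : ℝ → ℂ, Integrable g (gaussianReal 0 1) →
      Integrable (fun y => g y * ((gaussianPDFReal 0 1 y : ℝ) : ℂ)) := by
    intro g hg
    rw [gaussianReal_of_var_ne_zero 0 one_ne_zero,
      integrable_withDensity_iff_integrable_smul₀' (by fun_prop)
        (ae_of_all _ fun x => gaussianPDF_lt_top)] at hg
    refine hg.congr (ae_of_all _ fun x => ?_)
    simp [toReal_gaussianPDF, mul_comm]
  have key := integral_mul_deriv_eq_deriv_mul_of_integrable (u := f) (u' := f')
    (v := fun y => ((gaussianPDFReal 0 1 y : ℝ) : ℂ))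
    (v' := fun y => -(y : ℂ) * (gaussianPDFReal 0 1 y : ℝ)) (fun y _ => hf y) (fun y _ => hpdf y)
    (by
      refine (hint _ h2).neg.congr (ae_of_all _ fun x => ?_)
      simp; ring)
    (hint _ h1) (hint _ h0)
  rw [integral_gaussianReal_eq_integral_smul one_ne_zero,
    integral_gaussianReal_eq_integral_smul one_ne_zero]
  have h5 : ∀ x : ℝ, gaussianPDFReal 0 1 x • ((x : ℂ) * f x)
      = -(f x * (-(x : ℂ) * (gaussianPDFReal 0 1 x : ℝ))) := by
    intro x; rw [Complex.real_smul]; ring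
  have h6 : ∀ x : ℝ, gaussianPDFReal 0 1 x • f' x = f' x * ((gaussianPDFReal 0 1 x : ℝ) : ℂ) := by
    intro x; rw [Complex.real_smul]; ring
  simp_rw [h5, h6]
  rw [integral_neg, key, neg_neg]

variable {ι : Type*} [Fintype ι]

/-- The standard Gaussian law on `ι → ℝ`. -/
def gaussPi (ι : Type*) [Fintype ι] : Measure (ι → ℝ) := Measure.pi fun _ => gaussianReal 0 1

instance : IsProbabilityMeasure (gaussPi ι) := by unfold gaussPi; infer_instance

/-- Resampling one coordinate preserves the product law. This gives Fubini in the single variable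
`e` without splitting the index type. -/
lemma measurePreserving_update [DecidableEq ι] (e : ι) :
    MeasurePreserving (fun z : (ι → ℝ) × ℝ => Function.update z.1 e z.2)
      ((gaussPi ι).prod (gaussianReal 0 1)) (gaussPi ι) := by
  have hm : Measurable (fun z : (ι → ℝ) × ℝ => Function.update z.1 e z.2) := by
    refine measurable_pi_lambda _ fun i => ?_
    by_cases h : i = e
    · subst h; simpa using measurable_snd
    · simp only [Function.update_of_ne h]
      exact (measurable_pi_apply (X := fun _ : ι => ℝ) i).comp (measurable_fst (β := ℝ))
  refine ⟨hm, ?_⟩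
  conv_rhs => rw [gaussPi]
  symm
  refine Measure.pi_eq fun s hs => ?_
  rw [Measure.map_apply hm (MeasurableSet.univ_pi hs)]
  have : (fun z : (ι → ℝ) × ℝ => Function.update z.1 e z.2) ⁻¹' (Set.univ.pi s)
      = (Set.univ.pi (Function.update s e Set.univ)) ×ˢ s e := by
    ext z
    simp only [Set.mem_preimage, Set.mem_univ_pi, Set.mem_prod]
    constructor
    · intro h
      refine ⟨fun i => ?_, by simpa using h e⟩
      by_cases hi : i = e
      · subst hi; simp
      · simpa [Function.update_of_ne hi] using h i
    · rintro ⟨h1, h2⟩ i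
      by_cases hi : i = e
      · subst hi; simpa using h2
      · simpa [Function.update_of_ne hi] using h1 i
  rw [this, Measure.prod_prod, gaussPi, Measure.pi_pi,
    ← Finset.mul_prod_erase _ _ (Finset.mem_univ e),
    ← Finset.mul_prod_erase (Finset.univ) (fun i => gaussianReal 0 1 (s i)) (Finset.mem_univ e)]
  simp only [Function.update_self, measure_univ, one_mul]
  rw [mul_comm]
  congr 1
  refine Finset.prod_congr rfl fun i hi => ?_
  rw [Function.update_of_ne (Finset.ne_of_mem_erase hi)]

open MvPolynomial in
lemma hasDerivAt_eval_update [DecidableEq ι] (p : MvPolynomial ι ℝ) (e : ι) (x : ι → ℝ) (y : ℝ) :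
    HasDerivAt (fun y => eval (Function.update x e y) p)
      (eval (Function.update x e y) (pderiv e p)) y := by
  induction p using MvPolynomial.induction_on with
  | C a => simpa using hasDerivAt_const y a
  | add p q hp hq => simpa only [map_add] using! hp.add hq
  | mul_X p i hp =>
    have hX : HasDerivAt (fun y => Function.update x e y i) (Pi.single (M := fun _ => ℝ) e 1 i) y := by
      by_cases h : i = e
      · subst h; simpa using! hasDerivAt_id y
      · simpa [Function.update_of_ne h, Pi.single_eq_of_ne h] using hasDerivAt_const y (x i)
    have := hp.mul hX
    convert! this using 1
    · ext y; simp
    · simp only [pderiv_mul, map_add, map_mul, eval_X, pderiv_X]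
      by_cases h : i = e
      · subst h; simp
      · simp [Pi.single_eq_of_ne h]

open MvPolynomial in
lemma integrable_eval (p : MvPolynomial ι ℝ) : Integrable (fun x => eval x p) (gaussPi ι) := by
  simp only [MvPolynomial.eval_eq']
  refine integrable_finsetSum _ fun m _ => Integrable.const_mul ?_ _
  refine Integrable.fintype_prod (f := fun i (y : ℝ) => y ^ m i) fun i => ?_
  have h := (memLp_id_gaussianReal' (μ := 0) (v := 1) (m i : ENNReal) (by simp))
  by_cases hm : m i = 0
  · simp [hm]
  · have := h.integrable_norm_pow hm
    refine (integrable_norm_iff (by fun_prop)).mp ?_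
    simpa using this

/-- Expectation of a polynomial in i.i.d. standard normal variables. -/
def gaussE (p : MvPolynomial ι ℝ) : ℝ := ∫ x, MvPolynomial.eval x p ∂gaussPi ι

open MvPolynomial in
/-- Gaussian integration by parts against `p e ^ (i W)`. -/
lemma integral_X_mul_mul_cexp (p W : MvPolynomial ι ℝ) (e : ι) (s : ℝ) :
    ∫ x, ((eval x (X e * p) : ℝ) : ℂ) * Complex.exp ((s * eval x W : ℝ) * Complex.I) ∂gaussPi ι =
    ∫ x, (((eval x (pderiv e p) : ℝ) : ℂ) + s * Complex.I * ((eval x (p * pderiv e W) : ℝ) : ℂ)) *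
      Complex.exp ((s * eval x W : ℝ) * Complex.I) ∂gaussPi ι := by
  classical
  have hcont : ∀ q : MvPolynomial ι ℝ, Continuous fun x => eval x q :=
    fun q => MvPolynomial.continuous_eval q
  have hI : ∀ q : MvPolynomial ι ℝ, Integrable (fun x => ((eval x q : ℝ) : ℂ) *
      Complex.exp ((s * eval x W : ℝ) * Complex.I)) (gaussPi ι) := by
    intro q
    refine (integrable_norm_iff ?_).mp ?_
    · refine Continuous.aestronglyMeasurable ?_
      have := hcont q; have := hcont W
      fun_prop
    · simp only [norm_mul, Complex.norm_exp_ofReal_mul_I, mul_one, Complex.norm_real]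
      exact (integrable_eval q).norm
  set e2 := measurePreserving_update e
  have hmeas : ∀ {F : (ι → ℝ) → ℂ}, Integrable F (gaussPi ι) → ∫ x, F x ∂gaussPi ι =
      ∫ x, ∫ y, F (Function.update x e y) ∂gaussianReal 0 1 ∂gaussPi ι := by
    intro F hF
    have h1 : ∫ x, F x ∂gaussPi ι = ∫ z, F (Function.update z.1 e z.2)
        ∂((gaussPi ι).prod (gaussianReal 0 1)) := by
      conv_lhs => rw [← e2.map_eq]
      refine integral_map e2.measurable.aemeasurable ?_
      rw [e2.map_eq]; exact hF.aestronglyMeasurable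
    rw [h1]
    exact integral_prod _ ((e2.integrable_comp hF.aestronglyMeasurable).mpr hF)
  have hsec : ∀ {F : (ι → ℝ) → ℂ}, Integrable F (gaussPi ι) → ∀ᵐ x ∂gaussPi ι,
      Integrable (fun y => F (Function.update x e y)) (gaussianReal 0 1) := by
    intro F hF
    exact ((e2.integrable_comp hF.aestronglyMeasurable).mpr hF).prod_right_ae
  have hI2 : Integrable (fun x => (((eval x (pderiv e p) : ℝ) : ℂ) + s * Complex.I *
      ((eval x (p * pderiv e W) : ℝ) : ℂ)) *
      Complex.exp ((s * eval x W : ℝ) * Complex.I)) (gaussPi ι) := by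
    have := (hI (pderiv e p)).add ((hI (p * pderiv e W)).const_mul (s * Complex.I))
    refine this.congr (ae_of_all _ fun x => ?_)
    simp only [Pi.add_apply]; ring
  rw [hmeas (hI _), hmeas hI2]
  refine integral_congr_ae ?_
  -- For almost every `x` the sections along coordinate `e` are integrable, as the one-dimensional
  -- identity requires.
  filter_upwards [hsec (hI (X e * p)), hsec (hI p), hsec hI2] with x h1 h2 h3
  have hd : ∀ y : ℝ, HasDerivAt (fun y : ℝ => ((eval (Function.update x e y) p : ℝ) : ℂ) *
      Complex.exp ((s * eval (Function.update x e y) W : ℝ) * Complex.I))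
      ((((eval (Function.update x e y) (pderiv e p) : ℝ) : ℂ) + s * Complex.I *
      ((eval (Function.update x e y) (p * pderiv e W) : ℝ) : ℂ)) *
      Complex.exp ((s * eval (Function.update x e y) W : ℝ) * Complex.I)) y := by
    intro y
    have hp := (hasDerivAt_eval_update p e x y).ofReal_comp
    have hW := (((hasDerivAt_eval_update W e x y).const_mul s).ofReal_comp.mul_const
      Complex.I).cexp
    convert! hp.mul hW using 1
    simp only [map_mul]; push_cast; ring
  have := integral_mul_gaussianReal hd h2 h3 (by
    refine h1.congr (ae_of_all _ fun y => ?_)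
    simp only [map_mul, eval_X, Function.update_self]; push_cast; ring)
  rw [← this]
  refine integral_congr_ae (ae_of_all _ fun y => ?_)
  simp only [map_mul, eval_X, Function.update_self]; push_cast; ring

open MvPolynomial

lemma gaussE_add (p q : MvPolynomial ι ℝ) : gaussE (p + q) = gaussE p + gaussE q := by
  simp only [gaussE, map_add]
  exact integral_add (integrable_eval p) (integrable_eval q)

lemma gaussE_C_mul (a : ℝ) (p : MvPolynomial ι ℝ) : gaussE (C a * p) = a * gaussE p := by
  simp only [gaussE, map_mul, eval_C]
  exact integral_const_mul _ _

lemma gaussE_sub (p q : MvPolynomial ι ℝ) : gaussE (p - q) = gaussE p - gaussE q := by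
  simp only [gaussE, map_sub]
  exact integral_sub (integrable_eval p) (integrable_eval q)

@[simp] lemma gaussE_one : gaussE (1 : MvPolynomial ι ℝ) = 1 := by simp [gaussE]

@[simp] lemma gaussE_zero : gaussE (0 : MvPolynomial ι ℝ) = 0 := by simp [gaussE]

lemma gaussE_sum {α : Type*} (s : Finset α) (p : α → MvPolynomial ι ℝ) :
    gaussE (∑ a ∈ s, p a) = ∑ a ∈ s, gaussE (p a) := by
  simp only [gaussE, map_sum]
  exact integral_finsetSum _ fun a _ => integrable_eval (p a)

lemma gaussE_X_mul (p : MvPolynomial ι ℝ) (e : ι) : gaussE (X e * p) = gaussE (pderiv e p) := by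
  -- With `W = 0` and `s = 0` the exponential factor is 1.
  have := integral_X_mul_mul_cexp p 0 e 0
  simp only [map_mul, map_zero, mul_zero, Complex.ofReal_zero, zero_mul, Complex.exp_zero,
    mul_one, add_zero] at this
  unfold gaussE
  rw [integral_complex_ofReal, integral_complex_ofReal] at this
  simp only [map_mul]
  exact_mod_cast this

/-! ### Moments of products of standard normals -/

section Moments

variable {Q : Type*}

lemma pderiv_prod_X [DecidableEq ι] [DecidableEq Q] (s : Finset Q) (e : Q → ι) (a : ι) :
    pderiv a (∏ q ∈ s, (X (e q) : MvPolynomial ι ℝ)) =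
      ∑ q ∈ s, if e q = a then ∏ r ∈ s.erase q, X (e r) else 0 := by
  induction s using Finset.induction_on with
  | empty => simp
  | insert q s hq ih =>
    rw [Finset.prod_insert hq, pderiv_mul, ih, Finset.sum_insert hq, Finset.erase_insert hq,
      pderiv_X, Finset.mul_sum]
    congr 1
    · by_cases h : e q = a
      · simp [h]
      · simp [h]
    · refine Finset.sum_congr rfl fun r hr => ?_
      have hrq : q ≠ r := fun h => hq (h ▸ hr)
      rw [Finset.erase_insert_of_ne hrq, Finset.prod_insert (by simp [hq])]
      split_ifs <;> simp

/-- One step of Wick's formula: the factor at `a` is paired with each other factor carrying the same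
variable. -/
lemma gaussE_prod_X_eq_sum [DecidableEq ι] [DecidableEq Q] (s : Finset Q) (e : Q → ι) {a : Q}
    (ha : a ∈ s) :
    gaussE (∏ q ∈ s, (X (e q) : MvPolynomial ι ℝ)) =
      ∑ q ∈ s.erase a, if e q = e a then gaussE (∏ r ∈ (s.erase a).erase q, X (e r)) else 0 := by
  rw [← Finset.mul_prod_erase s _ ha, gaussE_X_mul, pderiv_prod_X, gaussE_sum]
  refine Finset.sum_congr rfl fun q _ => ?_
  split_ifs <;> simp

/-- A product of standard normals in which some variable occurs only once has mean zero. -/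
lemma gaussE_prod_X_eq_zero (s : Finset Q) (e : Q → ι) {a : Q}
    (ha : a ∈ s) (h : ∀ q ∈ s, q ≠ a → e q ≠ e a) :
    gaussE (∏ q ∈ s, (X (e q) : MvPolynomial ι ℝ)) = 0 := by
  classical
  rw [gaussE_prod_X_eq_sum s e ha]
  refine Finset.sum_eq_zero fun q hq => ?_
  rw [Finset.mem_erase] at hq
  rw [if_neg (h q hq.2 hq.1)]

/-- The moment counts Wick pairings: each step offers fewer than `s.card` partners and removes two
factors. -/
lemma gaussE_prod_X_nonneg_le (s : Finset Q) (e : Q → ι) :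
    0 ≤ gaussE (∏ q ∈ s, (X (e q) : MvPolynomial ι ℝ)) ∧
    gaussE (∏ q ∈ s, (X (e q) : MvPolynomial ι ℝ)) ≤ (s.card : ℝ) ^ s.card := by
  classical
  induction s using Finset.strongInduction with
  | H s ih =>
    rcases s.eq_empty_or_nonempty with rfl | ⟨a, ha⟩
    · simp
    · rw [gaussE_prod_X_eq_sum s e ha]
      have hsub : ∀ q ∈ s.erase a, (s.erase a).erase q ⊂ s := fun q hq =>
        (Finset.erase_ssubset hq).trans_subset (Finset.erase_subset _ _)
      constructor
      · refine Finset.sum_nonneg fun q hq => ?_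
        split_ifs
        · exact (ih _ (hsub q hq)).1
        · exact le_rfl
      · have hc : 1 ≤ s.card := Finset.card_pos.mpr ⟨a, ha⟩
        have hc' : (1 : ℝ) ≤ s.card := by exact_mod_cast hc
        calc _ ≤ ∑ q ∈ s.erase a, (s.card : ℝ) ^ (s.card - 1) := by
              refine Finset.sum_le_sum fun q hq => ?_
              split_ifs
              · refine (ih _ (hsub q hq)).2.trans ?_
                have h1 : ((s.erase a).erase q).card ≤ s.card - 1 := by
                  rw [Finset.card_erase_of_mem hq, Finset.card_erase_of_mem ha]; omega
                calc (((s.erase a).erase q).card : ℝ) ^ ((s.erase a).erase q).card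
                    ≤ (s.card : ℝ) ^ ((s.erase a).erase q).card := by
                      refine pow_le_pow_left₀ (by positivity) ?_ _
                      exact_mod_cast h1.trans (Nat.sub_le _ _)
                  _ ≤ _ := pow_le_pow_right₀ hc' h1
              · positivity
          _ = ((s.card - 1 : ℕ) : ℝ) * (s.card : ℝ) ^ (s.card - 1) := by
              rw [Finset.sum_const, Finset.card_erase_of_mem ha, nsmul_eq_mul]
          _ ≤ (s.card : ℝ) * (s.card : ℝ) ^ (s.card - 1) := by
              gcongr; omega
          _ = _ := by rw [← pow_succ']; congr 1; omega

/-- Squares of distinct standard normals have a product of mean one. -/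
lemma gaussE_prod_X_sq (s : Finset Q) (e : Q → ι) (he : Set.InjOn e s) :
    gaussE (∏ q ∈ s, (X (e q) : MvPolynomial ι ℝ) ^ 2) = 1 := by
  classical
  induction s using Finset.induction_on with
  | empty => simp
  | insert a s ha ih =>
    rw [Finset.prod_insert ha, pow_two, mul_assoc, gaussE_X_mul, pderiv_mul, pderiv_X_self, one_mul]
    have h0 : pderiv (e a) (∏ q ∈ s, (X (e q) : MvPolynomial ι ℝ) ^ 2) = 0 := by
      have : ∏ q ∈ s, (X (e q) : MvPolynomial ι ℝ) ^ 2 = (∏ q ∈ s, X (e q)) ^ 2 := by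
        rw [Finset.prod_pow]
      rw [this, pderiv_pow, pderiv_prod_X, Finset.sum_eq_zero, mul_zero]
      intro q hq
      rw [if_neg]
      intro h
      have := he (by simp [hq]) (by simp) h
      exact ha (this ▸ hq)
    rw [h0, mul_zero, add_zero]
    exact ih (he.mono (by simp))

end Moments

end

section

/-! ### Labelled cycles and the polynomials attached to them -/

open MvPolynomial

/-- Labelled bipartite cycles of length `2k` in `[n] × [p]`. -/
abbrev Cyc (n p k : ℕ) : Type := (Fin k ↪ Fin n) × (Fin k ↪ Fin p)

/-- The edge of a cycle at a position: `(t, false)` is `(i_t, j_t)`, `(t, true)` is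
`(i_{t+1}, j_t)`. -/
def Cyc.edge {n p k : ℕ} (c : Cyc n p k) (q : Fin k × Bool) : Fin n × Fin p :=
  (bif q.2 then c.1 (finRotate k q.1) else c.1 q.1, c.2 q.1)

/-- The signed cycle as a polynomial in the entries of the matrix. -/
def bicyclePoly (n p k : ℕ) : MvPolynomial (Fin n × Fin p) ℝ :=
  C (1 / (n : ℝ) ^ k) * ∑ c : Cyc n p k, ∏ q, X (c.edge q)

lemma prod_edge {n p k : ℕ} {M : Type*} [CommMonoid M] (c : Cyc n p k) (f : Fin n × Fin p → M) :
    ∏ q, f (c.edge q) = ∏ t : Fin k, (f (c.1 t, c.2 t) * f (c.1 (finRotate k t), c.2 t)) := by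
  rw [Fintype.prod_prod_type]
  refine Finset.prod_congr rfl fun t _ => ?_
  rw [Fintype.prod_bool, mul_comm]
  rfl

lemma bicycle_eq_sum_cyc {n p : ℕ} (k : ℕ) (x : Fin n → Fin p → ℝ) :
    bicycle k x = (1 / (n : ℝ) ^ k) * ∑ c : Cyc n p k, ∏ q, x (c.edge q).1 (c.edge q).2 := by
  unfold bicycle
  rw [Fintype.sum_prod_type]
  congr 1
  refine Finset.sum_congr rfl fun i _ => Finset.sum_congr rfl fun j _ => ?_
  rw [prod_edge (i, j) fun e => x e.1 e.2]

lemma eval_bicyclePoly {n p : ℕ} (k : ℕ) (x : Fin n × Fin p → ℝ) :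
    eval x (bicyclePoly n p k) = bicycle k (fun i j => x (i, j)) := by
  rw [bicycle_eq_sum_cyc]
  simp [bicyclePoly]

/-! ### Rotations and reflections of cycles, and derivatives of signed cycles -/

section Symmetry

variable {n p k : ℕ} [NeZero k]

/-- The distinguished position. -/
def pos0 (k : ℕ) [NeZero k] : Fin k × Bool := (0, false)

/-- Every position of a cycle can be moved to the distinguished one by a rotation or reflection. -/
lemma exists_symmetry (q : Fin k × Bool) :
    ∃ (g : Cyc n p k ≃ Cyc n p k) (π : Fin k × Bool ≃ Fin k × Bool),
      π (pos0 k) = q ∧ ∀ c r, (g c).edge r = c.edge (π r) := by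
  obtain ⟨s, b⟩ := q
  cases b with
  | false =>
    -- Edges `(t, false)` are reached by the rotation by `s`.
    refine ⟨Equiv.prodCongr (Equiv.embeddingCongr (Equiv.addRight (-s)) (Equiv.refl _))
      (Equiv.embeddingCongr (Equiv.addRight (-s)) (Equiv.refl _)),
      Equiv.prodCongr (Equiv.addRight s) (Equiv.refl _), ?_, ?_⟩
    · simp [pos0]
    · rintro ⟨i, j⟩ ⟨t, b⟩
      cases b <;> simp [Cyc.edge, add_right_comm]
  | true =>
    -- Edges `(t, true)` need a reflection: columns go to `s - t` and rows to `s + 1 - t`, so that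
    -- the two edges of each column are exchanged.
    refine ⟨Equiv.prodCongr (Equiv.embeddingCongr (Equiv.subLeft (s + 1)) (Equiv.refl _))
      (Equiv.embeddingCongr (Equiv.subLeft s) (Equiv.refl _)),
      Equiv.prodCongr (Equiv.subLeft s) Equiv.boolNot, ?_, ?_⟩
    · simp [pos0]
    · rintro ⟨i, j⟩ ⟨t, b⟩
      cases b
      · simp [Cyc.edge]
        constructor <;> abel
      · simp [Cyc.edge]
        constructor <;> abel

/-- The monomial of a cycle without its distinguished edge. -/
def tailPoly (c : Cyc n p k) : MvPolynomial (Fin n × Fin p) ℝ :=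
  ∏ q ∈ Finset.univ.erase (pos0 k), X (c.edge q)

/-- The sum of the monomials of the cycles through the edge `e`, without this edge. -/
def pathPoly (n p k : ℕ) [NeZero k] (e : Fin n × Fin p) : MvPolynomial (Fin n × Fin p) ℝ :=
  ∑ c : Cyc n p k, if c.edge (pos0 k) = e then tailPoly c else 0

/-- Each of the `2k` positions at which `e` can occur contributes the same sum, by symmetry; hence
the factor `2k` in front of the sum for the distinguished position. -/
lemma pderiv_bicyclePoly (e : Fin n × Fin p) :
    pderiv e (bicyclePoly n p k) = C (2 * k / (n : ℝ) ^ k) * pathPoly n p k e := by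
  have key : ∀ q : Fin k × Bool, ∑ c : Cyc n p k, (if c.edge q = e then
      ∏ r ∈ Finset.univ.erase q, (X (c.edge r) : MvPolynomial (Fin n × Fin p) ℝ) else 0)
      = pathPoly n p k e := by
    intro q
    obtain ⟨g, π, hπ, hg⟩ := exists_symmetry (n := n) (p := p) q
    unfold pathPoly tailPoly
    conv_rhs => rw [← Equiv.sum_comp g]
    refine Finset.sum_congr rfl fun c _ => ?_
    rw [hg, hπ]
    congr 1
    refine (Finset.prod_equiv π ?_ ?_).symm
    · intro r
      simp [← hπ]
    · intro r _
      rw [hg]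
  unfold bicyclePoly
  rw [pderiv_C_mul, map_sum]
  simp_rw [pderiv_prod_X]
  rw [Finset.sum_comm]
  simp_rw [key]
  rw [Finset.sum_const, Finset.card_univ, Fintype.card_prod, Fintype.card_fin, Fintype.card_bool,
    nsmul_eq_mul, ← mul_assoc, ← map_natCast C, ← C_mul]
  congr 2
  push_cast; ring

lemma edge_injective (hk : 2 ≤ k) (c : Cyc n p k) : Function.Injective c.edge := by
  rintro ⟨t, b⟩ ⟨t', b'⟩ h
  have h1 : c.2 t = c.2 t' := congrArg Prod.snd h
  obtain rfl := c.2.injective h1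
  have h2 := congrArg Prod.fst h
  have hne : t ≠ t + 1 := by
    intro h3
    have h4 : (1 : Fin k) = 0 := by simpa using h3.symm
    have := congrArg Fin.val h4
    rw [Fin.val_one', Fin.val_zero, Nat.mod_eq_of_lt hk] at this
    omega
  cases b <;> cases b' <;> simp [Cyc.edge, hne, hne.symm] at h2 ⊢

/-- For `k = 1` the two positions carry the same edge, so injectivity on all positions fails; a
proper subset then has at most one element. This lets length one be treated together with the other
lengths. -/
lemma edge_injOn (c : Cyc n p k) {s : Finset (Fin k × Bool)} (hs : s ≠ Finset.univ) :
    Set.InjOn c.edge s := by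
  by_cases hk : 2 ≤ k
  · exact (edge_injective hk c).injOn
  · have hk1 : k = 1 := by have := NeZero.pos k; omega
    subst hk1
    have hc : s.card < 2 := by
      by_contra hcon
      apply hs
      refine Finset.eq_univ_of_card s ?_
      have := Finset.card_le_univ s
      simp at this ⊢
      omega
    intro a ha b hb _
    exact Finset.card_le_one.mp (by omega) a ha b hb

/-- Only a cycle of length one meets its distinguished edge twice. The 1 in that case is the source
of the centring by `p`. -/
lemma pderiv_tailPoly (c : Cyc n p k) :
    pderiv (c.edge (pos0 k)) (tailPoly c) = if k = 1 then 1 else 0 := by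
  unfold tailPoly
  rw [pderiv_prod_X]
  split_ifs with hk
  · subst hk
    have : (Finset.univ.erase (pos0 1)) = {((0 : Fin 1), true)} := by
      ext ⟨t, b⟩; cases b <;> simp [pos0, Subsingleton.elim t 0]
    rw [this, Finset.sum_singleton, if_pos, Finset.erase_singleton, Finset.prod_empty]
    simp [Cyc.edge, pos0]
  · have hk2 : 2 ≤ k := by have := NeZero.pos k; omega
    refine Finset.sum_eq_zero fun q hq => if_neg fun h => ?_
    exact (Finset.ne_of_mem_erase hq) (edge_injective hk2 c h)

lemma bicyclePoly_eq_tail : bicyclePoly n p k = C (1 / (n : ℝ) ^ k) *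
    ∑ c : Cyc n p k, X (c.edge (pos0 k)) * tailPoly c := by
  unfold bicyclePoly tailPoly
  congr 1
  refine Finset.sum_congr rfl fun c _ => ?_
  rw [Finset.mul_prod_erase _ (fun q => X (c.edge q)) (Finset.mem_univ _)]

end Symmetry

/-- The sum of `tail c * tail c'` over the pairs of cycles sharing their distinguished edge. -/
def pairPoly (n p k k' : ℕ) [NeZero k] [NeZero k'] : MvPolynomial (Fin n × Fin p) ℝ :=
  ∑ c : Cyc n p k, ∑ c' : Cyc n p k',
    if c'.edge (pos0 k') = c.edge (pos0 k) then tailPoly c * tailPoly c' else 0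

/-- A linear combination of centred signed cycles. -/
def cyclePoly (n p : ℕ) {l : ℕ} (b : Fin l → ℝ) (k : Fin l → ℕ) :
    MvPolynomial (Fin n × Fin p) ℝ :=
  ∑ r, C (b r) * (bicyclePoly n p (k r) - C (if k r = 1 then (p : ℝ) else 0))

/-- The carré du champ of `cyclePoly`. -/
def gammaPoly (n p : ℕ) {l : ℕ} (b : Fin l → ℝ) (k : Fin l → ℕ) [∀ r, NeZero (k r)] :
    MvPolynomial (Fin n × Fin p) ℝ :=
  ∑ r, ∑ r', C (b r * b r' * (2 * k r' / ((n : ℝ) ^ k r * (n : ℝ) ^ k r'))) *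
    pairPoly n p (k r) (k r')

lemma integrable_eval_mul_cexp {ι : Type*} [Fintype ι] (q W : MvPolynomial ι ℝ) (s : ℝ) :
    Integrable (fun x => ((eval x q : ℝ) : ℂ) *
      Complex.exp ((s * eval x W : ℝ) * Complex.I)) (gaussPi ι) := by
  have hcont : ∀ q : MvPolynomial ι ℝ, Continuous fun x => eval x q :=
    fun q => MvPolynomial.continuous_eval q
  refine (integrable_norm_iff ?_).mp ?_
  · refine Continuous.aestronglyMeasurable ?_
    have := hcont q; have := hcont W
    fun_prop
  · simp only [norm_mul, Complex.norm_exp_ofReal_mul_I, mul_one, Complex.norm_real]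
    exact (integrable_eval q).norm

/-- The functional `q ↦ E[q e^{isW}]`. -/
def expE {ι : Type*} [Fintype ι] (W : MvPolynomial ι ℝ) (s : ℝ) :
    MvPolynomial ι ℝ →ₗ[ℝ] ℂ where
  toFun q := ∫ x, ((eval x q : ℝ) : ℂ) * Complex.exp ((s * eval x W : ℝ) * Complex.I) ∂gaussPi ι
  map_add' p q := by
    rw [← integral_add (integrable_eval_mul_cexp p W s) (integrable_eval_mul_cexp q W s)]
    refine integral_congr_ae (ae_of_all _ fun x => ?_)
    simp only [map_add]; push_cast; ring
  map_smul' a q := by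
    simp only [RingHom.id_apply]
    rw [← integral_smul]
    refine integral_congr_ae (ae_of_all _ fun x => ?_)
    simp only [smul_eval, Complex.real_smul]; push_cast; ring

lemma expE_C_mul {ι : Type*} [Fintype ι] (W : MvPolynomial ι ℝ) (s a : ℝ)
    (q : MvPolynomial ι ℝ) : expE W s (C a * q) = a * expE W s q := by
  rw [← smul_eq_C_mul, map_smul, Complex.real_smul]

lemma expE_X_mul {ι : Type*} [Fintype ι] (W : MvPolynomial ι ℝ) (s : ℝ) (e : ι)
    (q : MvPolynomial ι ℝ) : expE W s (X e * q) =
      expE W s (pderiv e q) + s * Complex.I * expE W s (q * pderiv e W) := by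
  have := integral_X_mul_mul_cexp q W e s
  simp only [expE, LinearMap.coe_mk, AddHom.coe_mk]
  rw [this, ← integral_const_mul, ← integral_add (integrable_eval_mul_cexp _ W s)
    ((integrable_eval_mul_cexp _ W s).const_mul _)]
  refine integral_congr_ae (ae_of_all _ fun x => ?_)
  ring

lemma card_cyc_one (n p : ℕ) : (Fintype.card (Cyc n p 1) : ℝ) = n * p := by
  simp [Fintype.card_prod, Fintype.card_embedding_eq]

/-- Integration by parts in the distinguished edge of each cycle of length `k r`. The derivative
falling on the tail cancels the centring; the one falling on the exponential produces the cycles of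
length `k r'` through the same edge, with weight `2 k r'`. The first cycle is peeled at one edge
only, which is why the coefficients are not symmetric in `r` and `r'`. -/
lemma expE_cyclePoly {n p l : ℕ} (hn : n ≠ 0) (b : Fin l → ℝ) (k : Fin l → ℕ)
    [∀ r, NeZero (k r)] (s : ℝ) :
    expE (cyclePoly n p b k) s (cyclePoly n p b k) =
      s * Complex.I * expE (cyclePoly n p b k) s (gammaPoly n p b k) := by
  set W := cyclePoly n p b k with hW
  have hderiv : ∀ e, pderiv e W = ∑ r', C (b r' * (2 * k r' / (n : ℝ) ^ k r')) *
      pathPoly n p (k r') e := by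
    intro e
    rw [hW, cyclePoly, map_sum]
    refine Finset.sum_congr rfl fun r _ => ?_
    rw [pderiv_C_mul, map_sub, pderiv_C, sub_zero, pderiv_bicyclePoly, ← mul_assoc, ← C_mul]
  have hone : ∀ r, expE W s (bicyclePoly n p (k r) - C (if k r = 1 then (p : ℝ) else 0)) =
      s * Complex.I * expE W s (∑ r', C (b r' * (2 * k r' / ((n : ℝ) ^ k r * (n : ℝ) ^ k r'))) *
        pairPoly n p (k r) (k r')) := by
    intro r
    rw [map_sub, bicyclePoly_eq_tail, expE_C_mul, map_sum]
    simp_rw [expE_X_mul, pderiv_tailPoly]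
    rw [Finset.sum_add_distrib, ← Finset.mul_sum, ← map_sum, ← map_sum]
    -- At length one there are `n p` cycles, each contributing 1; divided by `n` this is the
    -- centring `p`.
    have h1 : ((1 / (n : ℝ) ^ k r : ℝ) : ℂ) * expE W s (∑ c : Cyc n p (k r),
        (if k r = 1 then (1 : MvPolynomial (Fin n × Fin p) ℝ) else 0)) =
        expE W s (C (if k r = 1 then (p : ℝ) else 0)) := by
      rw [← expE_C_mul]
      congr 1
      rw [Finset.sum_const, Finset.card_univ, nsmul_eq_mul]
      split_ifs with hk
      · have : (Fintype.card (Cyc n p (k r)) : MvPolynomial (Fin n × Fin p) ℝ) =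
            C ((n : ℝ) * p) := by
          rw [← map_natCast C, hk, card_cyc_one]
        rw [this, mul_one, ← C_mul, hk]
        congr 1
        field_simp
      · simp
    rw [mul_add, h1, add_sub_cancel_left, mul_left_comm, ← expE_C_mul]
    congr 2
    simp_rw [hderiv, Finset.mul_sum]
    rw [Finset.sum_comm]
    refine Finset.sum_congr rfl fun r' _ => ?_
    unfold pairPoly pathPoly
    simp only [Finset.mul_sum]
    refine Finset.sum_congr rfl fun c _ => Finset.sum_congr rfl fun c' _ => ?_
    split_ifs
    · have : C (b r' * (2 * (k r' : ℝ) / ((n : ℝ) ^ k r * (n : ℝ) ^ k r'))) =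
        (C (1 / (n : ℝ) ^ k r) * C (b r' * (2 * (k r' : ℝ) / (n : ℝ) ^ k r')) :
          MvPolynomial (Fin n × Fin p) ℝ) := by
        rw [← C_mul]; congr 1; ring
      rw [this]; ring
    · simp
  conv_lhs => arg 2; rw [hW, cyclePoly]
  rw [map_sum]
  simp_rw [expE_C_mul, hone]
  rw [gammaPoly, map_sum, Finset.mul_sum]
  refine Finset.sum_congr rfl fun r _ => ?_
  rw [mul_left_comm, ← expE_C_mul]
  congr 2
  rw [Finset.mul_sum]
  refine Finset.sum_congr rfl fun r' _ => ?_
  rw [← mul_assoc, ← C_mul]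
  congr 2; ring

end

section

/-! ### Counting -/

section Counting

variable {P V : Type*} [Fintype P] [DecidableEq V]

/-- A map with at most `v` values factors through `Fin v`: choose a label for each point and a value
for each label. -/
lemma card_filter_image_card_le [Fintype V] [Nonempty V] [DecidableEq P] (v : ℕ) :
    (Finset.univ.filter fun w : P → V => (Finset.univ.image w).card ≤ v).card ≤
      Fintype.card V ^ v * v ^ Fintype.card P := by
  have hsub : (Finset.univ.filter fun w : P → V => (Finset.univ.image w).card ≤ v) ⊆
      Finset.univ.image fun gh : (Fin v → V) × (P → Fin v) => gh.1 ∘ gh.2 := by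
    intro w hw
    simp only [Finset.mem_filter, Finset.mem_univ, true_and] at hw
    have hcard : Fintype.card (Finset.univ.image w) ≤ Fintype.card (Fin v) := by
      rw [Fintype.card_coe, Fintype.card_fin]; exact hw
    obtain ⟨f⟩ := Function.Embedding.nonempty_of_card_le hcard
    simp only [Finset.mem_image, Finset.mem_univ, true_and, Prod.exists]
    -- Labels outside the range of `f` are never used, so their value is arbitrary.
    refine ⟨Function.extend f (fun y => (y : V)) (fun _ => Classical.arbitrary V),
      fun x => f ⟨w x, by simp⟩, ?_⟩
    ext x
    simp [f.injective.extend_apply]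
  calc _ ≤ _ := Finset.card_le_card hsub
    _ ≤ _ := Finset.card_image_le
    _ = _ := by simp

/-- Every fibre has at least two points and one has at least three; sum over the fibres. A triple
point thus costs a vertex. -/
lemma two_mul_card_image_lt (w : P → V) (h2 : ∀ x, ∃ y, y ≠ x ∧ w y = w x)
    {x y z : P} (hxy : x ≠ y) (hxz : x ≠ z) (hyz : y ≠ z) (hwy : w y = w x) (hwz : w z = w x) :
    2 * (Finset.univ.image w).card + 1 ≤ Fintype.card P := by
  classical
  rw [← Finset.card_univ, Finset.card_eq_sum_card_image w, mul_comm, ← smul_eq_mul,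
    ← Finset.sum_const]
  change (∑ _v ∈ Finset.univ.image w, 2) < _
  refine Finset.sum_lt_sum ?_ ⟨w x, by simp, ?_⟩
  · intro v hv
    simp only [Finset.mem_image, Finset.mem_univ, true_and] at hv
    obtain ⟨a, rfl⟩ := hv
    obtain ⟨b, hb, hwb⟩ := h2 a
    exact Finset.one_lt_card.mpr ⟨a, by simp, b, by simp [hwb], hb.symm⟩
  · exact Finset.two_lt_card.mpr ⟨x, by simp, y, by simp [hwy], z, by simp [hwz], hxy, hxz, hyz⟩

lemma card_image_lt_of_not_injective (w : P → V) (h : ¬ Function.Injective w) :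
    (Finset.univ.image w).card ≤ Fintype.card P - 1 := by
  have h1 : (Finset.univ.image w).card ≠ Fintype.card P := by
    intro h2
    exact h (by simpa using Finset.card_image_iff.mp (h2.trans Finset.card_univ.symm))
  have h2 : (Finset.univ.image w).card ≤ Fintype.card P := Finset.card_image_le
  omega

end Counting

/-! ### Families of cycles -/

section Families

open MvPolynomial

variable {n p : ℕ}

/-- The row position of an edge position. -/
def rowPos {k : ℕ} (q : Fin k × Bool) : Fin k := bif q.2 then finRotate k q.1 else q.1

lemma edge_eq {k : ℕ} (c : Cyc n p k) (q : Fin k × Bool) :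
    c.edge q = (c.1 (rowPos q), c.2 q.1) := by
  obtain ⟨t, b⟩ := q
  cases b <;> rfl

/-- The vertices of a cycle. -/
def Cyc.vert {k : ℕ} (c : Cyc n p k) : Fin k ⊕ Fin k → Fin n ⊕ Fin p := Sum.map c.1 c.2

lemma vert_injective {k : ℕ} (c : Cyc n p k) : Function.Injective c.vert :=
  Function.Injective.sumMap c.1.injective c.2.injective

variable {A : Type*} [Fintype A] {κ : A → ℕ}

/-- The vertices of a family of cycles. -/
def famVert (c : ∀ a, Cyc n p (κ a)) (x : Σ a, Fin (κ a) ⊕ Fin (κ a)) : Fin n ⊕ Fin p :=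
  (c x.1).vert x.2

/-- Families of cycles can therefore be counted by their vertex maps. -/
lemma famVert_injective :
    Function.Injective (famVert : (∀ a, Cyc n p (κ a)) → _ → Fin n ⊕ Fin p) := by
  intro c c' h
  funext a
  refine Prod.ext ?_ ?_
  · ext t
    have := congrFun h ⟨a, Sum.inl t⟩
    simpa [famVert, Cyc.vert, Fin.ext_iff] using this
  · ext t
    have := congrFun h ⟨a, Sum.inr t⟩
    simpa [famVert, Cyc.vert, Fin.ext_iff] using this

/-- The monomial of a family of cycles, restricted to given sets of positions. -/
def famPoly (c : ∀ a, Cyc n p (κ a)) (S : ∀ a, Finset (Fin (κ a) × Bool)) :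
    MvPolynomial (Fin n × Fin p) ℝ :=
  ∏ a, ∏ q ∈ S a, X ((c a).edge q)

lemma famPoly_eq (c : ∀ a, Cyc n p (κ a)) (S : ∀ a, Finset (Fin (κ a) × Bool)) :
    famPoly c S = ∏ x ∈ Finset.univ.sigma S, X ((c x.1).edge x.2) := by
  rw [famPoly, Finset.prod_sigma]

lemma gaussE_famPoly_le (c : ∀ a, Cyc n p (κ a)) (S : ∀ a, Finset (Fin (κ a) × Bool)) {m : ℕ}
    (hm : ∑ a, 2 * κ a ≤ m) : gaussE (famPoly c S) ≤ (m : ℝ) ^ m := by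
  rw [famPoly_eq]
  refine (gaussE_prod_X_nonneg_le _ _).2.trans ?_
  have hc : (Finset.univ.sigma S).card ≤ m := by
    rw [Finset.card_sigma]
    refine (Finset.sum_le_sum fun a _ => ?_).trans hm
    refine (Finset.card_le_univ _).trans ?_
    simp [mul_comm]
  rcases Nat.eq_zero_or_pos m with rfl | hm0
  · simp only [Nat.le_zero] at hc
    simp [hc]
  · have hm1 : (1 : ℝ) ≤ m := by exact_mod_cast hm0
    calc _ ≤ (m : ℝ) ^ (Finset.univ.sigma S).card := by gcongr
      _ ≤ _ := pow_le_pow_right₀ hm1 hc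

lemma gaussE_famPoly_nonneg (c : ∀ a, Cyc n p (κ a)) (S : ∀ a, Finset (Fin (κ a) × Bool)) :
    0 ≤ gaussE (famPoly c S) := by
  rw [famPoly_eq]
  exact (gaussE_prod_X_nonneg_le _ _).1

/-- In a nonzero Gaussian moment no variable occurs just once. The selected edges of a single cycle
are distinct, so the repetition must come from another cycle. -/
lemma exists_matching_edge [∀ a, NeZero (κ a)] {c : ∀ a, Cyc n p (κ a)}
    {S : ∀ a, Finset (Fin (κ a) × Bool)}
    (hS : ∀ a, S a ≠ Finset.univ) (h : gaussE (famPoly c S) ≠ 0) (a : A)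
    (q : Fin (κ a) × Bool) (hq : q ∈ S a) :
    ∃ b, b ≠ a ∧ ∃ r ∈ S b, (c b).edge r = (c a).edge q := by
  by_contra hcon
  push Not at hcon
  apply h
  rw [famPoly_eq]
  refine gaussE_prod_X_eq_zero _ _ (a := ⟨a, q⟩) (by simp [hq]) ?_
  rintro ⟨b, r⟩ hr hne heq
  simp only [Finset.mem_sigma, Finset.mem_univ, true_and] at hr
  by_cases hb : b = a
  · subst hb
    exact hne (by rw [edge_injOn (c b) (hS b) hr hq heq])
  · exact hcon b hb r hr heq

/-- Every vertex touched by a position of `S a` is shared with another cycle. -/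
lemma exists_shared_vertex [∀ a, NeZero (κ a)] {c : ∀ a, Cyc n p (κ a)}
    {S : ∀ a, Finset (Fin (κ a) × Bool)}
    (hS : ∀ a, S a ≠ Finset.univ) (h : gaussE (famPoly c S) ≠ 0) (a : A)
    (q : Fin (κ a) × Bool) (hq : q ∈ S a) :
    (∃ b, b ≠ a ∧ ∃ y, (c b).vert y = (c a).vert (Sum.inl (rowPos q))) ∧
    (∃ b, b ≠ a ∧ ∃ y, (c b).vert y = (c a).vert (Sum.inr q.1)) := by
  obtain ⟨b, hb, r, hr, heq⟩ := exists_matching_edge hS h a q hq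
  rw [edge_eq, edge_eq, Prod.mk.injEq] at heq
  exact ⟨⟨b, hb, Sum.inl (rowPos r), by simp [Cyc.vert, heq.1]⟩,
    ⟨b, hb, Sum.inr r.1, by simp [Cyc.vert, heq.2]⟩⟩

end Families

/-! ### Cyclic indices, and the vertices touched by a set of edges of a cycle -/

section Cyclic

variable {k : ℕ} [NeZero k]

lemma ofNat_succ (t : ℕ) : Fin.ofNat k (t + 1) = Fin.ofNat k t + 1 := by
  ext
  simp [Fin.val_add]

lemma ofNat_succ_ne {t : ℕ} (h : t + 1 < k) : Fin.ofNat k (t + 1) ≠ Fin.ofNat k t := by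
  intro h1
  have := congrArg Fin.val h1
  simp only [Fin.val_ofNat, Nat.mod_eq_of_lt h, Nat.mod_eq_of_lt (Nat.lt_of_succ_lt h)] at this
  omega

lemma eq_univ_of_add_one_mem {s : Finset (Fin k)} (hs : s.Nonempty) (h : ∀ t ∈ s, t + 1 ∈ s) :
    s = Finset.univ := by
  obtain ⟨a, ha⟩ := hs
  have key : ∀ t : ℕ, a + Fin.ofNat k t ∈ s := by
    intro t
    induction t with
    | zero => simpa using ha
    | succ t ih => rw [ofNat_succ, ← add_assoc]; exact h _ ih
  refine Finset.eq_univ_of_forall fun y => ?_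
  have := key (y - a).val
  simpa using this

/-- A proper nonempty set of edges of a cycle touches more vertices than it has edges. -/
lemma card_lt_card_touched {S : Finset (Fin k × Bool)} (h0 : S.Nonempty) (h1 : S ≠ Finset.univ) :
    S.card + 1 ≤ (S.image rowPos).card + (S.image Prod.fst).card := by
  by_contra hcon
  push Not at hcon
  set A0 := Finset.univ.filter fun t : Fin k => (t, false) ∈ S with hA0
  set A1 := Finset.univ.filter fun t : Fin k => (t, true) ∈ S with hA1
  have hcard : S.card = A0.card + A1.card := by
    rw [← Finset.card_filter_add_card_filter_not (s := S) (fun q => q.2 = false)]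
    congr 1
    · refine Finset.card_bij' (fun q _ => q.1) (fun t _ => (t, false)) ?_ ?_ ?_ ?_
      · rintro ⟨t, b⟩ h; cases b <;> simp_all
      · intro t h; simp_all
      · rintro ⟨t, b⟩ h; simp_all
      · intro t h; simp_all
    · refine Finset.card_bij' (fun q _ => q.1) (fun t _ => (t, true)) ?_ ?_ ?_ ?_
      · rintro ⟨t, b⟩ h; cases b <;> simp_all
      · intro t h; simp_all
      · rintro ⟨t, b⟩ h; simp_all
      · intro t h; simp_all
  have hr0 : A0 ⊆ S.image rowPos := by
    intro t ht
    exact Finset.mem_image.mpr ⟨(t, false), by simpa [hA0] using ht, rfl⟩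
  have hr1 : A1.image (· + 1) ⊆ S.image rowPos := by
    intro t ht
    obtain ⟨u, hu, rfl⟩ := Finset.mem_image.mp ht
    exact Finset.mem_image.mpr ⟨(u, true), by simpa [hA1] using hu, by simp [rowPos]⟩
  have hc0 : A0 ⊆ S.image Prod.fst := by
    intro t ht
    exact Finset.mem_image.mpr ⟨(t, false), by simpa [hA0] using ht, rfl⟩
  have hc1 : A1 ⊆ S.image Prod.fst := by
    intro t ht
    exact Finset.mem_image.mpr ⟨(t, true), by simpa [hA1] using ht, rfl⟩
  have e1 : (A1.image (· + 1)).card = A1.card :=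
    Finset.card_image_of_injective _ (add_left_injective 1)
  have l1 := Finset.card_le_card hr0
  have l2 := Finset.card_le_card hr1
  have l3 := Finset.card_le_card hc0
  have l4 := Finset.card_le_card hc1
  -- Rows and columns each number at least `max A0.card A1.card`, so under `hcon` all these
  -- inclusions are equalities. Then `A0 = A1` is also the row set, which contains `A1 + 1`; a
  -- nonempty set stable under the successor is everything.
  have E0 : A0 = S.image Prod.fst := Finset.eq_of_subset_of_card_le hc0 (by omega)
  have E1 : A1 = S.image Prod.fst := Finset.eq_of_subset_of_card_le hc1 (by omega)
  have E2 : A0 = S.image rowPos := Finset.eq_of_subset_of_card_le hr0 (by omega)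
  have E01 : A0 = A1 := E0.trans E1.symm
  have hne : A1.Nonempty := by
    rw [E1]; exact h0.image _
  have huniv : A1 = Finset.univ := by
    refine eq_univ_of_add_one_mem hne fun t ht => ?_
    rw [← E01, E2]
    exact hr1 (Finset.mem_image_of_mem _ ht)
  apply h1
  refine Finset.eq_univ_of_forall ?_
  rintro ⟨t, b⟩
  cases b
  · have : t ∈ A0 := by rw [E01, huniv]; simp
    simpa [hA0] using this
  · have : t ∈ A1 := by rw [huniv]; simp
    simpa [hA1] using this

end Cyclic

/-! ### Vertex counts for two pairs of cycles with common distinguished edges -/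

section Quadruples

variable {n p k k' : ℕ} [NeZero k] [NeZero k']

/-- The lengths of the cycles of a pair of pairs. -/
abbrev quadLen (k k' : ℕ) (a : Bool × Bool) : ℕ := bif a.2 then k' else k

instance (a : Bool × Bool) : NeZero (quadLen k k' a) := by
  obtain ⟨x, y⟩ := a
  cases y
  · exact inferInstanceAs (NeZero k)
  · exact inferInstanceAs (NeZero k')

/-- A pair of pairs of cycles as a family. -/
def quadFam (z : Bool → Cyc n p k × Cyc n p k') : ∀ a, Cyc n p (quadLen k k' a)
  | (x, false) => (z x).1
  | (x, true) => (z x).2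

/-- If no vertex lies on three cycles of the family and two of the cycles share their
distinguished edge, these two agree. -/
lemma cycle_eq_of_no_triple {A : Type*} [Fintype A] {κ : A → ℕ} [∀ a, NeZero (κ a)]
    {c : ∀ a, Cyc n p (κ a)}
    (h : gaussE (famPoly c fun a => Finset.univ.erase (pos0 (κ a))) ≠ 0)
    (h3 : ∀ x y z, x ≠ y → x ≠ z → y ≠ z → famVert c y = famVert c x → famVert c z ≠ famVert c x)
    {a b : A} (hab : a ≠ b) (he : (c b).edge (pos0 (κ b)) = (c a).edge (pos0 (κ a))) :
    (⟨κ a, c a⟩ : Σ m, Cyc n p m) = ⟨κ b, c b⟩ := by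
  have hS : ∀ a, Finset.univ.erase (pos0 (κ a)) ≠ Finset.univ := fun a h => by
    have := Finset.mem_univ (pos0 (κ a))
    rw [← h] at this
    simp at this
  -- an edge of `c a` at a vertex shared with `c b` is an edge of `c b`
  have hmatch : ∀ q : Fin (κ a) × Bool, q ≠ pos0 (κ a) →
      (∃ y, (c b).vert y = (c a).vert (Sum.inl (rowPos q)) ∨
        (c b).vert y = (c a).vert (Sum.inr q.1)) →
      ∃ r, r ≠ pos0 (κ b) ∧ (c b).edge r = (c a).edge q := by
    rintro q hq ⟨y, hy⟩
    obtain ⟨d, hd, r, hr, heq⟩ := exists_matching_edge hS h a q (by simp [hq])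
    by_cases hdb : d = b
    · subst hdb
      exact ⟨r, by simpa using hr, heq⟩
    · exfalso
      rw [edge_eq, edge_eq, Prod.mk.injEq] at heq
      rcases hy with hy | hy
      · exact h3 ⟨a, Sum.inl (rowPos q)⟩ ⟨b, y⟩ ⟨d, Sum.inl (rowPos r)⟩
          (fun h => hab (congrArg Sigma.fst h)) (fun h => hd (congrArg Sigma.fst h).symm)
          (fun h => hdb (congrArg Sigma.fst h).symm) hy (by simp [famVert, Cyc.vert, heq.1])
      · exact h3 ⟨a, Sum.inr q.1⟩ ⟨b, y⟩ ⟨d, Sum.inr r.1⟩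
          (fun h => hab (congrArg Sigma.fst h)) (fun h => hd (congrArg Sigma.fst h).symm)
          (fun h => hdb (congrArg Sigma.fst h).symm) hy (by simp [famVert, Cyc.vert, heq.2])
  have he' := he
  rw [edge_eq, edge_eq, Prod.mk.injEq] at he'
  -- Both cycles are now walked in parallel from their common distinguished edge: agreement at
  -- column `t` forces agreement at row `t + 1`, and that in turn at column `t + 1`.
  have hrow : ∀ t, t < κ a → (c b).2 (Fin.ofNat _ t) = (c a).2 (Fin.ofNat _ t) →
      (c b).1 (Fin.ofNat _ t) = (c a).1 (Fin.ofNat _ t) →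
      (c b).1 (Fin.ofNat _ (t + 1)) = (c a).1 (Fin.ofNat _ (t + 1)) := by
    intro t ht hcol hrow
    obtain ⟨⟨t', b'⟩, hr, heq⟩ := hmatch (Fin.ofNat _ t, true) (by simp [pos0])
      ⟨Sum.inr (Fin.ofNat _ t), Or.inr (by simp [Cyc.vert, hcol, -Fin.ofNat_eq_cast])⟩
    rw [edge_eq, edge_eq, Prod.mk.injEq] at heq
    have ht' : t' = Fin.ofNat _ t := (c b).2.injective (heq.2.trans hcol.symm)
    subst ht'
    cases b' with
    | true => simpa [rowPos, ofNat_succ, -Fin.ofNat_eq_cast] using heq.1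
    -- A match with the other edge of this column would make rows `t` and `t + 1` of `c a` equal.
    -- That is possible only at length one, where `t = 0` and the matching position would be the
    -- excluded `pos0`.
    | false =>
      exfalso
      have h1 : (c a).1 (Fin.ofNat _ t) = (c a).1 (Fin.ofNat _ (t + 1)) := by
        rw [← hrow]; simpa [rowPos, ofNat_succ, -Fin.ofNat_eq_cast] using heq.1
      have h2 := (c a).1.injective h1
      have ht0 : t ≠ 0 := by
        rintro rfl
        exact hr (by simp [pos0])
      rcases Nat.lt_or_ge (t + 1) (κ a) with hlt | hge
      · exact ofNat_succ_ne hlt h2.symm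
      · have : t + 1 = κ a := by omega
        have h4 := congrArg Fin.val h2
        simp only [Fin.val_ofNat, this, Nat.mod_self, Nat.mod_eq_of_lt ht] at h4
        exact ht0 h4
  have hcolstep : ∀ t, t + 1 < κ a → (c b).2 (Fin.ofNat _ t) = (c a).2 (Fin.ofNat _ t) →
      (c b).1 (Fin.ofNat _ (t + 1)) = (c a).1 (Fin.ofNat _ (t + 1)) →
      (c b).2 (Fin.ofNat _ (t + 1)) = (c a).2 (Fin.ofNat _ (t + 1)) := by
    intro t ht hcol hrow
    obtain ⟨⟨t', b'⟩, hr, heq⟩ := hmatch (Fin.ofNat _ (t + 1), false)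
      (by
        intro h
        have := congrArg (fun q => Fin.val q.1) h
        simp [pos0, Nat.mod_eq_of_lt ht] at this)
      ⟨Sum.inl (Fin.ofNat _ (t + 1)), Or.inl (by simpa [Cyc.vert, rowPos] using hrow)⟩
    rw [edge_eq, edge_eq, Prod.mk.injEq] at heq
    have h1 : rowPos (t', b') = Fin.ofNat _ (t + 1) :=
      (c b).1.injective (heq.1.trans (by simpa [rowPos] using hrow.symm))
    cases b' with
    | false =>
      have : t' = Fin.ofNat _ (t + 1) := by simpa [rowPos] using h1
      subst this
      exact heq.2
    | true =>
      exfalso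
      have h2 : t' = Fin.ofNat _ t := by
        rw [ofNat_succ] at h1
        simpa [rowPos] using h1
      subst h2
      have h4 : (c a).2 (Fin.ofNat _ t) = (c a).2 (Fin.ofNat _ (t + 1)) := hcol.symm.trans heq.2
      exact ofNat_succ_ne ht ((c a).2.injective h4).symm
  have hall : ∀ t, t < κ a → (c b).1 (Fin.ofNat _ t) = (c a).1 (Fin.ofNat _ t) ∧
      (c b).2 (Fin.ofNat _ t) = (c a).2 (Fin.ofNat _ t) := by
    intro t
    induction t with
    | zero => intro _; simpa [pos0, rowPos] using he'
    | succ t ih =>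
      intro ht
      obtain ⟨h1, h2⟩ := ih (by omega)
      have h3 := hrow t (by omega) h2 h1
      exact ⟨h3, hcolstep t ht h2 h3⟩
  -- The walk closes in `c a` after `κ a` steps, hence also in `c b`, so `κ b` divides `κ a`. If `κ
  -- b` were smaller, the closing of `c b` would repeat a row of `c a` too early.
  have hlen : κ a = κ b := by
    have ha := NeZero.pos (κ a)
    have hb := NeZero.pos (κ b)
    obtain ⟨h1, h2⟩ := hall (κ a - 1) (by omega)
    have h5 := hrow (κ a - 1) (by omega) h2 h1
    rw [Nat.sub_add_cancel ha] at h5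
    have h6 := (hall 0 ha).1
    have h7 : (Fin.ofNat (κ a) (κ a)) = Fin.ofNat (κ a) 0 := by ext; simp
    rw [h7, ← h6] at h5
    have h8 := congrArg Fin.val ((c b).1.injective h5)
    simp only [Fin.val_ofNat, Nat.zero_mod] at h8
    rcases Nat.lt_trichotomy (κ a) (κ b) with hlt | heq | hgt
    · rw [Nat.mod_eq_of_lt hlt] at h8; omega
    · exact heq
    · exfalso
      have h9 := (hall (κ b) hgt).1
      have h10 : (Fin.ofNat (κ b) (κ b)) = Fin.ofNat (κ b) 0 := by ext; simp
      rw [h10, h6] at h9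
      have h11 := congrArg Fin.val ((c a).1.injective h9)
      simp only [Fin.val_ofNat, Nat.zero_mod, Nat.mod_eq_of_lt hgt] at h11
      omega
  -- The lengths `κ a` and `κ b` are not variables; they are generalized so that their equality can
  -- be substituted.
  have gen : ∀ (m m' : ℕ) [NeZero m] [NeZero m'] (d : Cyc n p m) (d' : Cyc n p m'), m = m' →
      (∀ t, t < m → d'.1 (Fin.ofNat _ t) = d.1 (Fin.ofNat _ t) ∧
        d'.2 (Fin.ofNat _ t) = d.2 (Fin.ofNat _ t)) →
      (⟨m, d⟩ : Σ m, Cyc n p m) = ⟨m', d'⟩ := by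
    intro m m' _ _ d d' hmm hd
    subst hmm
    congr 1
    refine Prod.ext ?_ ?_
    · ext t; have := (hd t.val t.isLt).1; simp at this; rw [this]
    · ext t; have := (hd t.val t.isLt).2; simp at this; rw [this]
  exact gen _ _ _ _ hlen hall

/-- Every vertex lies on an edge other than the distinguished one, hence on at least two of the four
cycles; so the `4 (k + k')` vertex positions have at most `2 (k + k')` values. Equality rules out
vertices on three cycles, and then the two cycles of the first pair coincide, against `hne`. -/
lemma card_image_quad_le {z : Bool → Cyc n p k × Cyc n p k'}
    (h : gaussE (famPoly (quadFam z) fun _ => Finset.univ.erase (pos0 _)) ≠ 0)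
    (he : (z true).2.edge (pos0 k') = (z true).1.edge (pos0 k))
    (hne : (⟨k, (z true).1⟩ : Σ m, Cyc n p m) ≠ ⟨k', (z true).2⟩) :
    (Finset.univ.image (famVert (quadFam z))).card ≤ 2 * (k + k') - 1 := by
  have hS : ∀ a, Finset.univ.erase (pos0 (quadLen k k' a)) ≠ Finset.univ := fun a h => by
    have := Finset.mem_univ (pos0 (quadLen k k' a))
    rw [← h] at this
    simp at this
  have h2 : ∀ x, ∃ y, y ≠ x ∧ famVert (quadFam z) y = famVert (quadFam z) x := by
    rintro ⟨a, x⟩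
    cases x with
    | inl t =>
      -- the row vertex `t` lies on the edge `(t - 1, true)`
      obtain ⟨⟨b, hb, y, hy⟩, -⟩ := exists_shared_vertex hS h a (t - 1, true) (by simp [pos0])
      refine ⟨⟨b, y⟩, fun h => hb (congrArg Sigma.fst h), ?_⟩
      simpa [famVert, rowPos] using hy
    | inr t =>
      obtain ⟨-, ⟨b, hb, y, hy⟩⟩ := exists_shared_vertex hS h a (t, true) (by simp [pos0])
      exact ⟨⟨b, y⟩, fun h => hb (congrArg Sigma.fst h), by simpa [famVert] using hy⟩
  have hcardP : Fintype.card (Σ a, Fin (quadLen k k' a) ⊕ Fin (quadLen k k' a)) =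
      4 * (k + k') := by
    simp [Fintype.card_sigma, Fintype.sum_prod_type, quadLen]
    ring
  by_contra hcon
  push Not at hcon
  refine hne (cycle_eq_of_no_triple h ?_ (a := (true, false)) (b := (true, true)) (by simp) he)
  intro x y w hxy hxw hyw hy hw
  have := two_mul_card_image_lt (famVert (quadFam z)) h2 hxy hxw hyw hy hw
  rw [hcardP] at this
  omega

end Quadruples

end

section

/-! ### Second moment bounds -/

open MvPolynomial

lemma gaussE_mono {ι : Type*} [Fintype ι] {p q : MvPolynomial ι ℝ}
    (h : ∀ x, eval x p ≤ eval x q) : gaussE p ≤ gaussE q :=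
  integral_mono (integrable_eval p) (integrable_eval q) h

lemma gaussE_sq_sum_le {ι α : Type*} [Fintype ι] (s : Finset α) (f : α → MvPolynomial ι ℝ) :
    gaussE ((∑ a ∈ s, f a) ^ 2) ≤ s.card * ∑ a ∈ s, gaussE (f a ^ 2) := by
  rw [← gaussE_sum, ← gaussE_C_mul]
  refine gaussE_mono fun x => ?_
  simpa using sq_sum_le_card_mul_sum_sq (s := s) (f := fun a => eval x (f a))

section FamilyCount

variable {n p : ℕ} {A : Type*} [Fintype A] {κ : A → ℕ}

/-- The number of families of cycles with at most `v` vertices. -/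
lemma card_fam_le [NeZero n] {α : Type*} (s : Finset α) (F : α → ∀ a, Cyc n p (κ a))
    (hF : Set.InjOn F s) {v m : ℕ} (hm : ∑ a, 2 * κ a = m) (hv : v ≤ m)
    (h : ∀ x ∈ s, (Finset.univ.image (famVert (F x))).card ≤ v) :
    (s.card : ℝ) ≤ ((n : ℝ) + p) ^ v * (m : ℝ) ^ m := by
  classical
  have h1 : s.card ≤ (Finset.univ.filter fun w : (Σ a, Fin (κ a) ⊕ Fin (κ a)) → Fin n ⊕ Fin p =>
      (Finset.univ.image w).card ≤ v).card := by
    refine Finset.card_le_card_of_injOn (fun x => famVert (F x)) ?_ ?_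
    · intro x hx
      simpa using h x hx
    · intro x hx y hy hxy
      exact hF hx hy (famVert_injective hxy)
  have h2 := h1.trans (card_filter_image_card_le v)
  have hP : Fintype.card (Σ a, Fin (κ a) ⊕ Fin (κ a)) = m := by
    rw [← hm]; simp [Fintype.card_sigma, two_mul]
  rw [hP] at h2
  have h3 : s.card ≤ (n + p) ^ v * m ^ m := by
    refine h2.trans ?_
    simp only [Fintype.card_sum, Fintype.card_fin]
    gcongr
  exact_mod_cast h3

end FamilyCount

/-! ### Second moments of the diagonal and off-diagonal pair sums -/

section Rest

variable {n p : ℕ} (k k' : ℕ) [NeZero k] [NeZero k']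

lemma erase_pos0_ne_univ : Finset.univ.erase (pos0 k) ≠ Finset.univ := fun h => by
  have := Finset.mem_univ (pos0 k)
  rw [← h] at this
  simp at this

variable (n p) in
/-- The pairs of different cycles with the same distinguished edge. -/
def restPairs : Finset (Cyc n p k × Cyc n p k') :=
  open Classical in Finset.univ.filter fun z => z.2.edge (pos0 k') = z.1.edge (pos0 k) ∧
    (⟨k, z.1⟩ : Σ m, Cyc n p m) ≠ ⟨k', z.2⟩

variable (n p) in
/-- The off-diagonal part of `pairPoly`. -/
def restPoly : MvPolynomial (Fin n × Fin p) ℝ :=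
  ∑ z ∈ restPairs n p k k', tailPoly z.1 * tailPoly z.2

lemma famPoly_quadFam (z : Bool → Cyc n p k × Cyc n p k') :
    famPoly (quadFam z) (fun a => Finset.univ.erase (pos0 (quadLen k k' a))) =
      (tailPoly (z true).1 * tailPoly (z true).2) * (tailPoly (z false).1 * tailPoly (z false).2) := by
  rw [famPoly, Fintype.prod_prod_type, Fintype.prod_bool, Fintype.prod_bool, Fintype.prod_bool]
  change (tailPoly (z true).2 * tailPoly (z true).1) *
    (tailPoly (z false).2 * tailPoly (z false).1) = _
  ring

/-- The square is a sum over quadruples of cycles. Those with nonzero expectation have at most `2 (k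
+ k') - 1` vertices, one less than the power of `n` in the squared normalization. -/
lemma gaussE_restPoly_sq_le [NeZero n] :
    gaussE (restPoly n p k k' ^ 2) ≤
      ((n : ℝ) + p) ^ (2 * (k + k') - 1) * ((4 * (k + k') : ℕ) : ℝ) ^ (4 * (k + k')) *
        ((4 * (k + k') : ℕ) : ℝ) ^ (4 * (k + k')) := by
  classical
  set F := restPairs n p k k' with hF
  set Z : (Cyc n p k × Cyc n p k') × (Cyc n p k × Cyc n p k') → Bool → Cyc n p k × Cyc n p k' :=
    fun z b => bif b then z.1 else z.2 with hZ
  set G : (Cyc n p k × Cyc n p k') × (Cyc n p k × Cyc n p k') → ℝ := fun z =>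
    gaussE (famPoly (quadFam (Z z)) (fun a => Finset.univ.erase (pos0 (quadLen k k' a)))) with hG
  set T := (F ×ˢ F).filter fun z => G z ≠ 0 with hT
  have hk := NeZero.pos k
  have hmsum : ∑ a, 2 * quadLen k k' a = 4 * (k + k') := by
    simp [Fintype.sum_prod_type, quadLen]; ring
  have h1 : gaussE (restPoly n p k k' ^ 2) = ∑ z ∈ T, G z := by
    rw [hT, Finset.sum_filter_ne_zero, pow_two, restPoly, Finset.sum_mul_sum,
      ← Finset.sum_product', gaussE_sum]
    refine Finset.sum_congr rfl fun z _ => ?_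
    rw [hG]
    simp only [famPoly_quadFam, hZ, cond_true, cond_false]
  have hcard : (T.card : ℝ) ≤ ((n : ℝ) + p) ^ (2 * (k + k') - 1) *
      ((4 * (k + k') : ℕ) : ℝ) ^ (4 * (k + k')) := by
    refine card_fam_le T (fun z => quadFam (Z z)) ?_ hmsum (by omega) ?_
    · intro z _ z' _ h
      have e1 := congrFun h (true, false)
      have e2 := congrFun h (true, true)
      have e3 := congrFun h (false, false)
      have e4 := congrFun h (false, true)
      exact Prod.ext (Prod.ext e1 e2) (Prod.ext e3 e4)
    · intro z hz
      simp only [hT, Finset.mem_filter, Finset.mem_product] at hz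
      obtain ⟨⟨hz1, hz2⟩, hz3⟩ := hz
      simp only [hF, restPairs, Finset.mem_filter, Finset.mem_univ, true_and] at hz1
      exact card_image_quad_le hz3 hz1.1 hz1.2
  rw [h1]
  calc ∑ z ∈ T, G z ≤ ∑ z ∈ T, ((4 * (k + k') : ℕ) : ℝ) ^ (4 * (k + k')) :=
        Finset.sum_le_sum fun z _ => gaussE_famPoly_le _ _ hmsum.le
    _ = T.card * ((4 * (k + k') : ℕ) : ℝ) ^ (4 * (k + k')) := by
        rw [Finset.sum_const, nsmul_eq_mul]
    _ ≤ _ := by gcongr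

variable (n p) in
/-- The diagonal part of `pairPoly`. -/
def mainPoly : MvPolynomial (Fin n × Fin p) ℝ := ∑ c : Cyc n p k, tailPoly c ^ 2

lemma pairPoly_eq_rest_of_ne (h : k ≠ k') : pairPoly n p k k' = restPoly n p k k' := by
  classical
  rw [pairPoly, restPoly, restPairs, Finset.sum_filter,
    Fintype.sum_prod_type (α₁ := Cyc n p k) (α₂ := Cyc n p k')]
  refine Finset.sum_congr rfl fun c _ => Finset.sum_congr rfl fun c' _ => ?_
  have : (⟨k, c⟩ : Σ m, Cyc n p m) ≠ ⟨k', c'⟩ := fun h' => h (congrArg Sigma.fst h')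
  simp [this]

lemma pairPoly_self : pairPoly n p k k = mainPoly n p k + restPoly n p k k := by
  classical
  rw [pairPoly, restPoly, restPairs, Finset.sum_filter,
    Fintype.sum_prod_type (α₁ := Cyc n p k) (α₂ := Cyc n p k), mainPoly, ← Finset.sum_add_distrib]
  refine Finset.sum_congr rfl fun c _ => ?_
  have h1 : tailPoly c ^ 2 = ∑ c' : Cyc n p k, if c' = c then tailPoly c * tailPoly c' else 0 := by
    simp [pow_two]
  rw [h1, ← Finset.sum_add_distrib]
  refine Finset.sum_congr rfl fun c' _ => ?_
  by_cases h : c' = c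
  · subst h; simp
  · have h2 : c ≠ c' := fun h' => h h'.symm
    simp [h, h2]

lemma gaussE_tailPoly_sq (c : Cyc n p k) : gaussE (tailPoly c ^ 2) = 1 := by
  rw [tailPoly, ← Finset.prod_pow]
  exact gaussE_prod_X_sq _ _ (edge_injOn c (erase_pos0_ne_univ k))

/-- The covariance of two squared tails vanishes when the cycles have no common vertex, since the
edges are then all distinct. The surviving pairs have at most `4 k - 1` vertices, against a squared
mean of order `n ^ (4 k)`. -/
lemma gaussE_mainPoly_sub_sq_le [NeZero n] :
    gaussE ((mainPoly n p k - C (Fintype.card (Cyc n p k) : ℝ)) ^ 2) ≤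
      ((n : ℝ) + p) ^ (4 * k - 1) * ((4 * k : ℕ) : ℝ) ^ (4 * k) *
        ((8 * k : ℕ) : ℝ) ^ (8 * k) := by
  classical
  have hk := NeZero.pos k
  set Z : Cyc n p k × Cyc n p k → Bool → Cyc n p k := fun z b => bif b then z.1 else z.2 with hZ
  set G : Cyc n p k × Cyc n p k → ℝ := fun z =>
    gaussE ((tailPoly z.1 ^ 2 - 1) * (tailPoly z.2 ^ 2 - 1)) with hG
  set T := Finset.univ.filter fun z => G z ≠ 0 with hT
  have h1 : gaussE ((mainPoly n p k - C (Fintype.card (Cyc n p k) : ℝ)) ^ 2) = ∑ z ∈ T, G z := by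
    have : mainPoly n p k - C (Fintype.card (Cyc n p k) : ℝ) =
        ∑ c : Cyc n p k, (tailPoly c ^ 2 - 1) := by
      rw [mainPoly, Finset.sum_sub_distrib]
      simp
    rw [hT, Finset.sum_filter_ne_zero, this, pow_two, Finset.sum_mul_sum, ← Finset.sum_product',
      gaussE_sum]
    rfl
  have hG2 : ∀ z, G z = gaussE (tailPoly z.1 ^ 2 * tailPoly z.2 ^ 2) - 1 := by
    intro z
    have : (tailPoly z.1 ^ 2 - 1) * (tailPoly z.2 ^ 2 - 1) =
        tailPoly z.1 ^ 2 * tailPoly z.2 ^ 2 - tailPoly z.1 ^ 2 - tailPoly z.2 ^ 2 + 1 := by ring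
    simp only [hG]
    rw [this, gaussE_add, gaussE_sub, gaussE_sub, gaussE_tailPoly_sq, gaussE_tailPoly_sq,
      gaussE_one]
    ring
  have hGle : ∀ z, G z ≤ ((8 * k : ℕ) : ℝ) ^ (8 * k) := by
    intro z
    rw [hG2]
    have h2 : tailPoly z.1 ^ 2 * tailPoly z.2 ^ 2 =
        famPoly (A := Bool × Bool) (κ := fun _ => k) (fun a => Z z a.1)
          (fun _ => Finset.univ.erase (pos0 k)) := by
      rw [famPoly, Fintype.prod_prod_type, Fintype.prod_bool, Fintype.prod_bool,
        Fintype.prod_bool]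
      change _ = (tailPoly z.1 * tailPoly z.1) * (tailPoly z.2 * tailPoly z.2)
      ring
    rw [h2]
    have := gaussE_famPoly_le (A := Bool × Bool) (κ := fun _ => k) (fun a => Z z a.1)
          (fun _ => Finset.univ.erase (pos0 k)) (m := 8 * k) (by simp; omega)
    linarith
  have hcard : (T.card : ℝ) ≤ ((n : ℝ) + p) ^ (4 * k - 1) * ((4 * k : ℕ) : ℝ) ^ (4 * k) := by
    refine card_fam_le (A := Bool) (κ := fun _ => k) T (fun z => Z z) ?_ (by simp; ring) (by omega) ?_
    · intro z _ z' _ h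
      exact Prod.ext (congrFun h true) (congrFun h false)
    · intro z hz
      simp only [hT, Finset.mem_filter, Finset.mem_univ, true_and] at hz
      have hP : Fintype.card (Σ _ : Bool, Fin k ⊕ Fin k) = 4 * k := by
        simp [Fintype.card_sigma]; ring
      rw [← hP]
      refine card_image_lt_of_not_injective _ fun hinj => hz ?_
      rw [hG2, sub_eq_zero]
      have h2 : tailPoly z.1 ^ 2 * tailPoly z.2 ^ 2 =
          ∏ x ∈ (Finset.univ : Finset Bool).sigma (fun _ => Finset.univ.erase (pos0 k)),
            (X ((Z z x.1).edge x.2) : MvPolynomial (Fin n × Fin p) ℝ) ^ 2 := by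
        rw [Finset.prod_sigma, Fintype.prod_bool]
        simp only [Finset.prod_pow]
        rfl
      rw [h2]
      refine gaussE_prod_X_sq _ (fun x : Σ _ : Bool, Fin k × Bool => (Z z x.1).edge x.2) ?_
      rintro ⟨b, q⟩ hq ⟨b', q'⟩ hq' heq
      simp only [Finset.coe_sigma, Set.mem_sigma_iff, Finset.mem_coe, Finset.mem_univ,
        true_and] at hq hq'
      have heq' := heq
      simp only [edge_eq, Prod.mk.injEq] at heq'
      have hb := @hinj ⟨b, Sum.inr q.1⟩ ⟨b', Sum.inr q'.1⟩ (by simp [famVert, Cyc.vert, heq'.2])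
      have hbb : b = b' := congrArg Sigma.fst hb
      subst hbb
      rw [edge_injOn (Z z b) (erase_pos0_ne_univ k) hq hq' heq]
  rw [h1]
  calc ∑ z ∈ T, G z ≤ ∑ z ∈ T, ((8 * k : ℕ) : ℝ) ^ (8 * k) :=
        Finset.sum_le_sum fun z _ => hGle z
    _ = T.card * ((8 * k : ℕ) : ℝ) ^ (8 * k) := by
        rw [Finset.sum_const, nsmul_eq_mul]
    _ ≤ _ := by gcongr

end Rest

/-! ### Sums over cycles versus sums over arbitrary pairs of maps -/

section NonInjective

variable (n p k : ℕ)

/-- Few pairs of maps fail to be pairs of embeddings. -/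
lemma card_not_injective_le [NeZero n] [NeZero k] :
    ((Finset.univ.filter fun f : (Fin k → Fin n) × (Fin k → Fin p) =>
      ¬ (Function.Injective f.1 ∧ Function.Injective f.2)).card : ℝ) ≤
      ((n : ℝ) + p) ^ (2 * k - 1) * ((2 * k : ℕ) : ℝ) ^ (2 * k) := by
  classical
  have hk := NeZero.pos k
  have h1 : (Finset.univ.filter fun f : (Fin k → Fin n) × (Fin k → Fin p) =>
      ¬ (Function.Injective f.1 ∧ Function.Injective f.2)).card ≤
      (Finset.univ.filter fun w : Fin k ⊕ Fin k → Fin n ⊕ Fin p =>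
        (Finset.univ.image w).card ≤ 2 * k - 1).card := by
    refine Finset.card_le_card_of_injOn (fun f => Sum.map f.1 f.2) ?_ ?_
    · intro f hf
      simp only [Finset.coe_filter, Finset.mem_univ, true_and, Set.mem_ofPred_eq] at hf ⊢
      have hP : Fintype.card (Fin k ⊕ Fin k) = 2 * k := by simp [two_mul]
      rw [← hP]
      exact card_image_lt_of_not_injective _ fun h => hf (Sum.map_injective.mp h)
    · intro f _ g _ h
      refine Prod.ext ?_ ?_
      · ext t
        have := congrFun h (Sum.inl t)
        simpa [Fin.ext_iff] using this
      · ext t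
        have := congrFun h (Sum.inr t)
        simpa [Fin.ext_iff] using this
  have h2 := h1.trans (card_filter_image_card_le _)
  have h3 : (Finset.univ.filter fun f : (Fin k → Fin n) × (Fin k → Fin p) =>
      ¬ (Function.Injective f.1 ∧ Function.Injective f.2)).card ≤
      (n + p) ^ (2 * k - 1) * (2 * k) ^ (2 * k) := by
    refine h2.trans ?_
    simp only [Fintype.card_sum, Fintype.card_fin, ← two_mul]
    gcongr
    omega
  exact_mod_cast h3

/-- A sum over cycles as a sum over pairs of injective maps. -/
lemma sum_cyc_eq (g : (Fin k → Fin n) × (Fin k → Fin p) → ℝ) :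
    ∑ c : Cyc n p k, g (c.1, c.2) = ∑ f ∈ Finset.univ.filter
      (fun f : (Fin k → Fin n) × (Fin k → Fin p) =>
        Function.Injective f.1 ∧ Function.Injective f.2), g f := by
  classical
  refine Finset.sum_bij' (fun c _ => ((c.1 : Fin k → Fin n), (c.2 : Fin k → Fin p)))
    (fun f hf => (⟨f.1, (Finset.mem_filter.mp hf).2.1⟩, ⟨f.2, (Finset.mem_filter.mp hf).2.2⟩))
    ?_ ?_ ?_ ?_ ?_
  · intro c _; simp [c.1.injective, c.2.injective]
  · intro f _; simp
  · intro c _; rfl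
  · intro f _; rfl
  · intro c _; rfl

/-- Dropping the distinctness of the indices costs one vertex. With `g = 1` this counts cycles; for
a signal it turns the signed cycle into a trace. -/
lemma abs_sum_cyc_sub_le [NeZero n] [NeZero k] (g : (Fin k → Fin n) × (Fin k → Fin p) → ℝ)
    {M : ℝ} (hM : 0 ≤ M)
    (hg : ∀ f, |g f| ≤ M) :
    |∑ c : Cyc n p k, g (c.1, c.2) - ∑ f, g f| ≤
      ((n : ℝ) + p) ^ (2 * k - 1) * ((2 * k : ℕ) : ℝ) ^ (2 * k) * M := by
  classical
  rw [sum_cyc_eq, ← Finset.sum_filter_add_sum_filter_not Finset.univ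
      (fun f : (Fin k → Fin n) × (Fin k → Fin p) =>
        Function.Injective f.1 ∧ Function.Injective f.2) g, sub_add_cancel_left, abs_neg]
  refine (Finset.abs_sum_le_sum_abs _ _).trans ?_
  refine (Finset.sum_le_sum fun f _ => hg f).trans ?_
  rw [Finset.sum_const, nsmul_eq_mul]
  exact mul_le_mul_of_nonneg_right (card_not_injective_le n p k) hM

end NonInjective

end

section

/-! ### Signal plus noise -/

open MvPolynomial

section Cross

variable {n p : ℕ} (k : ℕ) [NeZero k]

/-- The part of the signed cycle of `s + X` in which the signal `s` is chosen at the positions in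
`D` and the noise elsewhere. -/
def mixedPoly (s : Fin n × Fin p → ℝ) (D : Finset (Fin k × Bool)) :
    MvPolynomial (Fin n × Fin p) ℝ :=
  C (1 / (n : ℝ) ^ k) * ∑ c : Cyc n p k,
    C (∏ q ∈ D, s (c.edge q)) * ∏ q ∈ Dᶜ, X (c.edge q)

/-- The mixed part of the signed cycle of signal plus noise. -/
def crossPoly (s : Fin n × Fin p → ℝ) : MvPolynomial (Fin n × Fin p) ℝ :=
  ∑ D ∈ (Finset.univ.erase ∅).erase Finset.univ, mixedPoly k s D

/-- The product over positions is expanded over the set `D` of those where the signal is chosen: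
everything gives the pure signal, nothing the pure noise. -/
lemma bicycle_add_eq (s x : Fin n × Fin p → ℝ) :
    bicycle k (fun i j => s (i, j) + x (i, j)) =
      bicycle k (fun i j => s (i, j)) + eval x (bicyclePoly n p k) + eval x (crossPoly k s) := by
  have h1 : bicycle k (fun i j => s (i, j) + x (i, j)) = ∑ D, eval x (mixedPoly k s D) := by
    rw [bicycle_eq_sum_cyc]
    simp only [mixedPoly, map_mul, eval_C, map_sum, map_prod, eval_X]
    rw [← Finset.mul_sum, Finset.sum_comm]
    congr 1
    refine Finset.sum_congr rfl fun c _ => ?_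
    simp only [Prod.mk.eta]
    rw [Finset.prod_add, Finset.powerset_univ]
    rfl
  have h2 : eval x (mixedPoly k s Finset.univ) = bicycle k (fun i j => s (i, j)) := by
    rw [bicycle_eq_sum_cyc]
    simp [mixedPoly]
  have h3 : eval x (mixedPoly k s ∅) = eval x (bicyclePoly n p k) := by
    simp [mixedPoly, bicyclePoly]
  have hne : (Finset.univ : Finset (Fin k × Bool)) ≠ ∅ := by
    have : (Finset.univ : Finset (Fin k × Bool)).Nonempty := ⟨pos0 k, Finset.mem_univ _⟩
    exact this.ne_empty
  rw [h1, crossPoly, map_sum, ← Finset.add_sum_erase _ _ (Finset.mem_univ ∅),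
    ← Finset.add_sum_erase _ _ (show Finset.univ ∈ Finset.univ.erase ∅ by simp [hne]), h2, h3]
  ring

/-- In the square, the noise edges of the two cycles must match. They touch at least `Dᶜ.card + 1`
vertices, all shared, so the pair has at most `4 k - (Dᶜ.card + 1) = 2 k + D.card - 1` vertices. For
`δ` of order `n ^ (-1/2)` up to logarithms, the factor `δ ^ (2 * D.card)` compensates `D.card` of
them, leaving a gain of `1 / n`. -/
lemma gaussE_mixedPoly_sq_le [NeZero n] (s : Fin n × Fin p → ℝ) {δ : ℝ} (hδ : ∀ e, |s e| ≤ δ)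
    {D : Finset (Fin k × Bool)} (h0 : D ≠ ∅) (h1 : D ≠ Finset.univ) :
    gaussE (mixedPoly k s D ^ 2) ≤ (1 / (n : ℝ) ^ k) ^ 2 * ((δ ^ D.card) ^ 2 *
      (((n : ℝ) + p) ^ (2 * k + D.card - 1) * ((4 * k : ℕ) : ℝ) ^ (4 * k) *
        ((4 * k : ℕ) : ℝ) ^ (4 * k))) := by
  classical
  have hk := NeZero.pos k
  set Z : Cyc n p k × Cyc n p k → Bool → Cyc n p k := fun z b => bif b then z.1 else z.2 with hZ
  set G : Cyc n p k × Cyc n p k → ℝ := fun z =>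
    gaussE (famPoly (A := Bool) (κ := fun _ => k) (Z z) fun _ => Dᶜ) with hG
  set T := Finset.univ.filter fun z => G z ≠ 0 with hT
  set a : Cyc n p k → ℝ := fun c => ∏ q ∈ D, s (c.edge q) with ha
  have hDc : Dᶜ ≠ Finset.univ := fun h => h0 (by simpa using h)
  have hDc0 : Dᶜ.Nonempty := by
    rw [Finset.nonempty_iff_ne_empty]
    exact fun h => h1 (by simpa using h)
  have ha_le : ∀ c, |a c| ≤ δ ^ D.card := by
    intro c
    rw [ha, Finset.abs_prod, ← Finset.prod_const]
    exact Finset.prod_le_prod (fun _ _ => abs_nonneg _) fun q _ => hδ _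
  have hG0 : ∀ z, 0 ≤ G z := fun z => gaussE_famPoly_nonneg _ _
  have hsum : gaussE (mixedPoly k s D ^ 2) = (1 / (n : ℝ) ^ k) ^ 2 *
      ∑ z ∈ T, (a z.1 * a z.2) * G z := by
    have e1 : ∑ z ∈ T, (a z.1 * a z.2) * G z = ∑ z, (a z.1 * a z.2) * G z := by
      refine Finset.sum_subset (Finset.subset_univ _) fun z _ hz => ?_
      have : G z = 0 := by simpa [hT] using hz
      rw [this, mul_zero]
    rw [e1, mixedPoly, mul_pow, ← C_pow, gaussE_C_mul, pow_two (∑ c : Cyc n p k, _),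
      Finset.sum_mul_sum, ← Finset.sum_product', gaussE_sum]
    congr 1
    refine Finset.sum_congr rfl fun z _ => ?_
    rw [hG]
    dsimp only
    rw [← gaussE_C_mul, famPoly, Fintype.prod_bool]
    congr 1
    rw [C_mul]
    simp only [hZ, cond_true, cond_false, ha]
    ring
  have hcard : (T.card : ℝ) ≤ ((n : ℝ) + p) ^ (2 * k + D.card - 1) *
      ((4 * k : ℕ) : ℝ) ^ (4 * k) := by
    have hDcard : D.card + Dᶜ.card = 2 * k := by
      rw [Finset.card_add_card_compl]; simp [mul_comm]
    have hpos : 0 < Dᶜ.card := hDc0.card_pos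
    refine card_fam_le (A := Bool) (κ := fun _ => k) T (fun z => Z z) ?_ (by simp; ring)
      (by omega) ?_
    · intro z _ z' _ h
      exact Prod.ext (congrFun h true) (congrFun h false)
    · intro z hz
      simp only [hT, Finset.mem_filter, Finset.mem_univ, true_and] at hz
      have hshare := exists_shared_vertex (A := Bool) (κ := fun _ => k) (c := Z z)
        (S := fun _ => Dᶜ) (fun _ => hDc) hz true
      -- The row and column positions touched by the noise edges.
      set U := (Dᶜ.image rowPos).disjSum (Dᶜ.image Prod.fst) with hU
      have hUcard : Dᶜ.card + 1 ≤ (U.image (z.1).vert).card := by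
        rw [Finset.card_image_of_injective _ (vert_injective _), hU, Finset.card_disjSum]
        exact card_lt_card_touched hDc0 hDc
      have hsub : U.image (z.1).vert ⊆
          (Finset.univ.image (z.1).vert) ∩ (Finset.univ.image (z.2).vert) := by
        intro v hv
        obtain ⟨x, hx, rfl⟩ := Finset.mem_image.mp hv
        refine Finset.mem_inter.mpr ⟨Finset.mem_image_of_mem _ (Finset.mem_univ _), ?_⟩
        rw [hU, Finset.mem_disjSum] at hx
        have hb : ∀ b : Bool, b ≠ true → b = false := by decide
        rcases hx with ⟨t, ht, rfl⟩ | ⟨t, ht, rfl⟩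
        · obtain ⟨q, hq, rfl⟩ := Finset.mem_image.mp ht
          obtain ⟨⟨b, hb', y, hy⟩, -⟩ := hshare q hq
          obtain rfl := hb b hb'
          exact Finset.mem_image.mpr ⟨y, Finset.mem_univ _, hy⟩
        · obtain ⟨q, hq, rfl⟩ := Finset.mem_image.mp ht
          obtain ⟨-, ⟨b, hb', y, hy⟩⟩ := hshare q hq
          obtain rfl := hb b hb'
          exact Finset.mem_image.mpr ⟨y, Finset.mem_univ _, hy⟩
      have himg : Finset.univ.image (famVert (A := Bool) (κ := fun _ => k) (Z z)) ⊆
          (Finset.univ.image (z.1).vert) ∪ (Finset.univ.image (z.2).vert) := by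
        intro v hv
        obtain ⟨⟨b, x⟩, -, rfl⟩ := Finset.mem_image.mp hv
        cases b
        · exact Finset.mem_union_right _ (Finset.mem_image_of_mem _ (Finset.mem_univ _))
        · exact Finset.mem_union_left _ (Finset.mem_image_of_mem _ (Finset.mem_univ _))
      have hc1 : ∀ c : Cyc n p k, (Finset.univ.image c.vert).card = 2 * k := by
        intro c
        rw [Finset.card_image_of_injective _ (vert_injective c)]
        simp [two_mul]
      have e1 := Finset.card_le_card himg
      have e2 := Finset.card_le_card hsub
      have e3 := Finset.card_union_add_card_inter (Finset.univ.image (z.1).vert)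
        (Finset.univ.image (z.2).vert)
      rw [hc1, hc1] at e3
      omega
  rw [hsum]
  have hδ0 : 0 ≤ (δ ^ D.card) ^ 2 := sq_nonneg _
  refine mul_le_mul_of_nonneg_left ?_ (sq_nonneg _)
  calc ∑ z ∈ T, (a z.1 * a z.2) * G z
      ≤ ∑ z ∈ T, (δ ^ D.card) ^ 2 * ((4 * k : ℕ) : ℝ) ^ (4 * k) := by
        refine Finset.sum_le_sum fun z _ => mul_le_mul ?_ ?_ (hG0 z) hδ0
        · refine (le_abs_self _).trans ?_
          rw [abs_mul, pow_two]
          exact mul_le_mul (ha_le _) (ha_le _) (abs_nonneg _) ((abs_nonneg _).trans (ha_le z.1))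
        · exact gaussE_famPoly_le _ _ (by simp; omega)
    _ = (δ ^ D.card) ^ 2 * (T.card * ((4 * k : ℕ) : ℝ) ^ (4 * k)) := by
        rw [Finset.sum_const, nsmul_eq_mul]; ring
    _ ≤ _ := by gcongr

/-- Cauchy–Schwarz over at most `4 ^ k` sets `D` gives `16 ^ k`; by `h1` the exponent `D.card` may
be raised to `2 k`, making the bound uniform in `D`. -/
lemma gaussE_crossPoly_sq_le [NeZero n] (s : Fin n × Fin p → ℝ) {δ : ℝ} (hδ : ∀ e, |s e| ≤ δ)
    (h1 : 1 ≤ δ ^ 2 * ((n : ℝ) + p)) :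
    gaussE (crossPoly k s ^ 2) ≤ 16 ^ k * ((1 / (n : ℝ) ^ k) ^ 2 *
      ((δ ^ 2 * ((n : ℝ) + p)) ^ (2 * k) * ((n : ℝ) + p) ^ (2 * k - 1) *
        ((4 * k : ℕ) : ℝ) ^ (4 * k) * ((4 * k : ℕ) : ℝ) ^ (4 * k))) := by
  have hk := NeZero.pos k
  set M : ℝ := (1 / (n : ℝ) ^ k) ^ 2 *
      ((δ ^ 2 * ((n : ℝ) + p)) ^ (2 * k) * ((n : ℝ) + p) ^ (2 * k - 1) *
        ((4 * k : ℕ) : ℝ) ^ (4 * k) * ((4 * k : ℕ) : ℝ) ^ (4 * k)) with hM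
  have hM0 : 0 ≤ M := by positivity
  set Ds := (Finset.univ.erase ∅).erase (Finset.univ : Finset (Fin k × Bool)) with hDs
  have hterm : ∀ D ∈ Ds, gaussE (mixedPoly k s D ^ 2) ≤ M := by
    intro D hD
    simp only [hDs, Finset.mem_erase, Finset.mem_univ, and_true] at hD
    refine (gaussE_mixedPoly_sq_le k s hδ hD.2 hD.1).trans ?_
    rw [hM]
    refine mul_le_mul_of_nonneg_left ?_ (sq_nonneg _)
    have hDcard : D.card ≤ 2 * k := by
      refine (Finset.card_le_univ D).trans ?_
      simp [mul_comm]
    have e1 : 2 * k + D.card - 1 = D.card + (2 * k - 1) := by omega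
    have e2 : (δ ^ D.card) ^ 2 * ((n : ℝ) + p) ^ (2 * k + D.card - 1) ≤
        (δ ^ 2 * ((n : ℝ) + p)) ^ (2 * k) * ((n : ℝ) + p) ^ (2 * k - 1) := by
      rw [e1, pow_add, ← pow_mul, mul_comm D.card 2, pow_mul, ← mul_assoc, ← mul_pow]
      refine mul_le_mul_of_nonneg_right ?_ (by positivity)
      exact pow_le_pow_right₀ h1 hDcard
    calc _ = (δ ^ D.card) ^ 2 * ((n : ℝ) + p) ^ (2 * k + D.card - 1) *
        ((4 * k : ℕ) : ℝ) ^ (4 * k) * ((4 * k : ℕ) : ℝ) ^ (4 * k) := by ring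
      _ ≤ _ := by gcongr
  have hDscard : (Ds.card : ℝ) ≤ 4 ^ k := by
    have : Ds.card ≤ 4 ^ k := by
      refine (Finset.card_le_univ Ds).trans ?_
      rw [Fintype.card_finset]
      simp only [Fintype.card_prod, Fintype.card_fin, Fintype.card_bool]
      rw [mul_comm, pow_mul]; norm_num
    exact_mod_cast this
  calc gaussE (crossPoly k s ^ 2) ≤ Ds.card * ∑ D ∈ Ds, gaussE (mixedPoly k s D ^ 2) :=
        gaussE_sq_sum_le _ _
    _ ≤ Ds.card * (Ds.card * M) := by
        refine mul_le_mul_of_nonneg_left ?_ (by positivity)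
        refine (Finset.sum_le_sum hterm).trans ?_
        rw [Finset.sum_const, nsmul_eq_mul]
    _ ≤ 4 ^ k * (4 ^ k * M) := by gcongr
    _ = 16 ^ k * M := by rw [← mul_assoc, ← mul_pow]; norm_num

end Cross

end

section

/-! ### Asymptotics -/

section Asymptotics

lemma tendsto_log_natCast_atTop : Tendsto (fun n : ℕ => Real.log n) atTop atTop :=
  Real.tendsto_log_atTop.comp tendsto_natCast_atTop_atTop

lemma eventually_le_log (C : ℝ) : ∀ᶠ n : ℕ in atTop, C ≤ Real.log n :=
  tendsto_log_natCast_atTop.eventually_ge_atTop C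

variable {k : ℕ → ℕ}

lemma eventually_mul_le_sqrt_log
    (hk : (fun n => (k n : ℝ)) =o[atTop] fun n : ℕ => √(Real.log (n : ℝ))) (C : ℝ) :
    ∀ᶠ n : ℕ in atTop, C * k n ≤ √(Real.log n) := by
  have h := hk.def (c := 1 / (|C| + 1)) (by positivity)
  filter_upwards [h] with n hn
  rw [Real.norm_of_nonneg (by positivity), Real.norm_of_nonneg (by positivity)] at hn
  have hC : 0 < |C| + 1 := by positivity
  rw [one_div, inv_mul_eq_div, le_div_iff₀ hC] at hn
  have h1 : C ≤ |C| := le_abs_self C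
  have h2 : (0 : ℝ) ≤ k n := by positivity
  nlinarith

lemma eventually_mul_le_log
    (hk : (fun n => (k n : ℝ)) =o[atTop] fun n : ℕ => √(Real.log (n : ℝ))) (C : ℝ) :
    ∀ᶠ n : ℕ in atTop, C * k n ≤ Real.log n := by
  filter_upwards [eventually_mul_le_sqrt_log hk C, eventually_le_log 1] with n h1 h2
  refine h1.trans ?_
  rw [Real.sqrt_le_left (by linarith)]
  nlinarith

/-- Polylogarithmic factors to the power `O(k)` are `n ^ o(1)`. -/
lemma tendsto_log_pow_mul_rpow
    (hk : (fun n => (k n : ℝ)) =o[atTop] fun n : ℕ => √(Real.log (n : ℝ)))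
    (B : ℕ) {c : ℝ} (hc : 0 < c) :
    Tendsto (fun n : ℕ => Real.log n ^ (B * k n) * (n : ℝ) ^ (-c)) atTop (𝓝 0) := by
  have hlim : Tendsto (fun n : ℕ => (n : ℝ) ^ (-(c / 2))) atTop (𝓝 0) :=
    (tendsto_rpow_neg_atTop (by positivity)).comp tendsto_natCast_atTop_atTop
  refine squeeze_zero' ?_ ?_ hlim
  · filter_upwards [eventually_le_log 1] with n hn
    positivity
  -- With `x = log n`, the constant `4 B / c` makes `B k ≤ (c / 4) √x`; together with `log x ≤ 2 √x`
  -- the logarithm of the power is at most `(c / 2) x`, half of what `n ^ (-c)` provides.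
  · filter_upwards [eventually_le_log 1, eventually_mul_le_sqrt_log hk (4 * B / c),
      eventually_gt_atTop 0] with n h1 h2 hn
    have hn' : (0 : ℝ) < n := by exact_mod_cast hn
    set x := Real.log n with hx
    have hx0 : 0 < x := by linarith
    have hs : √x * √x = x := Real.mul_self_sqrt hx0.le
    have hs0 : 0 < √x := Real.sqrt_pos.mpr hx0
    have hlog : Real.log x ≤ 2 * √x := by
      have : Real.log x = 2 * Real.log (√x) := by
        rw [Real.log_sqrt hx0.le]; ring
      rw [this]
      have := Real.log_le_sub_one_of_pos hs0
      linarith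
    have e1 : x ^ (B * k n) = Real.exp ((B * k n : ℕ) * Real.log x) := by
      rw [← Real.log_pow, Real.exp_log (by positivity)]
    rw [e1, Real.rpow_def_of_pos hn', Real.rpow_def_of_pos hn', ← Real.exp_add]
    refine Real.exp_le_exp.mpr ?_
    rw [← hx]
    have h3 : (B : ℝ) * k n ≤ c / 4 * √x := by
      have : 4 * (B : ℝ) / c * k n = (B * k n) * (4 / c) := by ring
      rw [this] at h2
      have h4 := mul_le_mul_of_nonneg_right h2 (show 0 ≤ c / 4 by positivity)
      have e : (B : ℝ) * k n * (4 / c) * (c / 4) = B * k n := by field_simp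
      linarith
    have h5 : ((B * k n : ℕ) : ℝ) * Real.log x ≤ (c / 4 * √x) * (2 * √x) := by
      push_cast
      calc (B : ℝ) * k n * Real.log x ≤ B * k n * (2 * √x) := by gcongr
        _ ≤ _ := by gcongr
    have h6 : (c / 4 * √x) * (2 * √x) = c / 2 * x := by
      rw [show (c / 4 * √x) * (2 * √x) = c / 2 * (√x * √x) by ring, hs]
    linarith

variable {γ : ℝ} {p : ℕ → ℕ}

/-- Throughout, `L = log n` serves as the common bound for constants and for multiples of `k`, so
that each error becomes a power of `L` with exponent `O(k)` times a negative power of `n`. -/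
lemma eventually_add_le_log_mul
    (hp : Tendsto (fun n => (p n : ℝ) / (n : ℝ)) atTop (𝓝 γ)) :
    ∀ᶠ n : ℕ in atTop, ((n : ℝ) + p n) ≤ Real.log n * n := by
  filter_upwards [hp.eventually_lt_const (lt_add_one γ), eventually_le_log (γ + 2),
    eventually_gt_atTop 0] with n h1 h2 hn
  have hn' : (0 : ℝ) < n := by exact_mod_cast hn
  rw [div_lt_iff₀ hn'] at h1
  nlinarith

lemma eventually_le_mul_p (hγ : 0 < γ)
    (hp : Tendsto (fun n => (p n : ℝ) / (n : ℝ)) atTop (𝓝 γ)) :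
    ∀ᶠ n : ℕ in atTop, γ / 2 * n ≤ p n := by
  filter_upwards [hp.eventually_const_lt (half_lt_self hγ), eventually_gt_atTop 0] with n h1 hn
  have hn' : (0 : ℝ) < n := by exact_mod_cast hn
  rw [lt_div_iff₀ hn'] at h1
  exact h1.le

/-- The quotient is `(1 + x) ^ k` with `k x → 0`: Bernoulli's inequality from below, `1 + x ≤ exp x`
from above. -/
lemma tendsto_ratio_pow (hγ : 0 < γ)
    (hr : Tendsto (fun n => (k n : ℝ) * ((p n : ℝ) / (n : ℝ) - γ)) atTop (𝓝 0)) :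
    Tendsto (fun n => ((p n : ℝ) / n) ^ k n / γ ^ k n) atTop (𝓝 1) := by
  have h1 : Tendsto (fun n => (k n : ℝ) * ((p n : ℝ) / (n : ℝ) - γ) / γ) atTop (𝓝 0) := by
    simpa using hr.div_const γ
  have hlow : Tendsto (fun n => 1 + (k n : ℝ) * ((p n : ℝ) / (n : ℝ) - γ) / γ) atTop (𝓝 1) := by
    simpa using h1.const_add 1
  have hup : Tendsto (fun n => Real.exp ((k n : ℝ) * ((p n : ℝ) / (n : ℝ) - γ) / γ)) atTop
      (𝓝 1) := by
    simpa using! (Real.continuous_exp.tendsto 0).comp h1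
  have e : ∀ n, ((p n : ℝ) / n) ^ k n / γ ^ k n = (1 + ((p n : ℝ) / n - γ) / γ) ^ k n := by
    intro n
    rw [← div_pow]
    congr 1
    field_simp
    ring
  have hge : ∀ n, -1 ≤ ((p n : ℝ) / n - γ) / γ := by
    intro n
    have : ((p n : ℝ) / n - γ) / γ = ((p n : ℝ) / n) / γ - 1 := by field_simp
    rw [this]
    have : 0 ≤ ((p n : ℝ) / n) / γ := by positivity
    linarith
  refine tendsto_of_tendsto_of_tendsto_of_le_of_le hlow hup (fun n => ?_) (fun n => ?_)
  · simp only [e]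
    have := one_add_mul_le_pow (show -2 ≤ ((p n : ℝ) / n - γ) / γ by linarith [hge n]) (k n)
    calc _ = 1 + (k n : ℝ) * (((p n : ℝ) / n - γ) / γ) := by ring
      _ ≤ _ := this
  · simp only [e]
    calc (1 + ((p n : ℝ) / n - γ) / γ) ^ k n ≤ Real.exp (((p n : ℝ) / n - γ) / γ) ^ k n := by
          refine pow_le_pow_left₀ (by linarith [hge n]) ?_ _
          rw [add_comm]; exact Real.add_one_le_exp _
      _ = _ := by rw [← Real.exp_nat_mul]; congr 1; ring

end Asymptotics

/-! ### Characteristic functions of polynomials in Gaussian variables -/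

section CharFun

open MvPolynomial

variable {ι : Type*} [Fintype ι]

lemma norm_expE_le (W q : MvPolynomial ι ℝ) (s : ℝ) :
    ‖expE W s q‖ ≤ ∫ x, |eval x q| ∂gaussPi ι := by
  refine (norm_integral_le_integral_norm _).trans (le_of_eq ?_)
  refine integral_congr_ae (ae_of_all _ fun x => ?_)
  simp only [norm_mul, Complex.norm_exp_ofReal_mul_I, mul_one, Complex.norm_real, Real.norm_eq_abs]

lemma hasDerivAt_expE_one (W : MvPolynomial ι ℝ) (s : ℝ) :
    HasDerivAt (fun s => expE W s 1) (Complex.I * expE W s W) s := by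
  have hcont : Continuous fun x => eval x W := MvPolynomial.continuous_eval W
  have h := hasDerivAt_integral_of_dominated_loc_of_deriv_le (μ := gaussPi ι)
    (F := fun (s : ℝ) x => ((eval x 1 : ℝ) : ℂ) * Complex.exp ((s * eval x W : ℝ) * Complex.I))
    (F' := fun (s : ℝ) x => Complex.I * (((eval x W : ℝ) : ℂ) *
      Complex.exp ((s * eval x W : ℝ) * Complex.I)))
    (bound := fun x => |eval x W|) (x₀ := s) (s := Set.univ) Filter.univ_mem
    (Eventually.of_forall fun s => (integrable_eval_mul_cexp 1 W s).aestronglyMeasurable)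
    (integrable_eval_mul_cexp 1 W s)
    ((integrable_eval_mul_cexp W W s).const_mul _).aestronglyMeasurable
    (ae_of_all _ fun x s _ => by
      simp only [norm_mul, Complex.norm_exp_ofReal_mul_I, mul_one, Complex.norm_real,
        Real.norm_eq_abs, Complex.norm_I, one_mul, le_refl])
    (integrable_eval W).abs
    (ae_of_all _ fun x s _ => by
      have h1 := (((hasDerivAt_id s).mul_const (eval x W)).ofReal_comp.mul_const Complex.I).cexp
      have h2 := h1.const_mul ((eval x 1 : ℝ) : ℂ)
      convert! h2 using 1
      simp; ring)
  have h2 := h.2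
  rw [integral_const_mul] at h2
  exact h2

/-- **Stein's method**: if `E[W e^{isW}] = is E[Γ e^{isW}]` and `Γ` is close to `σ²`, the
characteristic function of `W` is close to that of `N(0, σ²)`. -/
lemma norm_charFun_sub_le {W Γ : MvPolynomial ι ℝ}
    (h : ∀ s : ℝ, expE W s W = s * Complex.I * expE W s Γ) (σ2 : ℝ) (hσ : 0 ≤ σ2) :
    ‖expE W 1 1 - Complex.exp ((-(σ2 / 2) : ℝ))‖ ≤ ∫ x, |eval x Γ - σ2| ∂gaussPi ι := by
  set ε := ∫ x, |eval x Γ - σ2| ∂gaussPi ι with hε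
  -- The Gaussian integrating factor: the derivative of `ψ` involves only `Γ - σ2`.
  set ψ : ℝ → ℂ := fun s => Complex.exp ((s ^ 2 * (σ2 / 2) : ℝ)) * expE W s 1 with hψ
  have hd : ∀ s : ℝ, HasDerivAt ψ (-(s : ℂ) * Complex.exp ((s ^ 2 * (σ2 / 2) : ℝ)) *
      expE W s (Γ - C σ2)) s := by
    intro s
    have h1 := (((hasDerivAt_pow 2 s).mul_const (σ2 / 2)).ofReal_comp).cexp
    have h2 := h1.mul (hasDerivAt_expE_one W s)
    convert! h2 using 1
    have e1 : expE W s (C σ2) = σ2 * expE W s 1 := by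
      rw [← expE_C_mul, mul_one]
    rw [h, map_sub, e1]
    push_cast
    have hI : Complex.I * Complex.I = -1 := Complex.I_mul_I
    linear_combination (-(s : ℂ) * Complex.exp ((s : ℂ) ^ 2 * (σ2 / 2)) * expE W s Γ) * hI
  have hε2 : ∀ s, ‖expE W s (Γ - C σ2)‖ ≤ ε := by
    intro s
    refine (norm_expE_le W _ s).trans (le_of_eq ?_)
    simp [hε]
  have hε0 : 0 ≤ ε := (norm_nonneg _).trans (hε2 0)
  -- On `[0, 1]` the derivative is at most `exp (σ2 / 2) * ε`; undoing the integrating factor at `s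
  -- = 1` removes the exponential.
  have hb := norm_image_sub_le_of_norm_deriv_le_segment_01' (f := ψ) (C := Real.exp (σ2 / 2) * ε)
    (fun s _ => (hd s).hasDerivWithinAt) (by
      intro s hs
      rw [norm_mul, norm_mul, norm_neg, Complex.norm_real, Complex.norm_exp, Complex.ofReal_re,
        Real.norm_of_nonneg hs.1]
      have h1 : s * Real.exp (s ^ 2 * (σ2 / 2)) ≤ 1 * Real.exp (σ2 / 2) := by
        refine mul_le_mul hs.2.le ?_ (Real.exp_pos _).le zero_le_one
        refine Real.exp_le_exp.mpr ?_
        have : s ^ 2 ≤ 1 := pow_le_one₀ hs.1 hs.2.le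
        nlinarith
      rw [one_mul] at h1
      exact mul_le_mul h1 (hε2 s) (norm_nonneg _) (Real.exp_pos _).le)
  have e0 : ψ 0 = 1 := by
    simp [hψ, expE]
  have e1 : ψ 1 = Complex.exp ((σ2 / 2 : ℝ)) * expE W 1 1 := by simp [hψ]
  rw [e0, e1] at hb
  have e2 : expE W 1 1 - Complex.exp ((-(σ2 / 2) : ℝ)) =
      Complex.exp ((-(σ2 / 2) : ℝ)) * (Complex.exp ((σ2 / 2 : ℝ)) * expE W 1 1 - 1) := by
    rw [mul_sub, ← mul_assoc, ← Complex.exp_add]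
    simp
  rw [e2, norm_mul, Complex.norm_exp, Complex.ofReal_re]
  calc _ ≤ Real.exp (-(σ2 / 2)) * (Real.exp (σ2 / 2) * ε) := by gcongr
    _ = ε := by rw [← mul_assoc, ← Real.exp_add]; simp

/-- The variance of `|q|` is nonnegative. -/
lemma integral_abs_eval_le_sqrt (q : MvPolynomial ι ℝ) :
    ∫ x, |eval x q| ∂gaussPi ι ≤ √(gaussE (q ^ 2)) := by
  refine Real.le_sqrt_of_sq_le ?_
  set m := ∫ x, |eval x q| ∂gaussPi ι with hm
  have h1 : 0 ≤ ∫ x, (|eval x q| - m) ^ 2 ∂gaussPi ι := integral_nonneg fun x => sq_nonneg _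
  have h2 : ∫ x, (|eval x q| - m) ^ 2 ∂gaussPi ι = gaussE (q ^ 2) - m ^ 2 := by
    have e : ∀ x, (|eval x q| - m) ^ 2 = eval x (q ^ 2) - (2 * m * |eval x q| - m ^ 2) := by
      intro x
      rw [map_pow, sub_sq, sq_abs]; ring
    simp_rw [e]
    have hI : Integrable (fun x => 2 * m * |eval x q| - m ^ 2) (gaussPi ι) :=
      ((integrable_eval q).abs.const_mul _).sub (integrable_const _)
    rw [integral_sub (integrable_eval _) hI, integral_sub ((integrable_eval q).abs.const_mul _)
      (integrable_const _), integral_const_mul, ← hm]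
    simp [gaussE]
    ring
  linarith

lemma integral_abs_eval_add_le (q r : MvPolynomial ι ℝ) :
    ∫ x, |eval x (q + r)| ∂gaussPi ι ≤
      ∫ x, |eval x q| ∂gaussPi ι + ∫ x, |eval x r| ∂gaussPi ι := by
  rw [← integral_add (integrable_eval q).abs (integrable_eval r).abs]
  refine integral_mono (integrable_eval _).abs ((integrable_eval q).abs.add
    (integrable_eval r).abs) fun x => ?_
  simp only [map_add]
  exact abs_add_le _ _

lemma integral_abs_eval_sum_le {α : Type*} (s : Finset α) (f : α → MvPolynomial ι ℝ) :
    ∫ x, |eval x (∑ a ∈ s, f a)| ∂gaussPi ι ≤ ∑ a ∈ s, ∫ x, |eval x (f a)| ∂gaussPi ι := by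
  classical
  induction s using Finset.induction_on with
  | empty => simp
  | insert a s ha ih =>
    rw [Finset.sum_insert ha, Finset.sum_insert ha]
    exact (integral_abs_eval_add_le _ _).trans (by gcongr)

lemma integral_abs_eval_C_mul (a : ℝ) (q : MvPolynomial ι ℝ) :
    ∫ x, |eval x (C a * q)| ∂gaussPi ι = |a| * ∫ x, |eval x q| ∂gaussPi ι := by
  rw [← integral_const_mul]
  simp [abs_mul]

end CharFun

end

section

/-! ### The central limit theorem for the noise matrix -/

open MvPolynomial

/-- The standard deviation by which the signed cycle of length `k` is divided. -/
def cycleSd (γ : ℝ) (k : ℕ) : ℝ := √(2 * (k : ℝ) * γ ^ k)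

lemma cycleSd_pos {γ : ℝ} (hγ : 0 < γ) (k : ℕ) [NeZero k] : 0 < cycleSd γ k := by
  have : 0 < k := NeZero.pos k
  unfold cycleSd
  positivity

lemma inv_pow_le {γ L : ℝ} (hγ : 0 < γ) (h1 : γ⁻¹ ≤ L) (k : ℕ) : (γ ^ k)⁻¹ ≤ L ^ k := by
  rw [← inv_pow]
  exact pow_le_pow_left₀ (by positivity) h1 k

/-- A crude bound, losing a square root: the normalization must not spoil the error bounds when `γ <
1` and `k` grows. -/
lemma inv_cycleSd_le {γ L : ℝ} (hγ : 0 < γ) (h1 : γ⁻¹ ≤ L) (hL : 1 ≤ L) (k : ℕ) [NeZero k] :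
    (cycleSd γ k)⁻¹ ≤ L ^ k := by
  have hk : (1 : ℝ) ≤ k := by exact_mod_cast NeZero.pos k
  have hL0 : 0 < L := by linarith
  rw [inv_le_comm₀ (cycleSd_pos hγ k) (by positivity)]
  refine Real.le_sqrt_of_sq_le ?_
  have h2 := inv_pow_le hγ h1 k
  rw [inv_le_comm₀ (by positivity) (by positivity)] at h2
  have h3 : (L ^ k)⁻¹ ≤ 1 := inv_le_one_of_one_le₀ (one_le_pow₀ hL)
  have h4 : 0 ≤ (L ^ k)⁻¹ := by positivity
  have h5 : 0 ≤ γ ^ k := by positivity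
  nlinarith

/-- Converts one missing vertex into a factor `1 / n`. -/
lemma add_pow_sub_one_le {L : ℝ} {n p m : ℕ} (hL : 1 ≤ L) (hn : 0 < n)
    (h : (n : ℝ) + p ≤ L * n) (hm : 1 ≤ m) :
    ((n : ℝ) + p) ^ (m - 1) ≤ L ^ m * ((n : ℝ) ^ m / n) := by
  have hn' : (0 : ℝ) < n := by exact_mod_cast hn
  have hL0 : 0 < L := by linarith
  calc ((n : ℝ) + p) ^ (m - 1) ≤ (L * n) ^ (m - 1) := pow_le_pow_left₀ (by positivity) h _
    _ = L ^ (m - 1) * (n : ℝ) ^ (m - 1) := mul_pow _ _ _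
    _ ≤ L ^ m * (n : ℝ) ^ (m - 1) := by
        gcongr
        omega
    _ = _ := by
        congr 1
        obtain ⟨m, rfl⟩ := Nat.exists_eq_add_of_le' hm
        field_simp
        simp [pow_succ]

lemma sqrt_le_pow_mul {L x : ℝ} {n a b : ℕ} (hL : 1 ≤ L) (hn : 0 < n)
    (h : x ≤ L ^ (2 * a) * ((n : ℝ) ^ (2 * b) / n)) :
    √x ≤ L ^ a * ((n : ℝ) ^ b * (n : ℝ) ^ (-(1 / 2) : ℝ)) := by
  have hn' : (0 : ℝ) < n := by exact_mod_cast hn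
  have hL0 : 0 < L := by linarith
  rw [Real.sqrt_le_left (by positivity)]
  refine h.trans (le_of_eq ?_)
  have h1 : ((n : ℝ) ^ (-(1 / 2) : ℝ)) ^ 2 = (n : ℝ)⁻¹ := by
    rw [← Real.rpow_natCast, ← Real.rpow_mul hn'.le]
    norm_num
    exact Real.rpow_neg_one _
  rw [mul_pow, mul_pow, h1]
  ring

section

variable {γ : ℝ} {p : ℕ → ℕ} {k k' : ℕ → ℕ}

/-- The off-diagonal part has root mean square at most `n ^ (k + k' - 1/2)` up to powers of `L`, and
the prefactor carries `n ^ (-(k + k'))`. -/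
lemma tendsto_rest (hγ : 0 < γ) (hp : Tendsto (fun n => (p n : ℝ) / (n : ℝ)) atTop (𝓝 γ))
    [∀ n, NeZero (k n)] [∀ n, NeZero (k' n)]
    (hk : (fun n => (k n : ℝ)) =o[atTop] fun n : ℕ => √(Real.log (n : ℝ)))
    (hk' : (fun n => (k' n : ℝ)) =o[atTop] fun n : ℕ => √(Real.log (n : ℝ))) :
    Tendsto (fun n => (2 * k' n / ((n : ℝ) ^ k n * (n : ℝ) ^ k' n) * (cycleSd γ (k n))⁻¹ *
      (cycleSd γ (k' n))⁻¹) * √(gaussE (restPoly n (p n) (k n) (k' n) ^ 2))) atTop (𝓝 0) := by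
  have hK : (fun n => ((k n + k' n : ℕ) : ℝ)) =o[atTop] fun n : ℕ => √(Real.log (n : ℝ)) := by
    simpa using hk.add hk'
  refine squeeze_zero' (Eventually.of_forall fun n => ?_) ?_
    (tendsto_log_pow_mul_rpow hK 7 (c := 1 / 2) (by norm_num))
  · have := cycleSd_pos hγ (k n)
    have := cycleSd_pos hγ (k' n)
    positivity
  · filter_upwards [eventually_le_log 1, eventually_le_log γ⁻¹, eventually_mul_le_log hK 4,
      eventually_add_le_log_mul hp, eventually_gt_atTop 0] with n h1 h2 h3 h4 hn
    have : NeZero n := ⟨hn.ne'⟩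
    have hn' : (0 : ℝ) < n := by exact_mod_cast hn
    set L := Real.log n with hL
    have hL0 : 0 < L := by linarith
    have hkpos := NeZero.pos (k n)
    have hkpos' := NeZero.pos (k' n)
    set K := k n + k' n with hKdef
    have h3' : ((4 * K : ℕ) : ℝ) ≤ L := by push_cast at h3 ⊢; linarith
    have h2k : (2 * k' n : ℝ) ≤ L := by
      rw [hKdef] at h3'
      push_cast at h3'
      have : (0 : ℝ) ≤ k n := by positivity
      have : (0 : ℝ) ≤ k' n := by positivity
      linarith
    have hg : gaussE (restPoly n (p n) (k n) (k' n) ^ 2) ≤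
        L ^ (2 * (5 * K)) * ((n : ℝ) ^ (2 * K) / n) := by
      refine (gaussE_restPoly_sq_le (k n) (k' n)).trans ?_
      rw [← hKdef]
      calc _ ≤ (L ^ (2 * K) * ((n : ℝ) ^ (2 * K) / n)) * L ^ (4 * K) * L ^ (4 * K) := by
            gcongr
            exact add_pow_sub_one_le h1 hn h4 (by omega)
        _ = _ := by ring
    have hs := sqrt_le_pow_mul h1 hn hg
    calc (2 * k' n / ((n : ℝ) ^ k n * (n : ℝ) ^ k' n) * (cycleSd γ (k n))⁻¹ *
      (cycleSd γ (k' n))⁻¹) * √(gaussE (restPoly n (p n) (k n) (k' n) ^ 2))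
        ≤ (L / ((n : ℝ) ^ k n * (n : ℝ) ^ k' n) * L ^ k n * L ^ k' n) *
          (L ^ (5 * K) * ((n : ℝ) ^ K * (n : ℝ) ^ (-(1 / 2) : ℝ))) := by
          have := cycleSd_pos hγ (k n)
          have := cycleSd_pos hγ (k' n)
          gcongr
          · exact inv_cycleSd_le hγ h2 h1 _
          · exact inv_cycleSd_le hγ h2 h1 _
      _ = L ^ (1 + 6 * K) * (n : ℝ) ^ (-(1 / 2) : ℝ) := by
          rw [hKdef]
          field_simp
          ring
      _ ≤ L ^ (7 * K) * (n : ℝ) ^ (-(1 / 2) : ℝ) := by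
          gcongr
          omega

/-- The number of cycles is `n ^ k p ^ k` up to a relative error `n ^ (-1 + o(1))`. Comparing `p ^
k` with `(γ n) ^ k` is the one place where the ratio hypothesis does any work. -/
lemma tendsto_card_cyc (hγ : 0 < γ)
    (hp : Tendsto (fun n => (p n : ℝ) / (n : ℝ)) atTop (𝓝 γ))
    [∀ n, NeZero (k n)]
    (hk : (fun n => (k n : ℝ)) =o[atTop] fun n : ℕ => √(Real.log (n : ℝ)))
    (hr : Tendsto (fun n => (k n : ℝ) * ((p n : ℝ) / (n : ℝ) - γ)) atTop (𝓝 0)) :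
    Tendsto (fun n : ℕ => |((n : ℝ) ^ (2 * k n) * γ ^ k n)⁻¹ *
      (Fintype.card (Cyc n (p n) (k n)) : ℝ) - 1|) atTop (𝓝 0) := by
  have h0 := (tendsto_ratio_pow hγ hr).sub_const 1
  rw [sub_self] at h0
  have hlim := (tendsto_log_pow_mul_rpow hk 5 (c := 1) (by norm_num)).add h0.abs
  simp only [abs_zero, add_zero] at hlim
  refine squeeze_zero' (Eventually.of_forall fun n => abs_nonneg _) ?_ hlim
  filter_upwards [eventually_le_log 1, eventually_le_log γ⁻¹, eventually_mul_le_log hk 2,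
      eventually_add_le_log_mul hp, eventually_gt_atTop 0] with n h1 h2 h3 h4 hn
  have : NeZero n := ⟨hn.ne'⟩
  have hn' : (0 : ℝ) < n := by exact_mod_cast hn
  set L := Real.log n with hL
  have hL0 : 0 < L := by linarith
  have hkpos := NeZero.pos (k n)
  have hc := abs_sum_cyc_sub_le n (p n) (k n) (fun _ => 1) zero_le_one (by simp)
  simp only [Finset.sum_const, Finset.card_univ, nsmul_eq_mul, mul_one] at hc
  have hcard : (Fintype.card ((Fin (k n) → Fin n) × (Fin (k n) → Fin (p n))) : ℝ) =
      (n : ℝ) ^ k n * (p n : ℝ) ^ k n := by simp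
  rw [hcard] at hc
  have e1 : ((n : ℝ) ^ (2 * k n) * γ ^ k n)⁻¹ * ((n : ℝ) ^ k n * (p n : ℝ) ^ k n) =
      ((p n : ℝ) / n) ^ k n / γ ^ k n := by
    rw [div_pow]
    field_simp
    ring
  have e2 : ((n : ℝ) ^ (2 * k n) * γ ^ k n)⁻¹ * (Fintype.card (Cyc n (p n) (k n)) : ℝ) - 1 =
      ((n : ℝ) ^ (2 * k n) * γ ^ k n)⁻¹ * ((Fintype.card (Cyc n (p n) (k n)) : ℝ) -
        (n : ℝ) ^ k n * (p n : ℝ) ^ k n) + (((p n : ℝ) / n) ^ k n / γ ^ k n - 1) := by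
    rw [← e1]; ring
  rw [e2]
  refine (abs_add_le _ _).trans (add_le_add_left ?_ _)
  rw [abs_mul, abs_of_nonneg (by positivity : 0 ≤ ((n : ℝ) ^ (2 * k n) * γ ^ k n)⁻¹), mul_inv]
  calc ((n : ℝ) ^ (2 * k n))⁻¹ * (γ ^ k n)⁻¹ * _
      ≤ ((n : ℝ) ^ (2 * k n))⁻¹ * L ^ k n *
        ((L ^ (2 * k n) * ((n : ℝ) ^ (2 * k n) / n)) * L ^ (2 * k n)) := by
        refine mul_le_mul ?_ (hc.trans ?_) (abs_nonneg _) (by positivity)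
        · gcongr
          exact inv_pow_le hγ h2 _
        · gcongr
          · exact add_pow_sub_one_le h1 hn h4 (by omega)
          · push_cast; exact h3
    _ = L ^ (5 * k n) * (n : ℝ) ^ (-1 : ℝ) := by
        rw [Real.rpow_neg_one]
        field_simp
        ring

/-- The diagonal part concentrates around the number of cycles, with relative fluctuation `n ^ (-1/2
+ o(1))`. -/
lemma tendsto_main (hγ : 0 < γ) (hp : Tendsto (fun n => (p n : ℝ) / (n : ℝ)) atTop (𝓝 γ))
    [∀ n, NeZero (k n)]
    (hk : (fun n => (k n : ℝ)) =o[atTop] fun n : ℕ => √(Real.log (n : ℝ))) :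
    Tendsto (fun n : ℕ => ((n : ℝ) ^ (2 * k n) * γ ^ k n)⁻¹ *
      √(gaussE ((mainPoly n (p n) (k n) - C (Fintype.card (Cyc n (p n) (k n)) : ℝ)) ^ 2)))
      atTop (𝓝 0) := by
  refine squeeze_zero' (Eventually.of_forall fun n => by positivity) ?_
    (tendsto_log_pow_mul_rpow hk 9 (c := 1 / 2) (by norm_num))
  filter_upwards [eventually_le_log 1, eventually_le_log γ⁻¹, eventually_mul_le_log hk 8,
      eventually_add_le_log_mul hp, eventually_gt_atTop 0] with n h1 h2 h3 h4 hn
  have : NeZero n := ⟨hn.ne'⟩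
  have hn' : (0 : ℝ) < n := by exact_mod_cast hn
  set L := Real.log n with hL
  have hL0 : 0 < L := by linarith
  have hkpos := NeZero.pos (k n)
  have h3' : ((8 * k n : ℕ) : ℝ) ≤ L := by push_cast; exact h3
  have h3'' : ((4 * k n : ℕ) : ℝ) ≤ L := by
    refine le_trans ?_ h3'
    exact_mod_cast (by omega : 4 * k n ≤ 8 * k n)
  have hg : gaussE ((mainPoly n (p n) (k n) - C (Fintype.card (Cyc n (p n) (k n)) : ℝ)) ^ 2) ≤
      L ^ (2 * (8 * k n)) * ((n : ℝ) ^ (2 * (2 * k n)) / n) := by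
    refine (gaussE_mainPoly_sub_sq_le (k n)).trans ?_
    calc _ ≤ (L ^ (4 * k n) * ((n : ℝ) ^ (4 * k n) / n)) * L ^ (4 * k n) * L ^ (8 * k n) := by
          gcongr
          exact add_pow_sub_one_le h1 hn h4 (by omega)
      _ = _ := by ring
  have hs := sqrt_le_pow_mul h1 hn hg
  rw [mul_inv]
  calc ((n : ℝ) ^ (2 * k n))⁻¹ * (γ ^ k n)⁻¹ * _
      ≤ ((n : ℝ) ^ (2 * k n))⁻¹ * L ^ k n *
        (L ^ (8 * k n) * ((n : ℝ) ^ (2 * k n) * (n : ℝ) ^ (-(1 / 2) : ℝ))) := by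
        gcongr
        exact inv_pow_le hγ h2 _
    _ = L ^ (9 * k n) * (n : ℝ) ^ (-(1 / 2) : ℝ) := by
        field_simp
        ring

/-- The characteristic function of a linear combination of normalized signed cycles converges. -/
theorem tendsto_expE_cyclePoly (hγ : 0 < γ)
    (hp : Tendsto (fun n => (p n : ℝ) / (n : ℝ)) atTop (𝓝 γ)) {l : ℕ} {k : ℕ → Fin l → ℕ}
    [hk0 : ∀ n r, NeZero (k n r)] (hk_inj : ∀ n, Function.Injective (k n))
    (hk_small : ∀ r, (fun n => (k n r : ℝ)) =o[atTop] fun n => √(Real.log (n : ℝ)))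
    (hk_ratio : ∀ r, Tendsto (fun n => (k n r : ℝ) * ((p n : ℝ) / (n : ℝ) - γ)) atTop (𝓝 0))
    (t : Fin l → ℝ) :
    Tendsto (fun n => expE (cyclePoly n (p n) (fun r => t r * (cycleSd γ (k n r))⁻¹) (k n)) 1 1)
      atTop (𝓝 (Complex.exp ((-((∑ r, t r ^ 2) / 2) : ℝ)))) := by
  rw [tendsto_iff_norm_sub_tendsto_zero]
  -- Bounds the L¹ distance of the `(r, r')` block of `Γ` from `1` if `r = r'` and from `0`
  -- otherwise: different cycles, fluctuation of the diagonal pairs, and error in the number of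
  -- cycles.
  set E : ℕ → Fin l → Fin l → ℝ := fun n r r' =>
    ((2 * k n r' / ((n : ℝ) ^ k n r * (n : ℝ) ^ k n r') * (cycleSd γ (k n r))⁻¹ *
      (cycleSd γ (k n r'))⁻¹) * √(gaussE (restPoly n (p n) (k n r) (k n r') ^ 2))) +
    if r = r' then ((n : ℝ) ^ (2 * k n r) * γ ^ k n r)⁻¹ *
      √(gaussE ((mainPoly n (p n) (k n r) - C (Fintype.card (Cyc n (p n) (k n r)) : ℝ)) ^ 2)) +
      |((n : ℝ) ^ (2 * k n r) * γ ^ k n r)⁻¹ * (Fintype.card (Cyc n (p n) (k n r)) : ℝ) - 1|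
    else 0 with hE
  have hElim : ∀ r r', Tendsto (fun n => E n r r') atTop (𝓝 0) := by
    intro r r'
    have h1 := tendsto_rest (k := fun n => k n r) (k' := fun n => k n r') hγ hp
      (hk_small r) (hk_small r')
    have h2 := tendsto_main (k := fun n => k n r) hγ hp (hk_small r)
    have h3 := tendsto_card_cyc (k := fun n => k n r) hγ hp (hk_small r) (hk_ratio r)
    by_cases h : r = r'
    · simpa [hE, h] using! h1.add (h2.add h3)
    · simpa [hE, h] using! h1
  have hlim : Tendsto (fun n => ∑ r, ∑ r', |t r * t r'| * E n r r') atTop (𝓝 0) := by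
    have : (0 : ℝ) = ∑ r : Fin l, ∑ r' : Fin l, |t r * t r'| * 0 := by simp
    rw [this]
    exact tendsto_finsetSum _ fun r _ => tendsto_finsetSum _ fun r' _ => (hElim r r').const_mul _
  refine squeeze_zero' (Eventually.of_forall fun n => norm_nonneg _) ?_ hlim
  filter_upwards [eventually_gt_atTop 0] with n hn
  have hn' : (0 : ℝ) < n := by exact_mod_cast hn
  generalize hb : (fun r => t r * (cycleSd γ (k n r))⁻¹) = b
  refine (norm_charFun_sub_le (expE_cyclePoly hn.ne' b (k n)) _
    (Finset.sum_nonneg fun r _ => sq_nonneg _)).trans ?_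
  obtain ⟨c, hc⟩ : ∃ c : Fin l → Fin l → ℝ,
      c = fun r r' => 2 * k n r' / ((n : ℝ) ^ k n r * (n : ℝ) ^ k n r') *
    (cycleSd γ (k n r))⁻¹ * (cycleSd γ (k n r'))⁻¹ := ⟨_, rfl⟩
  have hc0 : ∀ r r', 0 ≤ c r r' := by
    intro r r'
    have := cycleSd_pos hγ (k n r)
    have := cycleSd_pos hγ (k n r')
    rw [hc]
    positivity
  have hdecomp : gammaPoly n (p n) b (k n) - C (∑ r, t r ^ 2) = ∑ r, ∑ r', C (t r * t r') *
      (C (c r r') * pairPoly n (p n) (k n r) (k n r') - C (if r = r' then 1 else 0)) := by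
    have e1 : gammaPoly n (p n) b (k n) = ∑ r, ∑ r', C (t r * t r') *
        (C (c r r') * pairPoly n (p n) (k n r) (k n r')) := by
      rw [gammaPoly]
      refine Finset.sum_congr rfl fun r _ => Finset.sum_congr rfl fun r' _ => ?_
      rw [← mul_assoc (C (t r * t r')), ← C_mul]
      have : b r * b r' * (2 * k n r' / ((n : ℝ) ^ k n r * (n : ℝ) ^ k n r')) =
          t r * t r' * c r r' := by
        simp only [← hb, hc]; ring
      rw [this]
    have e2 : (C (∑ r, t r ^ 2) : MvPolynomial (Fin n × Fin (p n)) ℝ) =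
        ∑ r, ∑ r', C (t r * t r') * C (if r = r' then 1 else 0) := by
      rw [map_sum]
      refine Finset.sum_congr rfl fun r _ => ?_
      rw [Finset.sum_eq_single r]
      · rw [if_pos rfl, ← C_mul, mul_one, pow_two]
      · intro r' _ hr'
        rw [if_neg (Ne.symm hr'), C_0, mul_zero]
      · simp
    rw [e1, e2]
    simp only [mul_sub, Finset.sum_sub_distrib]
  have hinteq : ∫ x, |eval x (gammaPoly n (p n) b (k n)) - ∑ r, t r ^ 2| ∂gaussPi (Fin n × Fin (p n))
      = ∫ x, |eval x (gammaPoly n (p n) b (k n) - C (∑ r, t r ^ 2))|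
        ∂gaussPi (Fin n × Fin (p n)) := by simp
  rw [hinteq, hdecomp]
  refine (integral_abs_eval_sum_le _ _).trans (Finset.sum_le_sum fun r _ => ?_)
  refine (integral_abs_eval_sum_le _ _).trans (Finset.sum_le_sum fun r' _ => ?_)
  rw [integral_abs_eval_C_mul]
  refine mul_le_mul_of_nonneg_left ?_ (abs_nonneg _)
  have hrest : ∫ x, |eval x (C (c r r') * restPoly n (p n) (k n r) (k n r'))|
      ∂gaussPi (Fin n × Fin (p n)) ≤
      c r r' * √(gaussE (restPoly n (p n) (k n r) (k n r') ^ 2)) := by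
    rw [integral_abs_eval_C_mul, abs_of_nonneg (hc0 r r')]
    exact mul_le_mul_of_nonneg_left (integral_abs_eval_le_sqrt _) (hc0 r r')
  by_cases h : r = r'
  · subst h
    -- The factor `2 k` from the positions cancels the one in the variance `2 k γ ^ k`.
    have hcrr : c r r = ((n : ℝ) ^ (2 * k n r) * γ ^ k n r)⁻¹ := by
      have hkpos : (0 : ℝ) < k n r := by exact_mod_cast NeZero.pos (k n r)
      have hsq : cycleSd γ (k n r) * cycleSd γ (k n r) = 2 * k n r * γ ^ k n r :=
        Real.mul_self_sqrt (by positivity)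
      have h1 : c r r = 2 * k n r / ((n : ℝ) ^ k n r * (n : ℝ) ^ k n r) *
          (cycleSd γ (k n r) * cycleSd γ (k n r))⁻¹ := by simp only [hc]; rw [mul_inv]; ring
      rw [h1, hsq]
      field_simp
      ring
    have hsplit : C (c r r) * pairPoly n (p n) (k n r) (k n r) - C (if r = r then 1 else 0) =
        C (c r r) * restPoly n (p n) (k n r) (k n r) +
        (C (c r r) * (mainPoly n (p n) (k n r) - C (Fintype.card (Cyc n (p n) (k n r)) : ℝ)) +
          C (c r r * (Fintype.card (Cyc n (p n) (k n r)) : ℝ) - 1)) := by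
      rw [pairPoly_self, if_pos rfl, C_sub, C_mul]
      ring
    rw [hsplit]
    refine (integral_abs_eval_add_le _ _).trans ?_
    simp only [hE, if_true]
    have hcr := congrFun (congrFun hc r) r
    rw [← hcr]
    refine add_le_add hrest ((integral_abs_eval_add_le _ _).trans (add_le_add ?_ ?_))
    · rw [integral_abs_eval_C_mul, abs_of_nonneg (hc0 r r), ← hcrr]
      exact mul_le_mul_of_nonneg_left (integral_abs_eval_le_sqrt _) (hc0 r r)
    · rw [← hcrr]; simp
  · simp only [hE, if_neg h, add_zero, C_0, sub_zero]
    -- Cycles of different lengths are never equal, so there is no diagonal part: this is the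
    -- asymptotic independence.
    rw [pairPoly_eq_rest_of_ne _ _ (fun h' => h (hk_inj n h'))]
    have hcr := congrFun (congrFun hc r) r'
    rw [← hcr]
    exact hrest

end

end

section

/-! ### Signed cycles of deterministic signals -/

section Trace

variable {I J : Type*} [Fintype I] [DecidableEq I] [Fintype J]

/-- The weight `g` on the endpoints is arbitrary so that the induction can absorb the first step of
the path into it; the closing edge of a cycle is a special case. -/
lemma sum_prod_path (M : Matrix I I ℝ) (m : ℕ) (g : I → I → ℝ) :
    ∑ i : Fin (m + 1) → I, (∏ t : Fin m, M (i t.castSucc) (i t.succ)) * g (i 0) (i (Fin.last m)) =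
      ∑ a, ∑ b, (M ^ m) a b * g a b := by
  induction m generalizing g with
  | zero =>
    simp only [Finset.univ_eq_empty, Finset.prod_empty, one_mul, pow_zero, Matrix.one_apply,
      ite_mul, zero_mul, Finset.sum_ite_eq, Finset.mem_univ, if_true]
    exact Fintype.sum_equiv (Equiv.funUnique (Fin 1) I) _ _ fun i => rfl
  | succ m ih =>
    rw [← (Fin.consEquiv fun _ : Fin (m + 2) => I).sum_comp, Fintype.sum_prod_type]
    refine Finset.sum_congr rfl fun a _ => ?_
    have h := ih fun x y => M a x * g a y
    have e : ∀ i : Fin (m + 1) → I, (∏ t : Fin (m + 1),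
        M ((Fin.consEquiv fun _ : Fin (m + 2) => I) (a, i) t.castSucc)
          ((Fin.consEquiv fun _ : Fin (m + 2) => I) (a, i) t.succ)) *
        g ((Fin.consEquiv fun _ : Fin (m + 2) => I) (a, i) 0)
          ((Fin.consEquiv fun _ : Fin (m + 2) => I) (a, i) (Fin.last (m + 1))) =
        (∏ t : Fin m, M (i t.castSucc) (i t.succ)) * (M a (i 0) * g a (i (Fin.last m))) := by
      intro i
      rw [Fin.prod_univ_succ]
      simp only [Fin.consEquiv_apply, Fin.castSucc_zero, Fin.cons_zero, Fin.cons_succ,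
        ← Fin.succ_castSucc, ← Fin.succ_last]
      ring
    simp_rw [e]
    rw [h, Finset.sum_comm]
    refine Finset.sum_congr rfl fun y _ => ?_
    rw [pow_succ', Matrix.mul_apply, Finset.sum_mul]
    refine Finset.sum_congr rfl fun x _ => ?_
    ring

lemma sum_prod_cycle_eq_trace (M : Matrix I I ℝ) (k : ℕ) [NeZero k] :
    ∑ i : Fin k → I, ∏ t, M (i t) (i (finRotate k t)) = (M ^ k).trace := by
  obtain ⟨m, rfl⟩ := Nat.exists_eq_succ_of_ne_zero (NeZero.ne k)
  have h := sum_prod_path M m fun x y => M y x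
  have e : ∀ i : Fin (m + 1) → I, ∏ t, M (i t) (i (finRotate (m + 1) t)) =
      (∏ t : Fin m, M (i t.castSucc) (i t.succ)) * M (i (Fin.last m)) (i 0) := by
    intro i
    rw [Fin.prod_univ_castSucc]
    simp
  simp_rw [Nat.succ_eq_add_one, e]
  rw [h, pow_succ, Matrix.trace]
  simp [Matrix.mul_apply]

/-- Cyclicity of the trace, used to pass from `n × n` to `κ × κ` matrices. At `k = 0` it would
compare the sizes of `I` and `J`. -/
lemma trace_mul_pow_comm [DecidableEq J] (A : Matrix I J ℝ) (B : Matrix J I ℝ) (k : ℕ) [NeZero k] :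
    ((A * B) ^ k).trace = ((B * A) ^ k).trace := by
  obtain ⟨m, rfl⟩ := Nat.exists_eq_succ_of_ne_zero (NeZero.ne k)
  have h : ∀ m : ℕ, (A * B) ^ (m + 1) = A * ((B * A) ^ m * B) := by
    intro m
    induction m with
    | zero => simp
    | succ m ih =>
      rw [pow_succ, ih, pow_succ (B * A) m]
      simp only [Matrix.mul_assoc]
  rw [Nat.succ_eq_add_one, h, Matrix.trace_mul_comm, pow_succ, Matrix.mul_assoc]

lemma sum_prod_bipartite_cycle (A : Matrix I J ℝ) (B : Matrix J I ℝ) (k : ℕ) [NeZero k] :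
    ∑ f : (Fin k → I) × (Fin k → J), ∏ t, (A (f.1 t) (f.2 t) * B (f.2 t) (f.1 (finRotate k t))) =
      ((A * B) ^ k).trace := by
  rw [← sum_prod_cycle_eq_trace, Fintype.sum_prod_type]
  refine Finset.sum_congr rfl fun i _ => ?_
  simp only [Matrix.mul_apply]
  rw [Finset.prod_univ_sum]
  simp [Fintype.piFinset_univ]

lemma cyclicSum_eq_trace {κ : ℕ} (CΘ CU : Matrix (Fin κ) (Fin κ) ℝ) (k : ℕ) [NeZero k] :
    cyclicSum CΘ CU k = ((CΘ * CU) ^ k).trace := by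
  rw [trace_mul_pow_comm, ← sum_prod_bipartite_cycle, cyclicSum]
  exact Fintype.sum_equiv (Equiv.arrowProdEquivProdArrow (Fin k) (fun _ => Fin κ) fun _ => Fin κ)
    _ _ fun L => rfl

end Trace

/-! ### From the signed cycle of a signal to traces of powers of small matrices -/

section SignalBounds

variable {n p κ : ℕ} (k : ℕ) [NeZero k]

/-- Without the distinctness of the indices, the sum over bipartite closed walks is exactly the
trace. -/
lemma abs_bicycle_sub_trace_le [NeZero n] (S : Matrix (Fin n) (Fin p) ℝ) {δ : ℝ} (hδ0 : 0 ≤ δ)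
    (hδ : ∀ i j, |S i j| ≤ δ) :
    |bicycle k (fun i j => S i j) - 1 / (n : ℝ) ^ k * ((S * Sᵀ) ^ k).trace| ≤ 1 / (n : ℝ) ^ k *
      (((n : ℝ) + p) ^ (2 * k - 1) * ((2 * k : ℕ) : ℝ) ^ (2 * k) * (δ ^ 2) ^ k) := by
  rw [← sum_prod_bipartite_cycle, bicycle_eq_sum_cyc, ← mul_sub, abs_mul,
    abs_of_nonneg (by positivity : (0 : ℝ) ≤ 1 / (n : ℝ) ^ k)]
  refine mul_le_mul_of_nonneg_left ?_ (by positivity)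
  have := abs_sum_cyc_sub_le n p k
    (fun f => ∏ t, (S (f.1 t) (f.2 t) * Sᵀ (f.2 t) (f.1 (finRotate k t)))) (M := (δ ^ 2) ^ k)
    (by positivity) (by
      intro f
      rw [Finset.abs_prod]
      calc _ ≤ ∏ _t : Fin k, δ ^ 2 := by
            refine Finset.prod_le_prod (fun _ _ => abs_nonneg _) fun t _ => ?_
            rw [abs_mul, pow_two]
            exact mul_le_mul (hδ _ _) (hδ _ _) (abs_nonneg _) hδ0
        _ = _ := by simp)
  refine le_trans (le_of_eq ?_) this
  congr 2
  refine Finset.sum_congr rfl fun c _ => ?_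
  exact prod_edge c fun e => S e.1 e.2

/-- The right side lives in the fixed dimension `κ` and depends on the signal only through two Gram
matrices, to which the law of large numbers applies. -/
lemma trace_signal_pow [NeZero n] (T : Matrix (Fin n) (Fin κ) ℝ) (W : Matrix (Fin p) (Fin κ) ℝ) :
    1 / (n : ℝ) ^ k * (((T * Wᵀ) * (T * Wᵀ)ᵀ) ^ k).trace =
      ((Wᵀ * W * ((1 / (n : ℝ)) • (Tᵀ * T))) ^ k).trace := by
  rw [Matrix.transpose_mul, Matrix.transpose_transpose]
  have h1 : T * Wᵀ * (W * Tᵀ) = T * (Wᵀ * W * Tᵀ) := by simp only [Matrix.mul_assoc]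
  rw [h1, trace_mul_pow_comm, Matrix.mul_smul, smul_pow, Matrix.trace_smul, Matrix.mul_assoc,
    smul_eq_mul, _root_.one_div_pow]

attribute [local instance] Matrix.linftyOpNormedRing

lemma abs_entry_le_norm (A : Matrix (Fin κ) (Fin κ) ℝ) (a b : Fin κ) : |A a b| ≤ ‖A‖ := by
  rw [Matrix.linfty_opNorm_def]
  have h1 : ‖A a b‖₊ ≤ ∑ j, ‖A a j‖₊ :=
    Finset.single_le_sum (f := fun j => ‖A a j‖₊) (fun _ _ => zero_le) (Finset.mem_univ b)
  have h2 : ∑ j, ‖A a j‖₊ ≤ Finset.univ.sup fun i => ∑ j, ‖A i j‖₊ :=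
    Finset.le_sup (f := fun i => ∑ j, ‖A i j‖₊) (Finset.mem_univ a)
  exact_mod_cast h1.trans h2

lemma norm_le_of_entry_le (A : Matrix (Fin κ) (Fin κ) ℝ) {η : ℝ} (hη : 0 ≤ η)
    (h : ∀ a b, |A a b| ≤ η) : ‖A‖ ≤ κ * η := by
  rw [Matrix.linfty_opNorm_def]
  lift η to NNReal using hη
  have : Finset.univ.sup (fun i => ∑ j, ‖A i j‖₊) ≤ κ * η := by
    refine Finset.sup_le fun i _ => ?_
    calc ∑ j, ‖A i j‖₊ ≤ ∑ _j : Fin κ, η := by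
          refine Finset.sum_le_sum fun j _ => ?_
          have := h i j
          exact_mod_cast this
      _ = κ * η := by simp
  exact_mod_cast this

lemma abs_trace_le (A : Matrix (Fin κ) (Fin κ) ℝ) : |A.trace| ≤ κ * ‖A‖ := by
  rw [Matrix.trace]
  refine (Finset.abs_sum_le_sum_abs _ _).trans ?_
  calc _ ≤ ∑ _a : Fin κ, ‖A‖ := Finset.sum_le_sum fun a _ => abs_entry_le_norm A a a
    _ = _ := by simp

/-- Telescoping in a submultiplicative norm. The loss `k M ^ k` is harmless against a power of `n`,
which is what allows `k` to grow. -/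
lemma norm_pow_sub_pow_le (A B : Matrix (Fin κ) (Fin κ) ℝ) {M η : ℝ} (hM : 1 ≤ M)
    (hA : ‖A‖ ≤ M) (hB : ‖B‖ ≤ M) (hη : ‖A - B‖ ≤ η) : ‖A ^ k - B ^ k‖ ≤ k * M ^ k * η := by
  obtain ⟨m, rfl⟩ := Nat.exists_eq_succ_of_ne_zero (NeZero.ne k)
  have hη0 : 0 ≤ η := (norm_nonneg _).trans hη
  induction m with
  | zero =>
    simp only [Nat.succ_eq_add_one, zero_add, pow_one, Nat.cast_one, one_mul]
    exact hη.trans (le_mul_of_one_le_left hη0 hM)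
  | succ m ih =>
    have e : A ^ (m + 2) - B ^ (m + 2) =
        A ^ (m + 1) * (A - B) + (A ^ (m + 1) - B ^ (m + 1)) * B := by
      rw [pow_succ A, pow_succ B]; noncomm_ring
    have hAp : ‖A ^ (m + 1)‖ ≤ M ^ (m + 1) :=
      (norm_pow_le' A (by omega)).trans (pow_le_pow_left₀ (norm_nonneg _) hA _)
    have h1 : ‖A ^ (m + 1) * (A - B)‖ ≤ M ^ (m + 1) * η :=
      (norm_mul_le _ _).trans (mul_le_mul hAp hη (norm_nonneg _) (by positivity))
    have h2 : ‖(A ^ (m + 1) - B ^ (m + 1)) * B‖ ≤ (m + 1 : ℕ) * M ^ (m + 1) * η * M :=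
      (norm_mul_le _ _).trans (mul_le_mul (ih ) hB (norm_nonneg _) (by positivity))
    have h3 : M ^ (m + 1) * η ≤ M ^ (m + 2) * η :=
      mul_le_mul_of_nonneg_right (pow_le_pow_right₀ hM (by omega)) hη0
    rw [Nat.succ_eq_add_one, show m + 1 + 1 = m + 2 by rfl, e]
    calc _ ≤ _ := norm_add_le _ _
      _ ≤ M ^ (m + 2) * η + (m + 1 : ℕ) * M ^ (m + 1) * η * M := add_le_add (h1.trans h3) h2
      _ = _ := by push_cast; ring

lemma abs_trace_pow_sub_le (A B : Matrix (Fin κ) (Fin κ) ℝ) {M η : ℝ} (hM : 1 ≤ M)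
    (hA : ‖A‖ ≤ M) (hB : ‖B‖ ≤ M) (hη : ‖A - B‖ ≤ η) :
    |(A ^ k).trace - (B ^ k).trace| ≤ κ * (k * M ^ k * η) := by
  rw [← Matrix.trace_sub]
  refine (abs_trace_le _).trans ?_
  gcongr
  exact norm_pow_sub_pow_le k A B hM hA hB hη

end SignalBounds

/-! ### Error bounds uniform over small signals -/

section SignalAsymptotics

variable {γ : ℝ} {p : ℕ → ℕ} {k : ℕ → ℕ}

/-- For `δ = L ^ 3 / √n` the quantity `δ ^ 2 (n + p)` lies between 1 and `L ^ 7`, so the mixed terms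
keep their gain of `n ^ (-1/2)`. The threshold 16 lets `L ^ k` absorb `16 ^ k`. Uniformity in `s` is
needed because the signal is random. -/
lemma eventually_cross_le (hγ : 0 < γ) (hp : Tendsto (fun n => (p n : ℝ) / (n : ℝ)) atTop (𝓝 γ))
    [∀ n, NeZero (k n)]
    (hk : (fun n => (k n : ℝ)) =o[atTop] fun n : ℕ => √(Real.log (n : ℝ))) :
    ∀ᶠ n : ℕ in atTop, ∀ s : Fin n × Fin (p n) → ℝ, (∀ e, |s e| ≤ Real.log n ^ 3 / √n) →
      (cycleSd γ (k n))⁻¹ * √(gaussE (crossPoly (k n) s ^ 2)) ≤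
        Real.log n ^ (14 * k n) * (n : ℝ) ^ (-(1 / 2) : ℝ) := by
  filter_upwards [eventually_le_log 16, eventually_le_log γ⁻¹, eventually_mul_le_log hk 4,
      eventually_add_le_log_mul hp, eventually_gt_atTop 0] with n h1 h2 h3 h4 hn s hs
  have : NeZero n := ⟨hn.ne'⟩
  have hn' : (0 : ℝ) < n := by exact_mod_cast hn
  set L := Real.log n with hL
  have hL1 : 1 ≤ L := by linarith
  have hL0 : 0 < L := by linarith
  have hkpos := NeZero.pos (k n)
  have h3' : ((4 * k n : ℕ) : ℝ) ≤ L := by push_cast; exact h3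
  have hδ2 : (L ^ 3 / √n) ^ 2 = L ^ 6 / n := by
    rw [div_pow, Real.sq_sqrt hn'.le]; ring
  have hup : (L ^ 3 / √n) ^ 2 * ((n : ℝ) + p n) ≤ L ^ 7 := by
    rw [hδ2]
    calc L ^ 6 / n * ((n : ℝ) + p n) ≤ L ^ 6 / n * (L * n) := by gcongr
      _ = L ^ 7 := by field_simp
  have hlow : 1 ≤ (L ^ 3 / √n) ^ 2 * ((n : ℝ) + p n) := by
    rw [hδ2]
    have hp0 : (0 : ℝ) ≤ p n := by positivity
    calc 1 ≤ L ^ 6 := one_le_pow₀ hL1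
      _ = L ^ 6 / n * n := by field_simp
      _ ≤ _ := by gcongr; linarith
  have hg : gaussE (crossPoly (k n) s ^ 2) ≤ L ^ (2 * (13 * k n)) * ((n : ℝ) ^ (2 * 0) / n) := by
    refine (gaussE_crossPoly_sq_le (k n) s hs hlow).trans ?_
    calc _ ≤ L ^ k n * ((1 / (n : ℝ) ^ k n) ^ 2 * ((L ^ 7) ^ (2 * k n) *
          (L ^ (2 * k n) * ((n : ℝ) ^ (2 * k n) / n)) * L ^ (4 * k n) * L ^ (4 * k n))) := by
          gcongr
          exact add_pow_sub_one_le hL1 hn h4 (by omega)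
      _ = L ^ (25 * k n) * ((n : ℝ) ^ (2 * 0) / n) := by
          field_simp
          ring
      _ ≤ _ := mul_le_mul_of_nonneg_right (pow_le_pow_right₀ hL1 (by omega)) (by positivity)
  have hsq := sqrt_le_pow_mul hL1 hn hg
  calc _ ≤ L ^ k n * (L ^ (13 * k n) * ((n : ℝ) ^ 0 * (n : ℝ) ^ (-(1 / 2) : ℝ))) := by
        gcongr
        exact inv_cycleSd_le hγ h2 hL1 _
    _ = _ := by ring

lemma eventually_bicycle_signal_le (hγ : 0 < γ)
    (hp : Tendsto (fun n => (p n : ℝ) / (n : ℝ)) atTop (𝓝 γ))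
    [∀ n, NeZero (k n)]
    (hk : (fun n => (k n : ℝ)) =o[atTop] fun n : ℕ => √(Real.log (n : ℝ))) :
    ∀ᶠ n : ℕ in atTop, ∀ S : Matrix (Fin n) (Fin (p n)) ℝ,
      (∀ i j, |S i j| ≤ Real.log n ^ 3 / √n) →
      (cycleSd γ (k n))⁻¹ *
        |bicycle (k n) (fun i j => S i j) - 1 / (n : ℝ) ^ k n * ((S * Sᵀ) ^ k n).trace| ≤
        Real.log n ^ (11 * k n) * (n : ℝ) ^ (-1 : ℝ) := by
  filter_upwards [eventually_le_log 1, eventually_le_log γ⁻¹, eventually_mul_le_log hk 2,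
      eventually_add_le_log_mul hp, eventually_gt_atTop 0] with n hL1 h2 h3 h4 hn S hS
  have : NeZero n := ⟨hn.ne'⟩
  have hn' : (0 : ℝ) < n := by exact_mod_cast hn
  set L := Real.log n with hL
  have hL0 : 0 < L := by linarith
  have hkpos := NeZero.pos (k n)
  have h3' : ((2 * k n : ℕ) : ℝ) ≤ L := by push_cast; exact h3
  have hδ2 : (L ^ 3 / √n) ^ 2 = L ^ 6 / n := by
    rw [div_pow, Real.sq_sqrt hn'.le]; ring
  have hb := abs_bicycle_sub_trace_le (k n) S (by positivity) hS
  rw [hδ2] at hb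
  calc _ ≤ L ^ k n * (1 / (n : ℝ) ^ k n * ((L ^ (2 * k n) * ((n : ℝ) ^ (2 * k n) / n)) *
        L ^ (2 * k n) * (L ^ 6 / n) ^ k n)) := by
        refine mul_le_mul (inv_cycleSd_le hγ h2 hL1 _) (hb.trans ?_) (abs_nonneg _) (by positivity)
        gcongr
        exact add_pow_sub_one_le hL1 hn h4 (by omega)
    _ = _ := by
        rw [Real.rpow_neg_one, div_pow]
        field_simp
        ring

attribute [local instance] Matrix.linftyOpNormedRing

/-- Once `L n ^ (-c) ≤ 1`, both matrices have norm at most `L`, and `norm_pow_sub_pow_le` loses only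
a power of `L` with exponent `O(k)`. -/
lemma eventually_trace_le (hγ : 0 < γ) {κ : ℕ} (D : Matrix (Fin κ) (Fin κ) ℝ)
    [∀ n, NeZero (k n)]
    (hk : (fun n => (k n : ℝ)) =o[atTop] fun n : ℕ => √(Real.log (n : ℝ))) {c : ℝ} (hc : 0 < c) :
    ∀ᶠ n : ℕ in atTop, ∀ G : Matrix (Fin κ) (Fin κ) ℝ, ‖G - D‖ ≤ Real.log n * (n : ℝ) ^ (-c) →
      (cycleSd γ (k n))⁻¹ * |(G ^ k n).trace - (D ^ k n).trace| ≤
        Real.log n ^ (5 * k n) * (n : ℝ) ^ (-c) := by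
  have hone := tendsto_log_pow_mul_rpow hk 1 hc
  filter_upwards [eventually_le_log 1, eventually_le_log γ⁻¹, eventually_mul_le_log hk 1,
      eventually_le_log κ, eventually_le_log (‖D‖ + 1), eventually_gt_atTop 0,
      hone.eventually_le_const zero_lt_one] with n hL1 h2 h3 h4 h5 hn h6 G hG
  have hn' : (0 : ℝ) < n := by exact_mod_cast hn
  set L := Real.log n with hL
  have hL0 : 0 < L := by linarith
  have hkpos := NeZero.pos (k n)
  have hG1 : ‖G - D‖ ≤ 1 := by
    refine hG.trans (le_trans ?_ h6)
    have : L ^ 1 ≤ L ^ (1 * k n) := pow_le_pow_right₀ hL1 (by omega)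
    rw [pow_one] at this
    gcongr
  have hG2 : ‖G‖ ≤ L := by
    have := norm_le_norm_add_norm_sub' G D
    linarith
  have ht := abs_trace_pow_sub_le (k n) G D hL1 hG2 (by linarith) hG
  have hnc : 0 < (n : ℝ) ^ (-c) := Real.rpow_pos_of_pos hn' _
  calc _ ≤ L ^ k n * (L * (L * L ^ k n * (L * (n : ℝ) ^ (-c)))) := by
        refine mul_le_mul (inv_cycleSd_le hγ h2 hL1 _) (ht.trans ?_) (abs_nonneg _) (by positivity)
        gcongr
        linarith
    _ = L ^ (2 * k n + 3) * (n : ℝ) ^ (-c) := by ring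
    _ ≤ _ := by
        gcongr
        omega

end SignalAsymptotics

end

section

/-! ### The frame -/

section Frame

variable {p κ : ℕ}

open scoped MatrixOrder

lemma gram_posSemidef (U : Fin p → Fin κ → ℝ) : ((Matrix.of U)ᵀ * Matrix.of U).PosSemidef := by
  have := Matrix.posSemidef_conjTranspose_mul_self (Matrix.of U)
  rwa [Matrix.conjTranspose_eq_transpose_of_trivial] at this

lemma sqrt_gram_mul_self (U : Fin p → Fin κ → ℝ) :
    CFC.sqrt ((Matrix.of U)ᵀ * Matrix.of U) * CFC.sqrt ((Matrix.of U)ᵀ * Matrix.of U) =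
      (Matrix.of U)ᵀ * Matrix.of U :=
  CFC.sqrt_mul_sqrt_self _ (gram_posSemidef U).nonneg

lemma sqrt_gram_posSemidef (U : Fin p → Fin κ → ℝ) :
    (CFC.sqrt ((Matrix.of U)ᵀ * Matrix.of U)).PosSemidef :=
  Matrix.nonneg_iff_posSemidef.mp (CFC.sqrt_nonneg _)

lemma sqrt_gram_transpose (U : Fin p → Fin κ → ℝ) :
    (CFC.sqrt ((Matrix.of U)ᵀ * Matrix.of U))ᵀ = CFC.sqrt ((Matrix.of U)ᵀ * Matrix.of U) := by
  have := (sqrt_gram_posSemidef U).isHermitian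
  rwa [Matrix.IsHermitian, Matrix.conjTranspose_eq_transpose_of_trivial] at this

lemma isUnit_det_sqrt_gram {U : Fin p → Fin κ → ℝ}
    (h : IsUnit ((Matrix.of U)ᵀ * Matrix.of U).det) :
    IsUnit (CFC.sqrt ((Matrix.of U)ᵀ * Matrix.of U)).det := by
  rw [← sqrt_gram_mul_self, Matrix.det_mul] at h
  exact isUnit_of_mul_isUnit_left h

/-- The columns of the frame are orthonormal. -/
lemma frame_transpose_mul_frame {U : Fin p → Fin κ → ℝ}
    (h : IsUnit ((Matrix.of U)ᵀ * Matrix.of U).det) : (frame U)ᵀ * frame U = 1 := by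
  have hR := isUnit_det_sqrt_gram h
  unfold frame
  rw [Matrix.transpose_mul, Matrix.transpose_nonsing_inv, sqrt_gram_transpose]
  set R := CFC.sqrt ((Matrix.of U)ᵀ * Matrix.of U) with hRdef
  have e : R⁻¹ * (Matrix.of U)ᵀ * (Matrix.of U * R⁻¹) =
      R⁻¹ * ((Matrix.of U)ᵀ * Matrix.of U) * R⁻¹ := by simp only [Matrix.mul_assoc]
  rw [e, ← sqrt_gram_mul_self, ← hRdef, ← Matrix.mul_assoc, Matrix.nonsing_inv_mul _ hR,
    Matrix.one_mul, Matrix.mul_nonsing_inv _ hR]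

/-- This projection no longer involves the square root, so the entries of the frame can be bounded
through the inverse Gram matrix alone. No invertibility is needed. -/
lemma frame_mul_frame_transpose (U : Fin p → Fin κ → ℝ) :
    frame U * (frame U)ᵀ = Matrix.of U * ((Matrix.of U)ᵀ * Matrix.of U)⁻¹ * (Matrix.of U)ᵀ := by
  unfold frame
  rw [Matrix.transpose_mul, Matrix.transpose_nonsing_inv, sqrt_gram_transpose]
  conv_rhs => rw [← sqrt_gram_mul_self, Matrix.mul_inv_rev]
  simp only [Matrix.mul_assoc]

/-- Each entry of the frame is controlled by the inverse Gram matrix. -/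
lemma sq_frame_le (U : Fin p → Fin κ → ℝ) (j : Fin p) (a : Fin κ) :
    frame U j a ^ 2 ≤ ∑ b, ∑ c, U j b * ((Matrix.of U)ᵀ * Matrix.of U)⁻¹ b c * U j c := by
  have h := congrFun (congrFun (frame_mul_frame_transpose U) j) j
  rw [Matrix.mul_apply] at h
  calc frame U j a ^ 2 = frame U j a * (frame U)ᵀ a j := by rw [Matrix.transpose_apply, pow_two]
    _ ≤ ∑ b, frame U j b * (frame U)ᵀ b j :=
        Finset.single_le_sum (f := fun b => frame U j b * (frame U)ᵀ b j)
          (fun b _ => by simpa using mul_self_nonneg _) (Finset.mem_univ a)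
    _ = _ := by
        rw [h, Matrix.mul_apply, Finset.sum_comm]
        refine Finset.sum_congr rfl fun c _ => ?_
        rw [Matrix.mul_apply, Finset.sum_mul]
        rfl

lemma isClosed_posSemidef :
    IsClosed {R : Fin κ → Fin κ → ℝ | (Matrix.of R).PosSemidef} := by
  have : {R : Fin κ → Fin κ → ℝ | (Matrix.of R).PosSemidef} =
      {R : Fin κ → Fin κ → ℝ | ∀ i j, R j i = R i j} ∩
        {R | ∀ x : Fin κ → ℝ, 0 ≤ ∑ i, x i * ∑ j, R i j * x j} := by
    ext R
    change (Matrix.of R).PosSemidef ↔ _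
    rw [Matrix.posSemidef_iff_dotProduct_mulVec, Matrix.IsHermitian, ← Matrix.ext_iff]
    simp [dotProduct, Matrix.mulVec]
  rw [this]
  refine IsClosed.inter ?_ ?_
  · simp only [Set.ofPred_forall]
    exact isClosed_iInter fun i => isClosed_iInter fun j =>
      isClosed_eq (by fun_prop) (by fun_prop)
  · simp only [Set.ofPred_forall]
    exact isClosed_iInter fun x => isClosed_le (by fun_prop) (by fun_prop)

/-- By uniqueness of the positive semidefinite root, the preimage of a closed set is the union over
`m` of the projections of the closed sets of pairs `(U, R)` with `R` in the compact `K m` and `R² =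
U'U`. Projection along a compact factor is closed. -/
lemma measurable_sqrt_gram : Measurable fun (U : Fin p → Fin κ → ℝ) (a b : Fin κ) =>
    CFC.sqrt ((Matrix.of U)ᵀ * Matrix.of U) a b := by
  refine measurable_of_isClosed fun F hF => ?_
  set K : ℕ → Set (Fin κ → Fin κ → ℝ) := fun m =>
    (F ∩ {R | (Matrix.of R).PosSemidef}) ∩ Metric.closedBall 0 m with hK
  have hKc : ∀ m, IsCompact (K m) := fun m =>
    (isCompact_closedBall _ _).inter_left (hF.inter isClosed_posSemidef)
  have hset : (fun (U : Fin p → Fin κ → ℝ) (a b : Fin κ) =>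
      CFC.sqrt ((Matrix.of U)ᵀ * Matrix.of U) a b) ⁻¹' F =
      ⋃ m, {U | ∃ R ∈ K m, Matrix.of R * Matrix.of R = (Matrix.of U)ᵀ * Matrix.of U} := by
    ext U
    simp only [Set.mem_preimage, Set.mem_iUnion]
    constructor
    · intro h
      set R : Fin κ → Fin κ → ℝ := fun a b => CFC.sqrt ((Matrix.of U)ᵀ * Matrix.of U) a b with hR
      obtain ⟨m, hm⟩ := exists_nat_ge ‖R‖
      exact ⟨m, R, ⟨⟨h, sqrt_gram_posSemidef U⟩, by simpa using hm⟩, sqrt_gram_mul_self U⟩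
    · rintro ⟨m, R, ⟨⟨hRF, hRP⟩, -⟩, hRR⟩
      have := CFC.sqrt_unique hRR (Matrix.PosSemidef.nonneg hRP)
      rw [this]
      exact hRF
  rw [hset]
  refine MeasurableSet.iUnion fun m => IsClosed.measurableSet ?_
  have : CompactSpace (K m) := isCompact_iff_compactSpace.mp (hKc m)
  have hC : IsClosed {x : (Fin p → Fin κ → ℝ) × K m | ∀ a b,
      ∑ c, x.2.1 a c * x.2.1 c b = ∑ j, x.1 j a * x.1 j b} := by
    simp only [Set.ofPred_forall]
    refine isClosed_iInter fun a => isClosed_iInter fun b => isClosed_eq ?_ ?_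
    · refine continuous_finsetSum _ fun c _ => ?_
      have h2 : Continuous fun x : (Fin p → Fin κ → ℝ) × K m => x.2.1 :=
        continuous_subtype_val.comp continuous_snd
      have h3 : ∀ a c, Continuous fun x : (Fin p → Fin κ → ℝ) × K m => x.2.1 a c := fun a c =>
        (continuous_apply c).comp ((continuous_apply a).comp h2)
      exact (h3 a c).mul (h3 c b)
    · fun_prop
  convert! isClosedMap_fst_of_compactSpace _ hC using 1
  ext U
  simp only [Set.mem_image, Prod.exists, exists_and_right, exists_eq_right]
  constructor
  · rintro ⟨R, hR, h⟩
    refine ⟨⟨R, hR⟩, fun a b => ?_⟩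
    have := congrFun (congrFun h a) b
    simpa [Matrix.mul_apply] using this
  · rintro ⟨⟨R, hR⟩, h⟩
    refine ⟨R, hR, ?_⟩
    ext a b
    simpa [Matrix.mul_apply] using h a b

/-- Adjugate over determinant; this also holds at singular matrices, where both sides are 0. -/
lemma measurable_inv_entry (a b : Fin κ) :
    Measurable fun R : Fin κ → Fin κ → ℝ => (Matrix.of R)⁻¹ a b := by
  have h1 : Continuous fun R : Fin κ → Fin κ → ℝ => (Matrix.of R).det :=
    Continuous.matrix_det (by exact continuous_id)
  have h2 : Continuous fun R : Fin κ → Fin κ → ℝ => (Matrix.of R).adjugate a b :=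
    (Continuous.matrix_adjugate (A := fun R : Fin κ → Fin κ → ℝ => Matrix.of R)
      (by exact continuous_id)).matrix_elem a b
  have e : (fun R : Fin κ → Fin κ → ℝ => (Matrix.of R)⁻¹ a b) =
      fun R => ((Matrix.of R).det)⁻¹ * (Matrix.of R).adjugate a b := by
    ext R
    rw [Matrix.inv_def, Ring.inverse_eq_inv']
    rfl
  rw [e]
  exact h1.measurable.inv.mul h2.measurable

lemma measurable_frame (j : Fin p) (a : Fin κ) :
    Measurable fun U : Fin p → Fin κ → ℝ => frame U j a := by
  unfold frame
  simp only [Matrix.mul_apply]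
  refine Finset.measurable_fun_sum _ fun b _ => Measurable.mul ?_ ?_
  · exact (measurable_pi_apply b).comp (measurable_pi_apply j)
  · exact (measurable_inv_entry b a).comp measurable_sqrt_gram

end Frame

end

section

/-! ### Sub-Gaussian priors -/

section Prior

variable {m κ : ℕ} {π : Measure (Fin m → Fin κ → ℝ)} [IsProbabilityMeasure π]
  {D S : Matrix (Fin κ) (Fin κ) ℝ}

/-- A bound for the exponential moments of the entries of a sub-Gaussian prior. -/
def expBound (S : Matrix (Fin κ) (Fin κ) ℝ) : ℝ := ∑ a, 2 * Real.exp (1 / 2 * S a a)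

lemma expBound_nonneg (S : Matrix (Fin κ) (Fin κ) ℝ) : 0 ≤ expBound S :=
  Finset.sum_nonneg fun _ _ => by positivity

lemma measurable_entry (i : Fin m) (a : Fin κ) :
    Measurable fun T : Fin m → Fin κ → ℝ => T i a :=
  (measurable_pi_apply a).comp (measurable_pi_apply i)

/-- Test vectors `± e_a`: the quadratic form is `S a a` for both signs. Only these exponential
moments of the prior are used below. -/
lemma integral_exp_entry (h : IsSubGaussianPrior π D S) (i : Fin m) (a : Fin κ) (s : ℝ)
    (hs : s = 1 ∨ s = -1) :
    Integrable (fun T : Fin m → Fin κ → ℝ => Real.exp (s * T i a)) π ∧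
      ∫ T, Real.exp (s * T i a) ∂π ≤ Real.exp (1 / 2 * S a a) := by
  have hi : AEMeasurable (fun T : Fin m → Fin κ → ℝ => T i) π :=
    (measurable_pi_apply i).aemeasurable
  have h1 := (h.subGaussian i).integrable_exp (Pi.single a s)
  have h2 := (h.subGaussian i).mgf_le (Pi.single a s)
  simp only [single_dotProduct] at h1 h2
  have hm : AEStronglyMeasurable (fun x : Fin κ → ℝ => Real.exp (s * x a)) (π.map fun T => T i) := by
    refine Measurable.aestronglyMeasurable ?_
    fun_prop
  rw [integrable_map_measure hm hi] at h1
  rw [integral_map hi hm] at h2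
  refine ⟨h1, h2.trans (le_of_eq ?_)⟩
  congr 2
  rcases hs with rfl | rfl <;> simp

lemma exp_abs_le (x : ℝ) : Real.exp |x| ≤ Real.exp (1 * x) + Real.exp (-1 * x) := by
  rcases abs_cases x with ⟨h, -⟩ | ⟨h, -⟩ <;> rw [h]
  · rw [one_mul]; linarith [Real.exp_pos (-1 * x)]
  · rw [neg_one_mul]; linarith [Real.exp_pos (1 * x)]

lemma integrable_exp_abs_entry (h : IsSubGaussianPrior π D S) (i : Fin m) (a : Fin κ) :
    Integrable (fun T : Fin m → Fin κ → ℝ => Real.exp |T i a|) π := by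
  have h1 := (integral_exp_entry h i a 1 (Or.inl rfl)).1
  have h2 := (integral_exp_entry h i a (-1) (Or.inr rfl)).1
  refine (h1.add h2).mono' ?_ (ae_of_all _ fun T => ?_)
  · have := measurable_entry (m := m) i a
    exact (Real.measurable_exp.comp this.abs).aestronglyMeasurable
  · rw [Real.norm_of_nonneg (Real.exp_pos _).le]
    exact exp_abs_le _

lemma integral_exp_abs_entry_le (h : IsSubGaussianPrior π D S) (i : Fin m) (a : Fin κ) :
    ∫ T, Real.exp |T i a| ∂π ≤ 2 * Real.exp (1 / 2 * S a a) := by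
  have h1 := integral_exp_entry h i a 1 (Or.inl rfl)
  have h2 := integral_exp_entry h i a (-1) (Or.inr rfl)
  calc ∫ T, Real.exp |T i a| ∂π ≤ ∫ T, (Real.exp (1 * T i a) + Real.exp (-1 * T i a)) ∂π :=
        integral_mono (integrable_exp_abs_entry h i a) (h1.1.add h2.1) fun T => exp_abs_le _
    _ = ∫ T, Real.exp (1 * T i a) ∂π + ∫ T, Real.exp (-1 * T i a) ∂π := integral_add h1.1 h2.1
    _ ≤ _ := by linarith [h1.2, h2.2]

/-- Markov's inequality for `exp |T i a|`. The exponential tail is weaker than the Gaussian one but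
enough for a union bound at `u = 2 log n`. -/
lemma measureReal_entry_gt_le (h : IsSubGaussianPrior π D S) (i : Fin m) (a : Fin κ) (u : ℝ) :
    π.real {T | u < |T i a|} ≤ 2 * Real.exp (1 / 2 * S a a) * Real.exp (-u) := by
  have h1 := mul_meas_ge_le_integral_of_nonneg (μ := π)
    (f := fun T : Fin m → Fin κ → ℝ => Real.exp |T i a|)
    (ae_of_all _ fun T => (Real.exp_pos _).le) (integrable_exp_abs_entry h i a) (Real.exp u)
  have h2 : π.real {T | u < |T i a|} ≤ π.real {T | Real.exp u ≤ Real.exp |T i a|} := by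
    refine measureReal_mono fun T hT => ?_
    exact Real.exp_le_exp.mpr (le_of_lt hT)
  have h3 := h1.trans (integral_exp_abs_entry_le h i a)
  rw [Real.exp_neg, ← div_eq_mul_inv, le_div_iff₀ (Real.exp_pos _), mul_comm]
  exact (mul_le_mul_of_nonneg_left h2 (Real.exp_pos _).le).trans h3

lemma measureReal_exists_entry_gt_le (h : IsSubGaussianPrior π D S) (u : ℝ) :
    π.real {T | ∃ i a, u < |T i a|} ≤ m * expBound S * Real.exp (-u) := by
  have : {T : Fin m → Fin κ → ℝ | ∃ i a, u < |T i a|} = ⋃ i, ⋃ a, {T | u < |T i a|} := by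
    ext T; simp
  rw [this]
  refine (measureReal_iUnion_fintype_le _).trans ?_
  calc _ ≤ ∑ _i : Fin m, expBound S * Real.exp (-u) := by
        refine Finset.sum_le_sum fun i _ => (measureReal_iUnion_fintype_le _).trans ?_
        rw [expBound, Finset.sum_mul]
        exact Finset.sum_le_sum fun a _ => measureReal_entry_gt_le h i a u
    _ = _ := by simp; ring

lemma pow_four_le_exp (x : ℝ) : x ^ 4 ≤ 24 * Real.exp |x| := by
  have := Real.pow_div_factorial_le_exp |x| (abs_nonneg x) 4
  rw [div_le_iff₀ (by positivity)] at this
  have e : |x| ^ 4 = x ^ 4 := by rw [← abs_pow, abs_of_nonneg (by positivity)]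
  rw [e] at this
  simp [Nat.factorial] at this
  linarith

lemma memLp_entry (h : IsSubGaussianPrior π D S) (i : Fin m) (a : Fin κ) :
    MemLp (fun T : Fin m → Fin κ → ℝ => T i a) 2 π := by
  rw [memLp_two_iff_integrable_sq (measurable_entry i a).aestronglyMeasurable]
  refine ((integrable_exp_abs_entry h i a).const_mul 2).mono'
    ((measurable_entry i a).pow_const 2).aestronglyMeasurable (ae_of_all _ fun T => ?_)
  rw [Real.norm_of_nonneg (sq_nonneg _)]
  have := Real.pow_div_factorial_le_exp |T i a| (abs_nonneg _) 2
  rw [sq_abs] at this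
  simp [Nat.factorial] at this
  linarith

lemma sq_mul_le_exp (x y : ℝ) : (x * y) ^ 2 ≤ 12 * (Real.exp |x| + Real.exp |y|) := by
  have h1 := pow_four_le_exp x
  have h2 := pow_four_le_exp y
  nlinarith [sq_nonneg (x ^ 2 - y ^ 2)]

lemma memLp_entry_mul (h : IsSubGaussianPrior π D S) (i : Fin m) (a b : Fin κ) :
    MemLp (fun T : Fin m → Fin κ → ℝ => T i a * T i b) 2 π := by
  have hm : Measurable fun T : Fin m → Fin κ → ℝ => T i a * T i b :=
    (measurable_entry i a).mul (measurable_entry i b)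
  rw [memLp_two_iff_integrable_sq hm.aestronglyMeasurable]
  refine (((integrable_exp_abs_entry h i a).add (integrable_exp_abs_entry h i b)).const_mul 12).mono'
    (hm.pow_const 2).aestronglyMeasurable (ae_of_all _ fun T => ?_)
  rw [Real.norm_of_nonneg (sq_nonneg _)]
  exact sq_mul_le_exp _ _

lemma integral_entry_mul (h : IsSubGaussianPrior π D S) (i : Fin m) (a b : Fin κ) :
    ∫ T, T i a * T i b ∂π = D a b := by
  have h1 := covariance_eq_sub (memLp_entry h i a) (memLp_entry h i b)
  rw [h.cov_eq] at h1
  have hmean : ∀ a, ∫ T, T i a ∂π = 0 := by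
    intro a
    have := (h.subGaussian i).mean_zero a
    rwa [integral_map (measurable_pi_apply i).aemeasurable (by
      refine Measurable.aestronglyMeasurable ?_
      fun_prop)] at this
  rw [hmean, hmean, mul_zero, sub_zero] at h1
  exact h1.symm

/-- Fourth moments are dominated by exponential ones; the resulting constant depends on neither `n`
nor the row. -/
lemma variance_entry_mul_le (h : IsSubGaussianPrior π D S) (i : Fin m) (a b : Fin κ) :
    Var[fun T : Fin m → Fin κ → ℝ => T i a * T i b; π] ≤ 24 * expBound S := by
  refine (variance_le_expectation_sq (memLp_entry_mul h i a b).aestronglyMeasurable).trans ?_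
  have hle : ∀ a, 2 * Real.exp (1 / 2 * S a a) ≤ expBound S := fun a =>
    Finset.single_le_sum (f := fun a => 2 * Real.exp (1 / 2 * S a a))
      (fun _ _ => by positivity) (Finset.mem_univ a)
  calc ∫ T, (T i a * T i b) ^ 2 ∂π
      ≤ ∫ T, 12 * (Real.exp |T i a| + Real.exp |T i b|) ∂π :=
        integral_mono (memLp_entry_mul h i a b).integrable_sq
          (((integrable_exp_abs_entry h i a).add (integrable_exp_abs_entry h i b)).const_mul 12)
          fun T => sq_mul_le_exp _ _
    _ = 12 * (∫ T, Real.exp |T i a| ∂π + ∫ T, Real.exp |T i b| ∂π) := by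
        rw [integral_const_mul, integral_add (integrable_exp_abs_entry h i a)
          (integrable_exp_abs_entry h i b)]
    _ ≤ _ := by
        have h1 := (integral_exp_abs_entry_le h i a).trans (hle a)
        have h2 := (integral_exp_abs_entry_le h i b).trans (hle b)
        linarith

/-- Chebyshev's inequality for a sum of pairwise independent random variables. -/
lemma measureReal_sum_ge_le {Ω : Type*} [MeasurableSpace Ω] {P : Measure Ω}
    [IsProbabilityMeasure P] {X : Fin m → Ω → ℝ} (hmem : ∀ i, MemLp (X i) 2 P)
    (hind : Pairwise fun i j => X i ⟂ᵢ[P] X j) {d V r : ℝ} (hd : ∀ i, ∫ ω, X i ω ∂P = d)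
    (hV : ∀ i, Var[X i; P] ≤ V) (hr : 0 < r) :
    P.real {ω | r ≤ |∑ i, X i ω - m * d|} ≤ m * V / r ^ 2 := by
  have hvar := IndepFun.variance_sum (s := Finset.univ) (fun i _ => hmem i) (hind.set_pairwise _)
  have hsum : MemLp (∑ i, X i) 2 P := memLp_finsetSum' _ fun i _ => hmem i
  have hmean : P[∑ i, X i] = m * d := by
    simp only [Finset.sum_apply]
    rw [integral_finsetSum _ fun i _ => (hmem i).integrable (by norm_num)]
    simp [hd]
  have hch := meas_ge_le_variance_div_sq hsum hr
  rw [hmean, hvar] at hch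
  simp only [Finset.sum_apply] at hch
  have hV0 : 0 ≤ ∑ i, Var[X i; P] := Finset.sum_nonneg fun i _ => variance_nonneg _ _
  refine (ENNReal.toReal_le_of_le_ofReal (div_nonneg hV0 (sq_nonneg r)) hch).trans ?_
  gcongr
  calc ∑ i, Var[X i; P] ≤ ∑ _i : Fin m, V := Finset.sum_le_sum fun i _ => hV i
    _ = _ := by simp

lemma measureReal_gram_entry_le (h : IsSubGaussianPrior π D S) (a b : Fin κ) {r : ℝ}
    (hr : 0 < r) :
    π.real {T | r ≤ |∑ i, T i a * T i b - m * D a b|} ≤ m * (24 * expBound S) / r ^ 2 := by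
  have hf : Measurable fun x : Fin κ → ℝ => x a * x b :=
    (measurable_pi_apply a).mul (measurable_pi_apply b)
  exact measureReal_sum_ge_le (X := fun i (T : Fin m → Fin κ → ℝ) => T i a * T i b)
    (fun i => memLp_entry_mul h i a b) (fun i j hij => (h.indep.indepFun hij).comp hf hf)
    (fun i => integral_entry_mul h i a b) (fun i => variance_entry_mul_le h i a b) hr

/-- The typical matrices: bounded entries, and a Gram matrix close to its mean. -/
def typical (m : ℕ) (D : Matrix (Fin κ) (Fin κ) ℝ) (u η : ℝ) : Set (Fin m → Fin κ → ℝ) :=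
  {T | (∀ i a, |T i a| ≤ u) ∧ ∀ a b, |∑ i, T i a * T i b - m * D a b| < m * η}

lemma measurableSet_typical (D : Matrix (Fin κ) (Fin κ) ℝ) (u η : ℝ) :
    MeasurableSet (typical m D u η) := by
  have h1 : MeasurableSet {T : Fin m → Fin κ → ℝ | ∀ i a, |T i a| ≤ u} := by
    simp only [Set.ofPred_forall]
    exact MeasurableSet.iInter fun i => MeasurableSet.iInter fun a =>
      measurableSet_le (measurable_entry i a).abs measurable_const
  have h2 : MeasurableSet {T : Fin m → Fin κ → ℝ |
      ∀ a b, |∑ i, T i a * T i b - m * D a b| < m * η} := by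
    simp only [Set.ofPred_forall]
    refine MeasurableSet.iInter fun a => MeasurableSet.iInter fun b =>
      measurableSet_lt (Measurable.abs (Measurable.sub_const ?_ _)) measurable_const
    exact Finset.measurable_fun_sum _ fun i _ => (measurable_entry i a).mul (measurable_entry i b)
  exact h1.inter h2

lemma measureReal_compl_typical_le (h : IsSubGaussianPrior π D S) (hm : 0 < m) {u η : ℝ}
    (hη : 0 < η) :
    π.real (typical m D u η)ᶜ ≤ m * expBound S * Real.exp (-u) +
      κ * (κ * (24 * expBound S / (m * η ^ 2))) := by
  have hm' : (0 : ℝ) < m := by exact_mod_cast hm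
  have hsub : (typical m D u η)ᶜ ⊆ {T | ∃ i a, u < |T i a|} ∪
      ⋃ a, ⋃ b, {T | m * η ≤ |∑ i, T i a * T i b - m * D a b|} := by
    intro T hT
    by_contra hcon
    simp only [Set.mem_union, Set.mem_ofPred_eq, Set.mem_iUnion, not_or, not_exists, not_lt,
      not_le] at hcon
    exact hT hcon
  refine (measureReal_mono hsub).trans ((measureReal_union_le _ _).trans ?_)
  refine add_le_add (measureReal_exists_entry_gt_le h u) ?_
  refine (measureReal_iUnion_fintype_le _).trans ?_
  calc _ ≤ ∑ _a : Fin κ, ((κ : ℝ) * (24 * expBound S / (m * η ^ 2))) := by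
        refine Finset.sum_le_sum fun a _ => (measureReal_iUnion_fintype_le _).trans ?_
        calc _ ≤ ∑ _b : Fin κ, (24 * expBound S / (m * η ^ 2)) := by
              refine Finset.sum_le_sum fun b _ => ?_
              refine (measureReal_gram_entry_le h a b (by positivity)).trans (le_of_eq ?_)
              field_simp
          _ = _ := by simp
    _ = _ := by simp

end Prior

/-- Sub-Gaussian priors put almost all their mass on typical matrices. -/
lemma tendsto_compl_typical {c : ℝ} (hc : 0 < c) {m : ℕ → ℕ}
    (hm : Tendsto (fun n => (m n : ℝ) / (n : ℝ)) atTop (𝓝 c)) {κ : ℕ}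
    {π : ∀ n, Measure (Fin (m n) → Fin κ → ℝ)} [∀ n, IsProbabilityMeasure (π n)]
    {D S : Matrix (Fin κ) (Fin κ) ℝ} (h : ∀ n, IsSubGaussianPrior (π n) D S) :
    Tendsto (fun n : ℕ => (π n).real
      (typical (m n) D (2 * Real.log n) ((n : ℝ) ^ (-(1 / 4) : ℝ)))ᶜ) atTop (𝓝 0) := by
  have h1 : Tendsto (fun n : ℕ => (n : ℝ) ^ (-(1 / 2) : ℝ)) atTop (𝓝 0) :=
    (tendsto_rpow_neg_atTop (by norm_num)).comp tendsto_natCast_atTop_atTop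
  have h2 : Tendsto (fun n : ℕ => (n : ℝ) ^ (-1 : ℝ)) atTop (𝓝 0) :=
    (tendsto_rpow_neg_atTop (by norm_num)).comp tendsto_natCast_atTop_atTop
  have hlim : Tendsto (fun n : ℕ => (c + 1) * expBound S * (n : ℝ) ^ (-1 : ℝ) +
      κ * (κ * (24 * expBound S / (c / 2))) * (n : ℝ) ^ (-(1 / 2) : ℝ)) atTop (𝓝 0) := by
    simpa using (h2.const_mul ((c + 1) * expBound S)).add
      (h1.const_mul (κ * (κ * (24 * expBound S / (c / 2)))))
  refine squeeze_zero' (Eventually.of_forall fun n => measureReal_nonneg) ?_ hlim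
  filter_upwards [eventually_le_mul_p hc hm, hm.eventually_lt_const (lt_add_one c),
    eventually_gt_atTop 0] with n hlow hup hn
  have hn' : (0 : ℝ) < n := by exact_mod_cast hn
  have hm' : (0 : ℝ) < m n := lt_of_lt_of_le (by positivity) hlow
  have hm0 : 0 < m n := by exact_mod_cast hm'
  have hη : 0 < (n : ℝ) ^ (-(1 / 4) : ℝ) := Real.rpow_pos_of_pos hn' _
  rw [div_lt_iff₀ hn'] at hup
  have hE := expBound_nonneg S
  refine (measureReal_compl_typical_le (h n) hm0 hη).trans (add_le_add ?_ ?_)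
  -- The level `2 log n` gives tails of order `n ^ (-2)`, which beats the union over at most `(c +
  -- 1) n` rows.
  · have e : Real.exp (-(2 * Real.log n)) = (n : ℝ) ^ (-1 : ℝ) * (n : ℝ) ^ (-1 : ℝ) := by
      rw [← Real.rpow_add hn', Real.rpow_def_of_pos hn']
      congr 1; ring
    rw [e, Real.rpow_neg_one]
    calc (m n : ℝ) * expBound S * ((n : ℝ)⁻¹ * (n : ℝ)⁻¹)
        ≤ ((c + 1) * n) * expBound S * ((n : ℝ)⁻¹ * (n : ℝ)⁻¹) := by gcongr
      _ = _ := by field_simp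
  -- Chebyshev's bound is of order `1 / (m η ^ 2)`; with `η = n ^ (-1/4)` it is of order `n ^
  -- (-1/2)`.
  · have e : ((n : ℝ) ^ (-(1 / 4) : ℝ)) ^ 2 = (n : ℝ) ^ (-(1 / 2) : ℝ) := by
      rw [← Real.rpow_natCast, ← Real.rpow_mul hn'.le]; norm_num
    have e2 : (n : ℝ) ^ (-(1 / 2) : ℝ) * (n : ℝ) ^ (-(1 / 2) : ℝ) * n = 1 := by
      rw [← Real.rpow_add hn', ← Real.rpow_add_one hn'.ne']; norm_num
    have hx : 0 < (n : ℝ) ^ (-(1 / 2) : ℝ) := Real.rpow_pos_of_pos hn' _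
    rw [e, mul_assoc (κ : ℝ), mul_assoc (κ : ℝ)]
    gcongr
    rw [div_mul_eq_mul_div, div_le_div_iff₀ (by positivity) (by positivity)]
    have : c / 2 ≤ (n : ℝ) ^ (-(1 / 2) : ℝ) * (m n * (n : ℝ) ^ (-(1 / 2) : ℝ)) := by
      calc c / 2 = (n : ℝ) ^ (-(1 / 2) : ℝ) * ((c / 2 * n) * (n : ℝ) ^ (-(1 / 2) : ℝ)) := by
            linear_combination (-(c / 2)) * e2
        _ ≤ _ := by gcongr
    calc 24 * expBound S * (c / 2) ≤ 24 * expBound S *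
          ((n : ℝ) ^ (-(1 / 2) : ℝ) * (m n * (n : ℝ) ^ (-(1 / 2) : ℝ))) := by gcongr
      _ = _ := by ring

end

section

/-! ### From polynomials back to random matrices -/

section Noise

open MvPolynomial

variable {n p l : ℕ}

lemma map_curry_gaussPi :
    (gaussPi (Fin n × Fin p)).map (fun x i j => x (i, j)) = noise n p := by
  have h := Measure.infinitePi_map_curry (fun (_ : Fin n) (_ : Fin p) => gaussianReal 0 1)
  simp only [Measure.infinitePi_eq_pi] at h
  exact h

lemma measurePreserving_curry_gaussPi :
    MeasurePreserving (fun (x : Fin n × Fin p → ℝ) i j => x (i, j)) (gaussPi (Fin n × Fin p))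
      (noise n p) :=
  ⟨by fun_prop, map_curry_gaussPi⟩

lemma integral_noise {f : (Fin n → Fin p → ℝ) → ℂ} (hf : Measurable f) :
    ∫ z, f z ∂noise n p = ∫ x, f (fun i j => x (i, j)) ∂gaussPi (Fin n × Fin p) := by
  rw [← measurePreserving_curry_gaussPi.map_eq, integral_map
    measurePreserving_curry_gaussPi.measurable.aemeasurable hf.aestronglyMeasurable]

lemma continuous_bicycleVec (γ : ℝ) (μ : ℕ → ℝ) (k : Fin l → ℕ) :
    Continuous fun X : Fin n → Fin p → ℝ => bicycleVec γ μ k X := by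
  unfold bicycleVec bicycle
  refine (PiLp.continuous_toLp 2 _).comp (continuous_pi fun r => ?_)
  fun_prop

lemma inner_bicycleVec (γ : ℝ) (μ : ℕ → ℝ) (k : Fin l → ℕ) (X : Fin n → Fin p → ℝ)
    (t : EuclideanSpace ℝ (Fin l)) :
    inner ℝ (bicycleVec γ μ k X) t = ∑ r, t r * (cycleSd γ (k r))⁻¹ *
      (bicycle (k r) X - (if k r = 1 then (p : ℝ) else 0) - μ (k r)) := by
  rw [PiLp.inner_apply]
  refine Finset.sum_congr rfl fun r _ => ?_
  simp only [bicycleVec, cycleSd, RCLike.inner_apply, conj_trivial]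
  ring

lemma inner_bicycleVec_zero (γ : ℝ) (k : Fin l → ℕ) (x : Fin n × Fin p → ℝ)
    (t : EuclideanSpace ℝ (Fin l)) :
    inner ℝ (bicycleVec γ (fun _ => 0) k fun i j => x (i, j)) t =
      eval x (cyclePoly n p (fun r => t r * (cycleSd γ (k r))⁻¹) k) := by
  rw [inner_bicycleVec, cyclePoly, map_sum]
  simp [eval_bicyclePoly]

lemma measurable_cexp_inner_bicycleVec (γ : ℝ) (μ : ℕ → ℝ) (k : Fin l → ℕ)
    (t : EuclideanSpace ℝ (Fin l)) : Measurable fun X : Fin n → Fin p → ℝ =>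
      Complex.exp ((inner ℝ (bicycleVec γ μ k X) t : ℝ) * Complex.I) := by
  have := continuous_bicycleVec (n := n) (p := p) γ μ k
  exact Continuous.measurable (by fun_prop)

lemma integral_cexp_bicycleVec_zero (γ : ℝ) (k : Fin l → ℕ) (t : EuclideanSpace ℝ (Fin l)) :
    ∫ z, Complex.exp ((inner ℝ (bicycleVec γ (fun _ => 0) k z) t : ℝ) * Complex.I) ∂noise n p =
      expE (cyclePoly n p (fun r => t r * (cycleSd γ (k r))⁻¹) k) 1 1 := by
  rw [integral_noise (measurable_cexp_inner_bicycleVec _ _ _ _)]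
  simp [inner_bicycleVec_zero, expE]

lemma norm_cexp_sub_cexp_le (x y : ℝ) :
    ‖Complex.exp (x * Complex.I) - Complex.exp (y * Complex.I)‖ ≤ |x - y| := by
  have e : Complex.exp (x * Complex.I) - Complex.exp (y * Complex.I) =
      Complex.exp (y * Complex.I) * (Complex.exp (Complex.I * ((x - y : ℝ) : ℂ)) - 1) := by
    rw [mul_sub, ← Complex.exp_add, mul_one]
    congr 2; push_cast; ring
  rw [e, norm_mul, Complex.norm_exp_ofReal_mul_I, one_mul]
  exact Real.norm_exp_I_mul_ofReal_sub_one_le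

/-- The effect of a deterministic signal on the characteristic function of the cycles. -/
lemma norm_integral_cexp_signal_sub_le {γ : ℝ} (hγ : 0 < γ) (μ : ℕ → ℝ) (k : Fin l → ℕ)
    [∀ r, NeZero (k r)] (S : Fin n → Fin p → ℝ) (t : EuclideanSpace ℝ (Fin l)) :
    ‖∫ z, Complex.exp ((inner ℝ (bicycleVec γ μ k fun i j => S i j + z i j) t : ℝ) * Complex.I)
        ∂noise n p -
      ∫ z, Complex.exp ((inner ℝ (bicycleVec γ (fun _ => 0) k z) t : ℝ) * Complex.I) ∂noise n p‖ ≤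
      ∑ r, |t r| * ((cycleSd γ (k r))⁻¹ * √(gaussE (crossPoly (k r) (fun e => S e.1 e.2) ^ 2)) +
        (cycleSd γ (k r))⁻¹ * |bicycle (k r) S - μ (k r)|) := by
  have hm : Measurable fun z : Fin n → Fin p → ℝ => Complex.exp
      ((inner ℝ (bicycleVec γ μ k fun i j => S i j + z i j) t : ℝ) * Complex.I) :=
    (measurable_cexp_inner_bicycleVec γ μ k t).comp (by fun_prop)
  have hint : ∀ f : (Fin n × Fin p → ℝ) → ℝ, Measurable f →
      Integrable (fun x => Complex.exp ((f x : ℝ) * Complex.I)) (gaussPi (Fin n × Fin p)) := by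
    intro f hf
    refine Integrable.of_bound (C := 1) ?_ (ae_of_all _ fun x => ?_)
    · exact (Complex.measurable_exp.comp
        ((Complex.measurable_ofReal.comp hf).mul_const _)).aestronglyMeasurable
    · rw [Complex.norm_exp_ofReal_mul_I]
  have hV : ∀ ν : ℕ → ℝ, Continuous fun X : Fin n → Fin p → ℝ => bicycleVec γ ν k X :=
    fun ν => continuous_bicycleVec γ ν k
  have hm1 : Measurable fun x : Fin n × Fin p → ℝ =>
      (inner ℝ (bicycleVec γ μ k fun i j => S i j + x (i, j)) t : ℝ) := by
    refine Continuous.measurable (Continuous.inner ((hV μ).comp ?_) continuous_const)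
    fun_prop
  have hm2 : Measurable fun x : Fin n × Fin p → ℝ =>
      (inner ℝ (bicycleVec γ (fun _ => 0) k fun i j => x (i, j)) t : ℝ) := by
    refine Continuous.measurable (Continuous.inner ((hV fun _ => 0).comp ?_) continuous_const)
    fun_prop
  rw [integral_noise hm, integral_noise (measurable_cexp_inner_bicycleVec _ _ _ _),
    ← integral_sub (hint _ hm1) (hint _ hm2)]
  refine (norm_integral_le_integral_norm _).trans ?_
  have hterm : ∀ r, Integrable (fun x => |t r| * ((cycleSd γ (k r))⁻¹ *
      |eval x (crossPoly (k r) fun e => S e.1 e.2)| +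
        (cycleSd γ (k r))⁻¹ * |bicycle (k r) S - μ (k r)|)) (gaussPi (Fin n × Fin p)) := fun r =>
    ((((integrable_eval _).abs.const_mul _).add (integrable_const _)).const_mul _)
  calc _ ≤ ∫ x, ∑ r, |t r| * ((cycleSd γ (k r))⁻¹ *
      |eval x (crossPoly (k r) fun e => S e.1 e.2)| +
        (cycleSd γ (k r))⁻¹ * |bicycle (k r) S - μ (k r)|) ∂gaussPi (Fin n × Fin p) := by
        refine integral_mono ((hint _ hm1).sub (hint _ hm2)).norm
          (integrable_finsetSum _ fun r _ => hterm r) fun x => ?_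
        refine (norm_cexp_sub_cexp_le _ _).trans ?_
        rw [inner_bicycleVec, inner_bicycleVec, ← Finset.sum_sub_distrib]
        refine (Finset.abs_sum_le_sum_abs _ _).trans (Finset.sum_le_sum fun r _ => ?_)
        have hb := bicycle_add_eq (k r) (fun e => S e.1 e.2) x
        simp only at hb
        rw [hb, eval_bicyclePoly]
        have hs : 0 < (cycleSd γ (k r))⁻¹ := inv_pos.mpr (cycleSd_pos hγ (k r))
        rw [show ∀ A B c m E s t : ℝ, t * s * (A + B + E - c - m) - t * s * (B - c - 0) =
          t * (s * (E + (A - m))) by intros; ring, abs_mul, abs_mul, abs_of_pos hs, ← mul_add]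
        gcongr
        exact abs_add_le _ _
    _ = ∑ r, |t r| * ((cycleSd γ (k r))⁻¹ *
        ∫ x, |eval x (crossPoly (k r) fun e => S e.1 e.2)| ∂gaussPi (Fin n × Fin p) +
        (cycleSd γ (k r))⁻¹ * |bicycle (k r) S - μ (k r)|) := by
        rw [integral_finsetSum _ fun r _ => hterm r]
        refine Finset.sum_congr rfl fun r _ => ?_
        rw [integral_const_mul, integral_add ((integrable_eval _).abs.const_mul _)
          (integrable_const _), integral_const_mul]
        simp
    _ ≤ _ := by
        refine Finset.sum_le_sum fun r _ => ?_
        have hs : 0 < (cycleSd γ (k r))⁻¹ := inv_pos.mpr (cycleSd_pos hγ (k r))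
        gcongr
        exact integral_abs_eval_le_sqrt _

end Noise

/-- A conditional estimate that holds on a set of large probability. -/
lemma norm_integral_prod_sub_le {Y Z : Type*} [MeasurableSpace Y] [MeasurableSpace Z]
    {ρ : Measure Y} {ν : Measure Z} [IsProbabilityMeasure ρ] [IsProbabilityMeasure ν]
    {F : Y × Z → ℂ} (hF : Measurable F) (hF1 : ∀ w, ‖F w‖ ≤ 1) {c : ℂ} (hc : ‖c‖ ≤ 1)
    {G : Set Y} (hG : MeasurableSet G) {ε : ℝ} (hε : 0 ≤ ε)
    (h : ∀ y ∈ G, ‖∫ z, F (y, z) ∂ν - c‖ ≤ ε) :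
    ‖∫ w, F w ∂ρ.prod ν - c‖ ≤ ε + 2 * ρ.real Gᶜ := by
  have hI : Integrable F (ρ.prod ν) :=
    Integrable.of_bound hF.aestronglyMeasurable 1 (ae_of_all _ hF1)
  have hI' : Integrable (fun y => ∫ z, F (y, z) ∂ν - c) ρ :=
    hI.integral_prod_left.sub (integrable_const c)
  have e : ∫ w, F w ∂ρ.prod ν - c = ∫ y, (∫ z, F (y, z) ∂ν - c) ∂ρ := by
    rw [integral_prod _ hI, integral_sub hI.integral_prod_left (integrable_const c)]
    simp
  rw [e]
  refine (norm_integral_le_integral_norm _).trans ?_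
  have hind : Integrable (Gᶜ.indicator fun _ => (2 : ℝ)) ρ :=
    (integrable_const _).indicator hG.compl
  calc _ ≤ ∫ y, (ε + Gᶜ.indicator (fun _ => (2 : ℝ)) y) ∂ρ := by
        refine integral_mono hI'.norm ((integrable_const ε).add hind) fun y => ?_
        by_cases hy : y ∈ G
        · simpa [hy] using h y hy
        · have h1 : ‖∫ z, F (y, z) ∂ν‖ ≤ 1 := by
            simpa using norm_integral_le_of_norm_le_const (μ := ν) (C := 1)
              (ae_of_all _ fun z => hF1 (y, z))
          have h2 := norm_sub_le (∫ z, F (y, z) ∂ν) c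
          simp only [Set.mem_compl_iff, hy, not_false_eq_true, Set.indicator_of_mem]
          linarith
    _ = _ := by
        rw [integral_add (integrable_const ε) hind, integral_indicator hG.compl]
        simp [mul_comm, measureReal_def]

/-- Lévy's continuity theorem; the limit is the characteristic function of the standard Gaussian
vector at `t`. -/
lemma tendstoInDistribution_of_integral_cexp {l : ℕ} {Ω : ℕ → Type*}
    [∀ n, MeasurableSpace (Ω n)] {P : ∀ n, Measure (Ω n)} [∀ n, IsProbabilityMeasure (P n)]
    {V : ∀ n, Ω n → EuclideanSpace ℝ (Fin l)} (hV : ∀ n, Measurable (V n))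
    (h : ∀ t : EuclideanSpace ℝ (Fin l), Tendsto
      (fun n => ∫ ω, Complex.exp ((inner ℝ (V n ω) t : ℝ) * Complex.I) ∂P n) atTop
      (𝓝 (Complex.exp ((-((∑ r, t r ^ 2) / 2) : ℝ))))) :
    TendstoInDistribution V atTop id P (stdGaussian (EuclideanSpace ℝ (Fin l))) where
  forall_aemeasurable n := (hV n).aemeasurable
  tendsto := by
    refine ProbabilityMeasure.tendsto_of_tendsto_charFun fun t => ?_
    simp only [ProbabilityMeasure.coe_mk, Measure.map_id, charFun_stdGaussian]
    have e : ∀ n, charFun ((P n).map (V n)) t =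
        ∫ ω, Complex.exp ((inner ℝ (V n ω) t : ℝ) * Complex.I) ∂P n := by
      intro n
      rw [charFun_apply, integral_map (hV n).aemeasurable]
      exact Continuous.aestronglyMeasurable (by fun_prop)
    simp_rw [e]
    convert! h t using 3
    rw [← Complex.ofReal_pow, EuclideanSpace.real_norm_sq_eq]
    push_cast; ring

end

section

/-! ### The spiked models -/

section Typical

variable {m κ : ℕ} {D : Matrix (Fin κ) (Fin κ) ℝ} {u η : ℝ} {T : Fin m → Fin κ → ℝ}

lemma abs_gram_sub_lt (hT : T ∈ typical m D u η) (hm : 0 < m) (a b : Fin κ) :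
    |((1 / (m : ℝ)) • ((Matrix.of T)ᵀ * Matrix.of T)) a b - D a b| < η := by
  have hm' : (0 : ℝ) < m := by exact_mod_cast hm
  have h := hT.2 a b
  rw [← mul_lt_mul_iff_right₀ hm', ← abs_of_pos hm', ← abs_mul, abs_of_pos hm']
  convert! h using 2
  simp only [Matrix.smul_apply, Matrix.mul_apply, Matrix.transpose_apply, Matrix.of_apply,
    smul_eq_mul]
  field_simp

attribute [local instance] Matrix.linftyOpNormedRing

lemma norm_gram_sub_le (hT : T ∈ typical m D u η) (hm : 0 < m) (hη : 0 ≤ η) :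
    ‖(1 / (m : ℝ)) • ((Matrix.of T)ᵀ * Matrix.of T) - D‖ ≤ κ * η :=
  norm_le_of_entry_le _ hη fun a b => (abs_gram_sub_lt hT hm a b).le

lemma norm_mul_sub_mul_le (A B A₀ B₀ : Matrix (Fin κ) (Fin κ) ℝ) {δ : ℝ}
    (hA : ‖A - A₀‖ ≤ δ) (hB : ‖B - B₀‖ ≤ δ) : ‖A * B - A₀ * B₀‖ ≤ δ * (‖B₀‖ + δ + ‖A₀‖) := by
  have e : A * B - A₀ * B₀ = (A - A₀) * B₀ + (A - A₀) * (B - B₀) + A₀ * (B - B₀) := by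
    noncomm_ring
  have hδ : 0 ≤ δ := (norm_nonneg _).trans hA
  rw [e]
  refine (norm_add₃_le).trans ?_
  calc _ ≤ ‖A - A₀‖ * ‖B₀‖ + ‖A - A₀‖ * ‖B - B₀‖ + ‖A₀‖ * ‖B - B₀‖ := by
        gcongr <;> exact norm_mul_le _ _
    _ ≤ δ * ‖B₀‖ + δ * δ + ‖A₀‖ * δ := by gcongr
    _ = _ := by ring

lemma abs_mul_transpose_le {n p : ℕ} {T : Matrix (Fin n) (Fin κ) ℝ} {W : Matrix (Fin p) (Fin κ) ℝ}
    {u w : ℝ} (hT : ∀ i a, |T i a| ≤ u) (hW : ∀ j a, |W j a| ≤ w) (i : Fin n) (j : Fin p) :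
    |(T * Wᵀ) i j| ≤ κ * (u * w) := by
  rw [Matrix.mul_apply]
  refine (Finset.abs_sum_le_sum_abs _ _).trans ?_
  calc _ ≤ ∑ _a : Fin κ, u * w := by
        refine Finset.sum_le_sum fun a _ => ?_
        rw [abs_mul]
        exact mul_le_mul (hT i a) (hW j a) (abs_nonneg _) ((abs_nonneg _).trans (hT i a))
    _ = _ := by simp

/-- Determinant and inverse are continuous at the invertible matrix `C`. On typical `U` this makes
the Gram matrix invertible and bounds its inverse. -/
lemma exists_inv_entry_bound {C : Matrix (Fin κ) (Fin κ) ℝ} (hC : C.det ≠ 0) :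
    ∃ δ > 0, ∃ B, 0 ≤ B ∧ ∀ A : Matrix (Fin κ) (Fin κ) ℝ, (∀ a b, |A a b - C a b| < δ) →
      IsUnit A.det ∧ ∀ a b, |A⁻¹ a b| ≤ B := by
  have hdet : Continuous fun R : Fin κ → Fin κ → ℝ => (Matrix.of R).det :=
    Continuous.matrix_det (by exact continuous_id)
  have hadj : Continuous fun R : Fin κ → Fin κ → ℝ => (Matrix.of R).adjugate :=
    Continuous.matrix_adjugate (by exact continuous_id)
  have hinv : ∀ a b, ContinuousAt (fun R : Fin κ → Fin κ → ℝ => (Matrix.of R)⁻¹ a b) C := by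
    intro a b
    simp only [Matrix.inv_def, Ring.inverse_eq_inv', Matrix.smul_apply, smul_eq_mul]
    exact (hdet.continuousAt.inv₀ hC).mul (hadj.matrix_elem a b).continuousAt
  set B : ℝ := ∑ a, ∑ b, (|C⁻¹ a b| + 1)
  have hB : ∀ a b, |C⁻¹ a b| < B := fun a b => calc
    |C⁻¹ a b| < |C⁻¹ a b| + 1 := lt_add_one _
    _ ≤ ∑ b, (|C⁻¹ a b| + 1) := Finset.single_le_sum (f := fun b => |C⁻¹ a b| + 1)
        (fun _ _ => by positivity) (Finset.mem_univ b)
    _ ≤ B := Finset.single_le_sum (f := fun a => ∑ b, (|C⁻¹ a b| + 1))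
        (fun _ _ => by positivity) (Finset.mem_univ a)
  have h1 : ∀ᶠ R in 𝓝 (C : Fin κ → Fin κ → ℝ), (Matrix.of R).det ≠ 0 :=
    hdet.continuousAt.eventually_ne hC
  have h2 : ∀ᶠ R in 𝓝 (C : Fin κ → Fin κ → ℝ), ∀ a b, |(Matrix.of R)⁻¹ a b| < B :=
    eventually_all.mpr fun a => eventually_all.mpr fun b =>
      (hinv a b).abs.eventually_lt_const (hB a b)
  obtain ⟨δ, hδ, hball⟩ := Metric.eventually_nhds_iff.mp (h1.and h2)
  refine ⟨δ, hδ, B, Finset.sum_nonneg fun _ _ => Finset.sum_nonneg fun _ _ => by positivity,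
    fun A hA => ?_⟩
  have := hball (y := fun a b => A a b) ((dist_pi_lt_iff hδ).mpr fun a =>
    (dist_pi_lt_iff hδ).mpr fun b => hA a b)
  exact ⟨isUnit_iff_ne_zero.mpr this.1, fun a b => (this.2 a b).le⟩

/-- The entries of the frame are small as soon as the Gram matrix is well conditioned. -/
lemma abs_frame_le {p : ℕ} {U : Fin p → Fin κ → ℝ} {u B : ℝ} (hp : 0 < p) (hB : 0 ≤ B)
    (hU : ∀ j a, |U j a| ≤ u)
    (hinv : ∀ a b, |((1 / (p : ℝ)) • ((Matrix.of U)ᵀ * Matrix.of U))⁻¹ a b| ≤ B)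
    (hdet : IsUnit ((1 / (p : ℝ)) • ((Matrix.of U)ᵀ * Matrix.of U)).det) (j : Fin p) (a : Fin κ) :
    |frame U j a| ≤ κ * (u * (√B / √p)) := by
  have hp' : (0 : ℝ) < p := by exact_mod_cast hp
  have hu : 0 ≤ u := (abs_nonneg _).trans (hU j a)
  set A := (1 / (p : ℝ)) • ((Matrix.of U)ᵀ * Matrix.of U) with hA
  have hgram : (Matrix.of U)ᵀ * Matrix.of U = (p : ℝ) • A := by
    rw [hA, smul_smul, mul_one_div_cancel hp'.ne', one_smul]
  have hi : ∀ b c, |((Matrix.of U)ᵀ * Matrix.of U)⁻¹ b c| ≤ B / p := by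
    intro b c
    have e : ((p : ℝ) • A)⁻¹ = (p : ℝ)⁻¹ • A⁻¹ := by
      refine Matrix.inv_eq_right_inv ?_
      rw [Matrix.smul_mul, Matrix.mul_smul, smul_smul, mul_inv_cancel₀ hp'.ne', one_smul,
        Matrix.mul_nonsing_inv _ hdet]
    rw [hgram, e, Matrix.smul_apply, smul_eq_mul, abs_mul, abs_of_pos (inv_pos.mpr hp'),
      inv_mul_eq_div]
    gcongr
    exact hinv b c
  refine abs_le_of_sq_le_sq ?_ (by positivity)
  refine (sq_frame_le U j a).trans ?_
  calc _ ≤ ∑ _b : Fin κ, ∑ _c : Fin κ, u * (B / p) * u := by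
        refine Finset.sum_le_sum fun b _ => Finset.sum_le_sum fun c _ => (le_abs_self _).trans ?_
        rw [abs_mul, abs_mul]
        have h1 := hU j b
        have h2 := hU j c
        have h3 := hi b c
        gcongr
    _ = _ := by
        simp only [Finset.sum_const, Finset.card_univ, Fintype.card_fin, nsmul_eq_mul]
        rw [mul_pow, mul_pow, div_pow, Real.sq_sqrt hB, Real.sq_sqrt hp'.le]
        ring

end Typical

lemma measureReal_compl_prod_le {A B : Type*} [MeasurableSpace A] [MeasurableSpace B]
    {μ : Measure A} {ν : Measure B} [IsProbabilityMeasure μ] [IsProbabilityMeasure ν]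
    (s : Set A) (t : Set B) : (μ.prod ν).real (s ×ˢ t)ᶜ ≤ μ.real sᶜ + ν.real tᶜ := by
  rw [Set.compl_prod_eq_union]
  refine (measureReal_union_le _ _).trans (le_of_eq ?_)
  rw [measureReal_prod_prod, measureReal_prod_prod]
  simp

/-! ### Limit laws for pure noise and for a small random signal plus noise -/

section Limits

variable {γ : ℝ} {p : ℕ → ℕ} {l : ℕ} {k : ℕ → Fin l → ℕ}

/-- One logarithm comes from `Θ` and one from the loadings; the third absorbs the constant and the
ratio of `n` to `p`. -/
lemma eventually_const_mul_log_sq_le (hγ : 0 < γ)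
    (hp : Tendsto (fun n => (p n : ℝ) / (n : ℝ)) atTop (𝓝 γ)) (c : ℝ) :
    ∀ᶠ n : ℕ in atTop, c * Real.log n ^ 2 / √(p n) ≤ Real.log n ^ 3 / √n := by
  filter_upwards [eventually_le_mul_p hγ hp, eventually_le_log (c / √(γ / 2)),
    eventually_gt_atTop 0] with n h1 h2 hn
  have hn' : (0 : ℝ) < n := by exact_mod_cast hn
  have hp' : (0 : ℝ) < p n := lt_of_lt_of_le (by positivity) h1
  have hs : 0 < √(γ / 2) := Real.sqrt_pos.mpr (by positivity)
  have h3 : √(γ / 2) * √n ≤ √(p n) := by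
    rw [← Real.sqrt_mul (by positivity)]
    exact Real.sqrt_le_sqrt h1
  have hL : 0 ≤ Real.log n := Real.log_natCast_nonneg n
  rw [div_le_iff₀ hs] at h2
  rw [div_le_div_iff₀ (Real.sqrt_pos.mpr hp') (Real.sqrt_pos.mpr hn')]
  calc c * Real.log n ^ 2 * √n ≤ (Real.log n * √(γ / 2)) * Real.log n ^ 2 * √n := by gcongr
    _ = Real.log n ^ 3 * (√(γ / 2) * √n) := by ring
    _ ≤ _ := by gcongr

variable [∀ n r, NeZero (k n r)]

theorem tendstoInDistribution_noise (hγ : 0 < γ)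
    (hp : Tendsto (fun n => (p n : ℝ) / (n : ℝ)) atTop (𝓝 γ))
    (hk_inj : ∀ n, Function.Injective (k n))
    (hk_small : ∀ r, (fun n => (k n r : ℝ)) =o[atTop] fun n => √(Real.log (n : ℝ)))
    (hk_ratio : ∀ r, Tendsto (fun n => (k n r : ℝ) * ((p n : ℝ) / (n : ℝ) - γ)) atTop (𝓝 0)) :
    TendstoInDistribution (fun n => bicycleVec (n := n) (p := p n) γ (fun _ => 0) (k n))
      atTop id (fun n => noise n (p n)) (stdGaussian (EuclideanSpace ℝ (Fin l))) := by
  refine tendstoInDistribution_of_integral_cexp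
    (fun n => (continuous_bicycleVec _ _ _).measurable) fun t => ?_
  simp_rw [integral_cexp_bicycleVec_zero]
  exact tendsto_expE_cyclePoly hγ hp hk_inj hk_small hk_ratio t

attribute [local instance] Matrix.linftyOpNormedRing

/-- A small random signal whose normalized traces of powers are almost deterministic only shifts
the signed cycles. -/
theorem tendsto_integral_cexp_signal (hγ : 0 < γ)
    (hp : Tendsto (fun n => (p n : ℝ) / (n : ℝ)) atTop (𝓝 γ))
    (hk_inj : ∀ n, Function.Injective (k n))
    (hk_small : ∀ r, (fun n => (k n r : ℝ)) =o[atTop] fun n => √(Real.log (n : ℝ)))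
    (hk_ratio : ∀ r, Tendsto (fun n => (k n r : ℝ) * ((p n : ℝ) / (n : ℝ) - γ)) atTop (𝓝 0))
    {Y : ℕ → Type*} [∀ n, MeasurableSpace (Y n)] {ρ : ∀ n, Measure (Y n)}
    [∀ n, IsProbabilityMeasure (ρ n)] {s : ∀ n, Y n → Matrix (Fin n) (Fin (p n)) ℝ}
    (hs : ∀ n i j, Measurable fun y => s n y i j) {G : ∀ n, Set (Y n)}
    (hG : ∀ n, MeasurableSet (G n)) (hG0 : Tendsto (fun n => (ρ n).real (G n)ᶜ) atTop (𝓝 0))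
    (hent : ∀ᶠ n : ℕ in atTop, ∀ y ∈ G n, ∀ i j, |s n y i j| ≤ Real.log n ^ 3 / √n)
    {κ : ℕ} {D : Matrix (Fin κ) (Fin κ) ℝ} {μ : ℕ → ℝ} (hμ : ∀ m, [NeZero m] → μ m = (D ^ m).trace)
    {c : ℝ} (hc : 0 < c)
    (htr : ∀ᶠ n : ℕ in atTop, ∀ y ∈ G n, ∃ Γ : Matrix (Fin κ) (Fin κ) ℝ,
      ‖Γ - D‖ ≤ Real.log n * (n : ℝ) ^ (-c) ∧ ∀ m, [NeZero m] →
        1 / (n : ℝ) ^ m * ((s n y * (s n y)ᵀ) ^ m).trace = (Γ ^ m).trace)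
    (t : EuclideanSpace ℝ (Fin l)) :
    Tendsto (fun n => ∫ w, Complex.exp ((inner ℝ (bicycleVec γ μ (k n)
        fun i j => s n w.1 i j + w.2 i j) t : ℝ) * Complex.I) ∂(ρ n).prod (noise n (p n))) atTop
      (𝓝 (Complex.exp ((-((∑ r, t r ^ 2) / 2) : ℝ)))) := by
  have hnull := tendsto_expE_cyclePoly hγ hp hk_inj hk_small hk_ratio t
  simp_rw [← integral_cexp_bicycleVec_zero] at hnull
  -- The three errors given a typical signal: mixed terms, repeated indices in the pure signal term,
  -- and deviation of the Gram matrices from their limits.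
  set ε : ℕ → ℝ := fun n => ∑ r, |t r| * (Real.log n ^ (14 * k n r) * (n : ℝ) ^ (-(1 / 2) : ℝ) +
    (Real.log n ^ (11 * k n r) * (n : ℝ) ^ (-1 : ℝ) + Real.log n ^ (5 * k n r) * (n : ℝ) ^ (-c)))
    with hεdef
  have hε : Tendsto ε atTop (𝓝 0) := by
    rw [show (0 : ℝ) = ∑ r, |t r| * (0 + (0 + 0)) by simp]
    refine tendsto_finsetSum _ fun r _ => Tendsto.const_mul _ ?_
    exact (tendsto_log_pow_mul_rpow (hk_small r) 14 (by norm_num)).add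
      ((tendsto_log_pow_mul_rpow (hk_small r) 11 (by norm_num)).add
        (tendsto_log_pow_mul_rpow (hk_small r) 5 hc))
  have hε0 : ∀ n, 0 ≤ ε n := fun n => Finset.sum_nonneg fun r _ => by
    have := Real.log_natCast_nonneg n
    positivity
  have hev1 := eventually_all.mpr fun r =>
    eventually_cross_le (k := fun n => k n r) hγ hp (hk_small r)
  have hev2 := eventually_all.mpr fun r =>
    eventually_bicycle_signal_le (k := fun n => k n r) hγ hp (hk_small r)
  have hev3 := eventually_all.mpr fun r =>
    eventually_trace_le (k := fun n => k n r) hγ D (hk_small r) hc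
  refine tendsto_of_tendsto_of_dist hnull ?_
  have hlim : Tendsto (fun n => ε n + 2 * (ρ n).real (G n)ᶜ) atTop (𝓝 0) := by
    simpa using hε.add (hG0.const_mul 2)
  refine squeeze_zero' (Eventually.of_forall fun n => dist_nonneg) ?_ hlim
  filter_upwards [hev1, hev2, hev3, hent, htr] with n h1 h2 h3 h4 h5
  rw [dist_comm, dist_eq_norm]
  refine norm_integral_prod_sub_le ?_ (fun w => ?_) ?_ (hG n) (hε0 n) fun y hy => ?_
  · refine (measurable_cexp_inner_bicycleVec γ μ (k n) t).comp ?_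
    refine measurable_pi_lambda _ fun i => measurable_pi_lambda _ fun j => ?_
    exact ((hs n i j).comp measurable_fst).add (by fun_prop)
  · rw [Complex.norm_exp_ofReal_mul_I]
  · simpa using norm_integral_le_of_norm_le_const (μ := noise n (p n)) (C := 1)
      (ae_of_all _ fun z => (Complex.norm_exp_ofReal_mul_I
        (inner ℝ (bicycleVec γ (fun _ => 0) (k n) z) t)).le)
  · refine (norm_integral_cexp_signal_sub_le hγ μ (k n) (fun i j => s n y i j) t).trans ?_
    obtain ⟨Γ, hΓ, hΓtr⟩ := h5 y hy
    refine Finset.sum_le_sum fun r _ => mul_le_mul_of_nonneg_left ?_ (abs_nonneg _)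
    refine add_le_add (h1 r _ fun e => h4 y hy e.1 e.2) ?_
    have h6 := h2 r (s n y) (h4 y hy)
    have h7 := h3 r Γ hΓ
    rw [hΓtr] at h6
    rw [hμ]
    refine le_trans ?_ (add_le_add h6 h7)
    rw [← mul_add]
    exact mul_le_mul_of_nonneg_left (abs_sub_le _ _ _) (inv_pos.mpr (cycleSd_pos hγ _)).le

end Limits

end

/-! ### The two spiked models -/

section Models

variable {γ : ℝ} {p : ℕ → ℕ} {l : ℕ} {k : ℕ → Fin l → ℕ} [∀ n r, NeZero (k n r)] {κ : ℕ}

/-- Reassociating the triple lets the noise be integrated first, with `(Θ, U)` frozen. -/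
lemma integral_jointLaw {n p : ℕ} {πΘ : Measure (Fin n → Fin κ → ℝ)}
    {πU : Measure (Fin p → Fin κ → ℝ)} [IsProbabilityMeasure πΘ] [IsProbabilityMeasure πU]
    {F : (Fin n → Fin κ → ℝ) × (Fin p → Fin κ → ℝ) × (Fin n → Fin p → ℝ) → ℂ}
    (hF : Measurable F) :
    ∫ ω, F ω ∂jointLaw πΘ πU =
      ∫ w, F (w.1.1, w.1.2, w.2) ∂(πΘ.prod πU).prod (noise n p) := by
  rw [jointLaw, ← Measure.prodAssoc_prod, integral_map
    MeasurableEquiv.prodAssoc.measurable.aemeasurable hF.aestronglyMeasurable]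
  rfl

attribute [local instance] Matrix.linftyOpNormedRing

/-- The limit law of the signed cycles of `Θ W' + Z`, for loadings `W` that are a function of the
prior matrix `U`. -/
theorem tendstoInDistribution_spiked (hγ : 0 < γ)
    (hp : Tendsto (fun n => (p n : ℝ) / (n : ℝ)) atTop (𝓝 γ))
    (hk_inj : ∀ n, Function.Injective (k n))
    (hk_small : ∀ r, (fun n => (k n r : ℝ)) =o[atTop] fun n => √(Real.log (n : ℝ)))
    (hk_ratio : ∀ r, Tendsto (fun n => (k n r : ℝ) * ((p n : ℝ) / (n : ℝ) - γ)) atTop (𝓝 0))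
    {CΘ SΘ CU SU : Matrix (Fin κ) (Fin κ) ℝ}
    {πΘ : ∀ n : ℕ, Measure (Fin n → Fin κ → ℝ)} {πU : ∀ n : ℕ, Measure (Fin (p n) → Fin κ → ℝ)}
    [∀ n, IsProbabilityMeasure (πΘ n)] [∀ n, IsProbabilityMeasure (πU n)]
    (hΘ : ∀ n, IsSubGaussianPrior (πΘ n) CΘ SΘ) (hU : ∀ n, IsSubGaussianPrior (πU n) CU SU)
    {W : ∀ n, (Fin (p n) → Fin κ → ℝ) → Matrix (Fin (p n)) (Fin κ) ℝ}
    (hW : ∀ n j a, Measurable fun U => W n U j a)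
    {E : Matrix (Fin κ) (Fin κ) ℝ} {c d : ℝ}
    (hWent : ∀ᶠ n : ℕ in atTop,
      ∀ U ∈ typical (p n) CU (2 * Real.log n) ((n : ℝ) ^ (-(1 / 4) : ℝ)),
        (∀ j a, |W n U j a| ≤ c * Real.log n / √(p n)) ∧
        ‖(W n U)ᵀ * W n U - E‖ ≤ d * (n : ℝ) ^ (-(1 / 4) : ℝ))
    {μ : ℕ → ℝ} (hμ : ∀ m, [NeZero m] → μ m = ((E * CΘ) ^ m).trace) :
    TendstoInDistribution
      (fun n (ω : (Fin n → Fin κ → ℝ) × (Fin (p n) → Fin κ → ℝ) × (Fin n → Fin (p n) → ℝ)) =>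
        bicycleVec γ μ (k n) fun i j => (Matrix.of ω.1 * (W n ω.2.1)ᵀ) i j + ω.2.2 i j)
      atTop id (fun n => jointLaw (πΘ n) (πU n)) (stdGaussian (EuclideanSpace ℝ (Fin l))) := by
  have hS : ∀ n i j, Measurable fun y : (Fin n → Fin κ → ℝ) × (Fin (p n) → Fin κ → ℝ) =>
      (Matrix.of y.1 * (W n y.2)ᵀ) i j := by
    intro n i j
    simp only [Matrix.mul_apply, Matrix.of_apply, Matrix.transpose_apply]
    exact Finset.measurable_fun_sum _ fun a _ => ((measurable_entry i a).comp measurable_fst).mul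
      ((hW n j a).comp measurable_snd)
  have hX : ∀ n, Measurable
      fun ω : (Fin n → Fin κ → ℝ) × (Fin (p n) → Fin κ → ℝ) × (Fin n → Fin (p n) → ℝ) =>
        fun i j => (Matrix.of ω.1 * (W n ω.2.1)ᵀ) i j + ω.2.2 i j := by
    intro n
    refine measurable_pi_lambda _ fun i => measurable_pi_lambda _ fun j => Measurable.add ?_ ?_
    · exact (hS n i j).comp (f := fun ω : (Fin n → Fin κ → ℝ) × (Fin (p n) → Fin κ → ℝ) ×
        (Fin n → Fin (p n) → ℝ) => (ω.1, ω.2.1)) (by fun_prop)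
    · fun_prop
  refine tendstoInDistribution_of_integral_cexp
    (fun n => (continuous_bicycleVec _ _ _).measurable.comp (hX n)) fun t => ?_
  have hint : ∀ n, ∫ ω, Complex.exp ((inner ℝ (bicycleVec γ μ (k n)
      fun i j => (Matrix.of ω.1 * (W n ω.2.1)ᵀ) i j + ω.2.2 i j) t : ℝ) * Complex.I)
        ∂jointLaw (πΘ n) (πU n) =
      ∫ w, Complex.exp ((inner ℝ (bicycleVec γ μ (k n)
        fun i j => (Matrix.of w.1.1 * (W n w.1.2)ᵀ) i j + w.2 i j) t : ℝ) * Complex.I)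
        ∂((πΘ n).prod (πU n)).prod (noise n (p n)) := fun n =>
    integral_jointLaw ((measurable_cexp_inner_bicycleVec γ μ (k n) t).comp (hX n))
  simp_rw [hint]
  set G : ∀ n : ℕ, Set ((Fin n → Fin κ → ℝ) × (Fin (p n) → Fin κ → ℝ)) := fun n =>
    typical n CΘ (2 * Real.log n) ((n : ℝ) ^ (-(1 / 4) : ℝ)) ×ˢ
      typical (p n) CU (2 * Real.log n) ((n : ℝ) ^ (-(1 / 4) : ℝ)) with hGdef
  have hid : Tendsto (fun n : ℕ => (n : ℝ) / (n : ℝ)) atTop (𝓝 1) :=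
    tendsto_const_nhds.congr' ((eventually_ne_atTop 0).mono fun n hn =>
      (div_self (Nat.cast_ne_zero.mpr hn)).symm)
  have hη1 : Tendsto (fun n : ℕ => (n : ℝ) ^ (-(1 / 4) : ℝ)) atTop (𝓝 0) :=
    (tendsto_rpow_neg_atTop (by norm_num)).comp tendsto_natCast_atTop_atTop
  refine tendsto_integral_cexp_signal hγ hp hk_inj hk_small hk_ratio
    (ρ := fun n => (πΘ n).prod (πU n)) (s := fun n y => Matrix.of y.1 * (W n y.2)ᵀ) hS
    (G := G) (fun n => (measurableSet_typical _ _ _).prod (measurableSet_typical _ _ _)) ?_ ?_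
    (D := E * CΘ) hμ (c := 1 / 4) (by norm_num) ?_ t
  · refine squeeze_zero (fun n => measureReal_nonneg) (fun n => measureReal_compl_prod_le _ _) ?_
    simpa using (tendsto_compl_typical one_pos hid hΘ).add (tendsto_compl_typical hγ hp hU)
  · filter_upwards [hWent, eventually_const_mul_log_sq_le hγ hp (κ * 2 * c)] with n h1 h2
    rintro ⟨T, U⟩ ⟨hT, hU'⟩ i j
    refine (abs_mul_transpose_le (T := Matrix.of T) hT.1 (h1 U hU').1 i j).trans
      (le_trans (le_of_eq ?_) h2)
    ring
  -- One constant for both Gram deviations, `d` for the loadings and `κ` for `Θ`; the extra `log n`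
  -- permitted in the target absorbs the constants of the product.
  · set d' := max d κ
    filter_upwards [hWent, eventually_gt_atTop 0,
      eventually_le_log (d' * (‖CΘ‖ + d' + ‖E‖)),
      hη1.eventually_le_const zero_lt_one] with n h1 hn hlog h2
    rintro ⟨T, U⟩ ⟨hT, hU'⟩
    have : NeZero n := ⟨hn.ne'⟩
    have hη0 : 0 ≤ (n : ℝ) ^ (-(1 / 4) : ℝ) := Real.rpow_nonneg n.cast_nonneg _
    refine ⟨(W n U)ᵀ * W n U * ((1 / (n : ℝ)) • ((Matrix.of T)ᵀ * Matrix.of T)), ?_,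
      fun m _ => trace_signal_pow m (Matrix.of T) (W n U)⟩
    have hd' : 0 ≤ d' := le_max_of_le_right κ.cast_nonneg
    refine (norm_mul_sub_mul_le _ _ _ _
      ((h1 U hU').2.trans (mul_le_mul_of_nonneg_right (le_max_left d κ) hη0))
      ((norm_gram_sub_le hT hn hη0).trans
        (mul_le_mul_of_nonneg_right (le_max_right d κ) hη0))).trans ?_
    calc d' * (n : ℝ) ^ (-(1 / 4) : ℝ) * (‖CΘ‖ + d' * (n : ℝ) ^ (-(1 / 4) : ℝ) + ‖E‖)
        ≤ d' * (n : ℝ) ^ (-(1 / 4) : ℝ) * (‖CΘ‖ + d' * 1 + ‖E‖) := by gcongr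
      _ = d' * (‖CΘ‖ + d' + ‖E‖) * (n : ℝ) ^ (-(1 / 4) : ℝ) := by ring
      _ ≤ _ := by gcongr

/-- The loadings are `U / √p`, whose Gram matrix is the empirical covariance of `U`, close to `CU`.
The product arises in the order `CU * CΘ`, which the trace does not see. -/
theorem tendstoInDistribution_unnormalized (hγ : 0 < γ)
    (hp : Tendsto (fun n => (p n : ℝ) / (n : ℝ)) atTop (𝓝 γ))
    (hk_inj : ∀ n, Function.Injective (k n))
    (hk_small : ∀ r, (fun n => (k n r : ℝ)) =o[atTop] fun n => √(Real.log (n : ℝ)))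
    (hk_ratio : ∀ r, Tendsto (fun n => (k n r : ℝ) * ((p n : ℝ) / (n : ℝ) - γ)) atTop (𝓝 0))
    {CΘ SΘ CU SU : Matrix (Fin κ) (Fin κ) ℝ}
    {πΘ : ∀ n : ℕ, Measure (Fin n → Fin κ → ℝ)} {πU : ∀ n : ℕ, Measure (Fin (p n) → Fin κ → ℝ)}
    [∀ n, IsProbabilityMeasure (πΘ n)] [∀ n, IsProbabilityMeasure (πU n)]
    (hΘ : ∀ n, IsSubGaussianPrior (πΘ n) CΘ SΘ) (hU : ∀ n, IsSubGaussianPrior (πU n) CU SU) :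
    TendstoInDistribution
      (fun n ω => bicycleVec γ (fun m => ((CΘ * CU) ^ m).trace) (k n) (dataUnnormalized ω))
      atTop id (fun n => jointLaw (πΘ n) (πU n)) (stdGaussian (EuclideanSpace ℝ (Fin l))) := by
  have key := tendstoInDistribution_spiked hγ hp hk_inj hk_small hk_ratio hΘ hU
    (W := fun n U => (1 / √(p n : ℝ)) • Matrix.of U)
    (fun n j a => (measurable_entry j a).const_mul _) (E := CU) (c := 2) (d := κ) ?_
    (μ := fun m => ((CΘ * CU) ^ m).trace) fun m _ => trace_mul_pow_comm CΘ CU m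
  · convert! key using 4 with n ω
    ext i j
    simp only [dataUnnormalized, Matrix.transpose_smul, Matrix.mul_smul, Matrix.smul_apply,
      smul_eq_mul]
  · filter_upwards [eventually_le_mul_p hγ hp, eventually_gt_atTop 0] with n h1 hn U hU'
    have hn' : (0 : ℝ) < n := by exact_mod_cast hn
    have hp' : (0 : ℝ) < p n := lt_of_lt_of_le (by positivity) h1
    refine ⟨fun j a => ?_, ?_⟩
    · rw [Matrix.smul_apply, smul_eq_mul, abs_mul, abs_of_nonneg (by positivity),
        one_div_mul_eq_div]
      exact div_le_div_of_nonneg_right (hU'.1 j a) (Real.sqrt_nonneg _)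
    · rw [Matrix.transpose_smul, Matrix.smul_mul, Matrix.mul_smul, smul_smul, div_mul_div_comm,
        one_mul, Real.mul_self_sqrt hp'.le]
      exact norm_gram_sub_le hU' (by exact_mod_cast hp') (Real.rpow_nonneg hn'.le _)

/-- The loadings are orthonormal as soon as `U'U` is invertible, so their Gram matrix is exactly 1
and `d = 0`. Positive definiteness of `CU` ensures this on typical `U` for large `n`, and keeps the
entries of the frame of order `log n / √p`. -/
theorem tendstoInDistribution_normalized (hγ : 0 < γ)
    (hp : Tendsto (fun n => (p n : ℝ) / (n : ℝ)) atTop (𝓝 γ))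
    (hk_inj : ∀ n, Function.Injective (k n))
    (hk_small : ∀ r, (fun n => (k n r : ℝ)) =o[atTop] fun n => √(Real.log (n : ℝ)))
    (hk_ratio : ∀ r, Tendsto (fun n => (k n r : ℝ) * ((p n : ℝ) / (n : ℝ) - γ)) atTop (𝓝 0))
    {CΘ SΘ CU SU : Matrix (Fin κ) (Fin κ) ℝ}
    {πΘ : ∀ n : ℕ, Measure (Fin n → Fin κ → ℝ)} {πU : ∀ n : ℕ, Measure (Fin (p n) → Fin κ → ℝ)}
    [∀ n, IsProbabilityMeasure (πΘ n)] [∀ n, IsProbabilityMeasure (πU n)]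
    (hΘ : ∀ n, IsSubGaussianPrior (πΘ n) CΘ SΘ) (hU : ∀ n, IsSubGaussianPrior (πU n) CU SU)
    (hCU : CU.PosDef) :
    TendstoInDistribution
      (fun n ω => bicycleVec γ (fun m => (CΘ ^ m).trace) (k n) (dataNormalized ω))
      atTop id (fun n => jointLaw (πΘ n) (πU n)) (stdGaussian (EuclideanSpace ℝ (Fin l))) := by
  obtain ⟨δ, hδ, B, hB, hinv⟩ := exists_inv_entry_bound hCU.det_pos.ne'
  refine tendstoInDistribution_spiked hγ hp hk_inj hk_small hk_ratio hΘ hU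
    (W := fun n U => frame U) (fun n j a => measurable_frame j a) (E := 1) (c := κ * 2 * √B)
    (d := 0) ?_ (μ := fun m => (CΘ ^ m).trace) fun m _ => by rw [one_mul]
  have hη1 : Tendsto (fun n : ℕ => (n : ℝ) ^ (-(1 / 4) : ℝ)) atTop (𝓝 0) :=
    (tendsto_rpow_neg_atTop (by norm_num)).comp tendsto_natCast_atTop_atTop
  filter_upwards [eventually_le_mul_p hγ hp, eventually_gt_atTop 0,
    hη1.eventually_le_const hδ] with n h1 hn h2 U hU'
  have hn' : (0 : ℝ) < n := by exact_mod_cast hn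
  have hp' : (0 : ℝ) < p n := lt_of_lt_of_le (by positivity) h1
  have hp0 : 0 < p n := by exact_mod_cast hp'
  obtain ⟨hdet, hbound⟩ := hinv _ fun a b => (abs_gram_sub_lt hU' hp0 a b).trans_le h2
  refine ⟨fun j a => (abs_frame_le hp0 hB hU'.1 hbound hdet j a).trans (le_of_eq (by ring)), ?_⟩
  rw [frame_transpose_mul_frame, sub_self, norm_zero, zero_mul]
  rw [Matrix.det_smul] at hdet
  exact isUnit_of_mul_isUnit_right hdet

end Models

end SpikedModel

end

theorem proposition2
    (γ : ℝ) (hγ : 0 < γ)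
    -- the number of columns, with `p / n → γ`
    (p : ℕ → ℕ) (hp : Tendsto (fun n => (p n : ℝ) / (n : ℝ)) atTop (𝓝 γ))
    -- the lengths `1 ≤ k_1(n) < … < k_l(n) = o(√log n)`
    (l : ℕ) (k : ℕ → Fin l → ℕ)
    (hk_pos : ∀ n r, 1 ≤ k n r) (hk_mono : ∀ n, StrictMono (k n))
    (hk_small : ∀ r, (fun n => (k n r : ℝ)) =o[atTop] fun n => √(Real.log (n : ℝ)))
    -- equivalent to `(p / n) ^ k_r(n) = (1 + o(1)) γ ^ k_r(n)`; automatic for fixed lengths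
    (hk_ratio : ∀ r, Tendsto (fun n => (k n r : ℝ) * ((p n : ℝ) / (n : ℝ) - γ)) atTop (𝓝 0)) :
    -- under the null hypothesis
    TendstoInDistribution
      (fun n => SpikedModel.bicycleVec (n := n) (p := p n) γ (fun _ => 0) (k n))
      atTop id (fun n => SpikedModel.noise n (p n)) (stdGaussian (EuclideanSpace ℝ (Fin l))) ∧
    -- under the alternatives
    ∀ (κ : ℕ) (CΘ SΘ CU SU : Matrix (Fin κ) (Fin κ) ℝ)
      (πΘ : ∀ n : ℕ, Measure (Fin n → Fin κ → ℝ))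
      (πU : ∀ n : ℕ, Measure (Fin (p n) → Fin κ → ℝ))
      [∀ n, IsProbabilityMeasure (πΘ n)] [∀ n, IsProbabilityMeasure (πU n)],
      (∀ n, SpikedModel.IsSubGaussianPrior (πΘ n) CΘ SΘ) →
      (∀ n, SpikedModel.IsSubGaussianPrior (πU n) CU SU) →
      -- the unnormalized model
      ((∀ m : ℕ, 1 ≤ m → SpikedModel.cyclicSum CΘ CU m = ((CΘ * CU) ^ m).trace) ∧
        TendstoInDistribution
          (fun n ω => SpikedModel.bicycleVec γ (fun m => ((CΘ * CU) ^ m).trace) (k n)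
            (SpikedModel.dataUnnormalized ω))
          atTop id (fun n => SpikedModel.jointLaw (πΘ n) (πU n))
          (stdGaussian (EuclideanSpace ℝ (Fin l)))) ∧
      -- the normalized model
      (CU.PosDef →
        TendstoInDistribution
          (fun n ω => SpikedModel.bicycleVec γ (fun m => (CΘ ^ m).trace) (k n)
            (SpikedModel.dataNormalized ω))
          atTop id (fun n => SpikedModel.jointLaw (πΘ n) (πU n))
          (stdGaussian (EuclideanSpace ℝ (Fin l)))) := by
  have : ∀ n r, NeZero (k n r) := fun n r => ⟨Nat.one_le_iff_ne_zero.mp (hk_pos n r)⟩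
  -- From the ordering, the argument needs only that the lengths are distinct.
  have hk_inj : ∀ n, Function.Injective (k n) := fun n => (hk_mono n).injective
  refine ⟨SpikedModel.tendstoInDistribution_noise hγ hp hk_inj hk_small hk_ratio, ?_⟩
  intro κ CΘ SΘ CU SU πΘ πU _ _ hΘ hU
  refine ⟨⟨fun m hm => ?_, ?_⟩, fun hCU => ?_⟩
  · have : NeZero m := ⟨Nat.one_le_iff_ne_zero.mp hm⟩
    exact SpikedModel.cyclicSum_eq_trace CΘ CU m
  · exact SpikedModel.tendstoInDistribution_unnormalized hγ hp hk_inj hk_small hk_ratio hΘ hU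
  · exact SpikedModel.tendstoInDistribution_normalized hγ hp hk_inj hk_small hk_ratio hΘ hU hCU
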